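/- **Circuit model.** Fix $d\ge 2$. A circuit acts on $w$ qudits of dimension $d$ and $c$ classical registers with values in $\{0,\dots,d-1\}$; some qudits are designated as inputs and some as outputs, every other qudit starts in $|0\rangle$ and every register in $0$. It is a finite sequence of layers of three kinds: (i) quantum gates on pairwise disjoint sets of qudits, each possibly classically controlled (applied iff a given register has a given value); (ii) computational-basis measurements of some qudits, with outcomes written to registers; (iii) simultaneous classical gates, each computing the new value of one register, registers being readable by arbitrarily many gates (unbounded classical fanout). Tracing out all registers and non-output qudits at the end, the circuit implements a quantum operation from its input to its output qudits. Its depth is the number of layers; its size is the number of qudits, registers, gates and measurements. For arities $a,b:\mathbb N\to\mathbb N$, a class below consists of all sequences $(\Phi_n)_{n\in\mathbb N}$ of quantum operations, $\Phi_n$ from $a(n)$ to $b(n)$ qudits, that are implemented exactly by circuits $(C_n)$ of depth $O(1)$ and size polynomial in $n$ (non-uniform), using the following gates: * in both classes: all one-qudit unitaries $U$, all singly controlled gates $|c\rangle|m\rangle\mapsto|c\rangle U^{c}|m\rangle$, and all classical gates of fan-in at most two; * in $\mathsf{i}\text{-}\mathsf{QTC}_d^0$, in addition: all multiply controlled one-qudit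 unitaries (apply $U$ to the target iff the control qudits are in a prescribed basis state) and all threshold gates $|x_0,x_1,\dots,x_m\rangle\mapsto|x_0+\mathsf{TH}_t(x_1,\dots,x_m)\bmod d,\,x_1,\dots,x_m\rangle$, where $\mathsf{TH}_t(x)=1$ if $\sum_i x_i\ge t$ (sum in $\mathbb N$) and $0$ otherwise; * in $\mathsf{i}\text{-}\mathsf{QNC}_d^0[q]_{\mathsf c}$, in addition: classical gates $\mathrm{MOD}_q$ of unbounded fan-in, with value $1$ if the sum of the inputs is $0$ modulo $q$ and $0$ otherwise. For an injective map $e:\{0,\dots,p-1\}\to\{0,1\}^k$ let $E_m$ be the isometry $|x_1,\dots,x_m\rangle\mapsto|e(x_1),\dots,e(x_m)\rangle$ from $m$ qudits of dimension $p$ to $mk$ qubits. **Theorem 3.10.** For any primes $p$ and $q$, $\ \mathsf{i}\text{-}\mathsf{QTC}_p^0\subseteq\mathsf{i}\text{-}\mathsf{QNC}_2^0[q]_{\mathsf c}$ under every fixed encoding of $p$-dimensional qudits into qubits. That is: for every $k$, every injective $e:\{0,\dots,p-1\}\to\{0,1\}^k$, all $a,b:\mathbb N\to\mathbb N$ and every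 sequence $(\Phi_n)$ in $\mathsf{i}\text{-}\mathsf{QTC}_p^0$, with $\Phi_n$ from $a(n)$ to $b(n)$ qudits, there is a sequence $(\Psi_n)$ in $\mathsf{i}\text{-}\mathsf{QNC}_2^0[q]_{\mathsf c}$, with $\Psi_n$ from $a(n)k$ to $b(n)k$ qubits, such that $$\Psi_n\big(E_{a(n)}\,\rho\,E_{a(n)}^\dagger\big)=E_{b(n)}\,\Phi_n(\rho)\,E_{b(n)}^\dagger$$ for all $n$ and all operators $\rho$ on $a(n)$ qudits of dimension $p$. -/

import Mathlib

open scoped Matrix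

namespace QuditCircuit

/-- Computational basis labels of a register of `w` qudits of dimension `d`
(also used for the contents of `w` classical `d`-ary registers). -/
abbrev Basis (d w : ℕ) : Type := Fin w → Fin d

/-- Operators on the Hilbert space of `w` qudits of dimension `d`, in the computational basis. -/
abbrev Op (d w : ℕ) : Type := Matrix (Basis d w) (Basis d w) ℂ

/-- Quantum gates on `w` wires carrying qudits of dimension `d`. -/
inductive QGate (d w : ℕ) : Type
  /-- An arbitrary one-qudit unitary `U` on wire `i`. -/
  | single (i : Fin w) (U : Matrix.unitaryGroup (Fin d) ℂ)
  /-- The singly controlled gate `|c⟩|m⟩ ↦ |c⟩ U ^ c |m⟩`, with control wire `j` and target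
  wire `i`. For qubits this is the usual controlled `U`. -/
  | ctrl (j i : Fin w) (hji : j ≠ i) (U : Matrix.unitaryGroup (Fin d) ℂ)
  /-- The multiply controlled gate that applies `U` to wire `i` exactly when every control wire
  `j ∈ T` is in the basis state `a j`. -/
  | multiCtrl (T : Finset (Fin w)) (a : Basis d w) (i : Fin w) (hi : i ∉ T)
      (U : Matrix.unitaryGroup (Fin d) ℂ)
  /-- The quantum threshold gate of unbounded fan-in: it adds `1` modulo `d` to wire `i` exactly
  when the sum (in `ℕ`) of the basis values of the wires in `T` is at least `t`. -/
  | threshold (T : Finset (Fin w)) (i : Fin w) (hi : i ∉ T) (t : ℕ)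

/-- The wires on which a gate acts. -/
def QGate.support {d w : ℕ} : QGate d w → Finset (Fin w)
  | .single i _ => {i}
  | .ctrl j i _ _ => {j, i}
  | .multiCtrl T _ i _ _ => insert i T
  | .threshold T i _ _ => insert i T

/-- The shift `|m⟩ ↦ |m + 1 mod d⟩`. -/
def shiftX (d : ℕ) [NeZero d] : Matrix (Fin d) (Fin d) ℂ :=
  Matrix.of fun x y => if x = y + 1 then 1 else 0

/-- The operator that sends `|y⟩` to the state in which the one-qudit operator `V y` has been
applied to wire `i` and the other wires are unchanged. -/
def onTarget {d w : ℕ} (i : Fin w) (V : Basis d w → Matrix (Fin d) (Fin d) ℂ) : Op d w :=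
  Matrix.of fun x y => if ∀ j, j ≠ i → x j = y j then V y (x i) (y i) else 0

/-- The operator of a gate on the whole register. -/
def QGate.toOp {d w : ℕ} [NeZero d] : QGate d w → Op d w
  | .single i U => onTarget i fun _ => (U : Matrix (Fin d) (Fin d) ℂ)
  | .ctrl j i _ U => onTarget i fun y => (U : Matrix (Fin d) (Fin d) ℂ) ^ (y j : ℕ)
  | .multiCtrl T a i _ U =>
      onTarget i fun y => if ∀ j ∈ T, y j = a j then (U : Matrix (Fin d) (Fin d) ℂ) else 1
  | .threshold T i _ t =>
      onTarget i fun y => if t ≤ ∑ j ∈ T, (y j : ℕ) then shiftX d else 1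

/-- Classical gates; each computes the new content of one register from the old contents of the
`c` classical registers. A register may be read by any number of gates (unbounded classical
fanout). -/
inductive CGate (d c : ℕ) : Type
  /-- Leave the register as it is. -/
  | keep
  /-- An arbitrary function of fan-in two. -/
  | bounded (r₁ r₂ : Fin c) (f : Fin d → Fin d → Fin d)
  /-- The gate `MOD_q` of unbounded fan-in: the value is `1` if the sum of the inputs is
  `0` modulo `q`, and `0` otherwise. -/
  | mod (q : ℕ) (T : Finset (Fin c))

/-- The value that a classical gate writes to register `r`. -/
def CGate.eval {d c : ℕ} [NeZero d] (s : Basis d c) (r : Fin c) : CGate d c → Fin d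
  | .keep => s r
  | .bounded r₁ r₂ f => f (s r₁) (s r₂)
  | .mod q T => if (∑ j ∈ T, (s j : ℕ)) % q = 0 then 1 else 0

/-- The number of gates: `keep` is a bare wire. -/
def CGate.cost {d c : ℕ} : CGate d c → ℕ
  | .keep => 0
  | .bounded _ _ _ => 1
  | .mod _ _ => 1

/-- One time step of a circuit with `w` qudits and `c` classical registers. -/
inductive Layer (d w c : ℕ) : Type
  /-- Quantum gates on pairwise disjoint sets of wires. A gate that comes with `some (r, v)` is
  classically controlled: it is applied exactly when register `r` contains `v`. -/
  | quantum (gs : List (Option (Fin c × Fin d) × QGate d w))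
      (hgs : gs.Pairwise fun g h => Disjoint g.2.support h.2.support)
  /-- Measurement in the computational basis: whenever `m r = some i`, wire `i` is measured and
  the outcome is written to register `r`. -/
  | measure (m : Fin c → Option (Fin w))
  /-- Simultaneous classical gates, `u r` writing to register `r`. -/
  | classical (u : Fin c → CGate d c)

/-- The number of gates (and measurements) of a layer. -/
def Layer.size {d w c : ℕ} : Layer d w c → ℕ
  | .quantum gs _ => gs.length
  | .measure m => ∑ r, if (m r).isSome then 1 else 0
  | .classical u => ∑ r, (u r).cost

/-- Joint states of the qudits and the classical registers: `σ s` is the unnormalized density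
operator of the qudits in the event that the classical registers contain `s`. -/
abbrev HybridState (d w c : ℕ) : Type := Basis d c → Op d w

/-- The operator of a possibly classically controlled gate, given the register contents. -/
def controlledOp {d w c : ℕ} [NeZero d] (s : Basis d c)
    (g : Option (Fin c × Fin d) × QGate d w) : Op d w :=
  match g.1 with
  | none => g.2.toOp
  | some (r, v) => if s r = v then g.2.toOp else 1

/-- The register contents after measuring the basis state `x`. -/
def record {d w c : ℕ} (m : Fin c → Option (Fin w)) (s : Basis d c) (x : Basis d w) :
    Basis d c :=
  fun r => match m r with
    | none => s r
    | some i => x i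

/-- The action of a layer on joint states. In a measurement the coherences between basis states
that differ on a measured wire vanish. -/
noncomputable def Layer.apply {d w c : ℕ} [NeZero d] (L : Layer d w c) (σ : HybridState d w c) :
    HybridState d w c :=
  match L with
  | .quantum gs _ => fun s =>
      let U : Op d w := (gs.map (controlledOp s)).prod
      U * σ s * Uᴴ
  | .measure m => fun s' => Matrix.of fun x y =>
      if ∀ r i, m r = some i → x i = y i then
        ∑ s : Basis d c, if record m s x = s' then σ s x y else 0
      else 0
  | .classical u => fun s' =>
      ∑ s : Basis d c, if (fun r => (u r).eval s r) = s' then σ s else 0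

/-- A circuit with `a` input qudits and `b` output qudits of dimension `d`, possibly using further
(auxiliary) qudits, classical registers, intermediate measurements and classical control. -/
structure Circuit (d a b : ℕ) where
  /-- The total number of qudits. -/
  width : ℕ
  /-- The number of classical registers. -/
  regs : ℕ
  /-- The wires of the input qudits. -/
  inp : Fin a ↪ Fin width
  /-- The wires of the output qudits. -/
  out : Fin b ↪ Fin width
  /-- The time steps, the first one first. -/
  layers : List (Layer d width regs)

/-- The depth is the number of time steps. -/
def Circuit.depth {d a b : ℕ} (C : Circuit d a b) : ℕ := C.layers.length

/-- The size is the number of wires and gates, quantum and classical. -/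
def Circuit.size {d a b : ℕ} (C : Circuit d a b) : ℕ :=
  C.width + C.regs + (C.layers.map Layer.size).sum

/-- The initial joint state: `ρ` on the input wires, `|0⟩` on the auxiliary wires, and `0` in the
classical registers. -/
noncomputable def Circuit.init {d a b : ℕ} [NeZero d] (C : Circuit d a b) (ρ : Op d a) :
    HybridState d C.width C.regs :=
  open Classical in
  fun s => Matrix.of fun x y =>
    if s = 0 ∧ ∀ i, i ∉ Set.range C.inp → x i = 0 ∧ y i = 0 then
      ρ (x ∘ C.inp) (y ∘ C.inp)
    else 0

/-- The state of the output wires; the other wires and the classical registers are traced out. -/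
noncomputable def Circuit.final {d a b : ℕ} (C : Circuit d a b)
    (σ : HybridState d C.width C.regs) : Op d b :=
  open Classical in
  Matrix.of fun u v => ∑ s : Basis d C.regs, ∑ x : Basis d C.width, ∑ y : Basis d C.width,
    if x ∘ C.out = u ∧ y ∘ C.out = v ∧ ∀ i, i ∉ Set.range C.out → x i = y i then
      σ s x y
    else 0

/-- The quantum operation from `a` qudits to `b` qudits that the circuit implements. -/
noncomputable def Circuit.channel {d a b : ℕ} [NeZero d] (C : Circuit d a b) (ρ : Op d a) :
    Op d b :=
  C.final (C.layers.foldl (fun σ L => L.apply σ) (C.init ρ))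

/-- What a class of circuits may use beyond one-qudit unitaries, singly controlled one-qudit
unitaries, measurements, classical control and classical gates of bounded fan-in. -/
structure GateSet where
  /-- Are multiply controlled one-qudit unitaries available? -/
  multiCtrl : Prop
  /-- Are quantum threshold gates available? -/
  threshold : Prop
  /-- The moduli `q` for which classical `MOD_q` gates are available. -/
  classicalMod : Set ℕ

def QGate.Allowed (G : GateSet) {d w : ℕ} : QGate d w → Prop
  | .single _ _ => True
  | .ctrl _ _ _ _ => True
  | .multiCtrl _ _ _ _ _ => G.multiCtrl
  | .threshold _ _ _ _ => G.threshold

def CGate.Allowed (G : GateSet) {d c : ℕ} : CGate d c → Prop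
  | .keep => True
  | .bounded _ _ _ => True
  | .mod q _ => q ∈ G.classicalMod

def Layer.Allowed (G : GateSet) {d w c : ℕ} : Layer d w c → Prop
  | .quantum gs _ => ∀ g ∈ gs, g.2.Allowed G
  | .measure _ => True
  | .classical u => ∀ r, (u r).Allowed G

/-- The families of quantum operations, the `n`-th one from `a n` to `b n` qudits of dimension `d`,
that are implemented by families of circuits of constant depth and polynomial size over `G`. -/
def ConstDepthPolySize (d : ℕ) [NeZero d] (G : GateSet) (a b : ℕ → ℕ) :
    Set ((n : ℕ) → Op d (a n) → Op d (b n)) :=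
  {Φ | ∃ (C : (n : ℕ) → Circuit d (a n) (b n)) (D : ℕ) (P : Polynomial ℕ),
    ∀ n, (∀ L ∈ (C n).layers, L.Allowed G) ∧ (C n).depth ≤ D ∧ (C n).size ≤ P.eval n ∧
      (C n).channel = Φ n}

/-- `i-QTC_d^0`: all one-qudit unitaries, their controlled and multiply controlled versions, and
quantum threshold gates. -/
def iQTC0 (d : ℕ) [NeZero d] (a b : ℕ → ℕ) : Set ((n : ℕ) → Op d (a n) → Op d (b n)) :=
  ConstDepthPolySize d ⟨True, True, ∅⟩ a b

/-- `i-QNC_d^0[q]_c`: all one-qudit unitaries and their singly controlled versions, with classical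
`MOD_q` gates. -/
def iQNC0c (d : ℕ) [NeZero d] (q : ℕ) (a b : ℕ → ℕ) :
    Set ((n : ℕ) → Op d (a n) → Op d (b n)) :=
  ConstDepthPolySize d ⟨False, False, {q}⟩ a b

/-- Replace every basis value in a string of qudits by its code word of `k` bits. -/
def encodeBasis {p k : ℕ} (e : Fin p → Basis 2 k) {m : ℕ} (x : Basis p m) : Basis 2 (m * k) :=
  fun i => e (x (finProdFinEquiv.symm i).1) (finProdFinEquiv.symm i).2

/-- The operator `E ρ E†` with `E |x⟩ = |e (x 0), …, e (x (m - 1))⟩`. -/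
noncomputable def encode {p k : ℕ} (e : Fin p → Basis 2 k) {m : ℕ} (ρ : Op p m) :
    Op 2 (m * k) :=
  Matrix.of fun X Y => ∑ x : Basis p m, ∑ y : Basis p m,
    if encodeBasis e x = X ∧ encodeBasis e y = Y then ρ x y else 0

end QuditCircuit

open scoped Matrix
set_option linter.unusedSectionVars false
set_option linter.unusedSimpArgs false
set_option synthInstance.maxSize 2000

namespace QuditCircuit

/-! Every `p`-level qudit is kept in one-hot code, one qubit for each basis value. A unitary on such
a block is a product of boundedly many two-level unitaries (`exists_twoLevel_list`), and a two-level
unitary becomes a CNOT, a controlled one-qubit gate and a CNOT (`blocks_cnot`, `blocks_ctrl`). So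
local unitaries on all blocks together cost constant depth (`exists_impl_blocks`). What remains is
to supply the unbounded fan-in of the multiply controlled gates and threshold gates.

Fan-out comes from measurement and `MOD_q`. Next to every bit `x j` a chain of elements of `ZMod q`
is put into uniform superposition and the differences `d` of neighbours are measured. The outcomes
are independent of `x`, and every link now holds `x j` shifted by a partial sum of `d`; `MOD_q`
gates compute all these shifts at once. With as many links as bits, each pair of bits meets in a
private pair of copies, and all phases `θ j k * x j * x k` are applied in parallel. A measurement of
the copies in the Fourier basis removes them. Its outcomes `m` leave a phase that depends on `x j`
only through the sum of `m` along chain `j`, which `MOD_q` again makes available, so that it can be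
corrected; the remaining phase is common to ket and bra (`omega_cancel`, `sum_phases`). The result
is `impl_quadratic`: every quadratic phase in constant depth, with all auxiliary systems returned to
`0`.

Between Hadamard gates, quadratic phases become rotations by angles that are affine in the other
bits (`impl_rot`). They yield an exact oracle for any function `g` of a weighted sum `h` of bits
modulo `2 ^ m`. For every guess `s` there are `m` qubits, rotated by `2π(h - s)/2^(k+1)`. If the
guess is right, all of them stay `0` with certainty; if it is wrong, the one at the 2-adic valuation
of `h - s` is flipped with certainty (`estimate_correct`). The other qubits may be in superposition,
but the predicate "all zero" is sharp. It is a linear combination of `2 ^ m` parities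
(`sum_parity`), parities are rotations by multiples of `π`, and the flip by `g h` is then one more
rotation by an affine angle. Uncomputation is exact (`oracle_mulVec_ket`). As `m` is logarithmic in
the size of the source circuit, `2 ^ m` is polynomial.

Every gate of the source applies a power `U ^ f S`, where `S` is a sum of small weights of the
controls (`QGate.toOp_eq`). The oracle routes the target to the block on which the required power
acts, and clears the routing afterwards because the gate leaves its controls unchanged
(`reach_powers`). Measurements and classical gates are translated bit by bit, and the same oracle
converts between the code `e` and the one-hot code. The depth of the simulation depends on the
source depth, `p` and `q` only. -/

/-- Hybrid states over arbitrary sets of classical labels `S` and of quantum basis labels `X`. -/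
abbrev GS (S X : Type*) : Type _ := S → Matrix X X ℂ

/-- The basis vector with label `x`. -/
noncomputable def ket {X : Type*} [DecidableEq X] (x : X) : X → ℂ := Pi.single x 1

/-- The isometry (if `f` is injective) that relabels basis vectors along `f`. -/
def relabel {X X' : Type*} [DecidableEq X'] (f : X → X') : Matrix X' X ℂ :=
  Matrix.of fun x' x => if f x = x' then 1 else 0

/-! ### Hybrid states: relabelling and conjugation. -/

section Basic

variable {S S' S'' X X' X'' : Type*} [Fintype S] [Fintype S'] [Fintype S''] [Fintype X]
  [Fintype X'] [Fintype X''] [DecidableEq S] [DecidableEq S'] [DecidableEq S'']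
  [DecidableEq X] [DecidableEq X'] [DecidableEq X'']

lemma mulVec_ket (M : Matrix X' X ℂ) (x : X) : M *ᵥ ket x = fun x' => M x' x := by
  ext x'; simp [ket]

lemma mulVec_ket_apply (M : Matrix X' X ℂ) (x : X) (x' : X') : (M *ᵥ ket x) x' = M x' x := by
  simp [ket]

lemma ket_apply (x y : X) : ket x y = if y = x then 1 else 0 := by
  simp [ket, Pi.single_apply]

lemma relabel_mulVec_ket (f : X → X') (x : X) : relabel f *ᵥ ket x = ket (f x) := by
  rw [mulVec_ket]; ext x'; simp [relabel, ket_apply, eq_comm]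

lemma matrix_ext_ket {M N : Matrix X' X ℂ} (h : ∀ x, M *ᵥ ket x = N *ᵥ ket x) : M = N := by
  ext i j; simpa [mulVec_ket] using congrFun (h j) i

lemma relabel_id : relabel (id : X → X) = 1 := by
  refine matrix_ext_ket fun x => ?_
  simp [relabel_mulVec_ket]

/-- The hybrid state with a single nonzero entry. -/
noncomputable def bas (s : S) (x y : X) : GS S X := Pi.single s (Matrix.single x y 1)

lemma GS.sum_bas (σ : GS S X) : σ = ∑ s, ∑ x, ∑ y, σ s x y • bas s x y := by
  funext s
  ext x y
  simp only [Finset.sum_apply, Matrix.sum_apply, Pi.smul_apply, Matrix.smul_apply, bas]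
  rw [Finset.sum_eq_single s, Finset.sum_eq_single x, Finset.sum_eq_single y]
  · simp
  · intro b _ hb; simp [hb]
  · simp
  · intro b _ hb; simp [hb]
  · simp
  · intro b _ hb; simp [Pi.single_apply, hb.symm]
  · simp

/-- All layers act linearly, so that identities between them need checking only on states `|s⟩⟨s| ⊗
|x⟩⟨y|`. The off-diagonal pairs `x ≠ y` are needed: coherences between data labels have to survive
the simulation. -/
lemma GS.linearMap_ext {N : Type*} [AddCommMonoid N] [Module ℂ N] {T T' : GS S X →ₗ[ℂ] N}
    (h : ∀ s x y, T (bas s x y) = T' (bas s x y)) : T = T' := by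
  refine LinearMap.ext fun σ => ?_
  rw [GS.sum_bas σ]
  simp [map_sum, h]

/-- Relabelling of hybrid states. -/
noncomputable def push (g : S → S') (f : X → X') : GS S X →ₗ[ℂ] GS S' X' where
  toFun σ := fun s' => ∑ s, if g s = s' then relabel f * σ s * (relabel f)ᴴ else 0
  map_add' σ τ := by
    funext s'
    simp only [Pi.add_apply, ← Finset.sum_add_distrib]
    refine Finset.sum_congr rfl fun s _ => ?_
    split_ifs <;> simp [Matrix.mul_add, Matrix.add_mul]
  map_smul' c σ := by
    funext s'
    simp only [Pi.smul_apply, RingHom.id_apply, Finset.smul_sum]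
    refine Finset.sum_congr rfl fun s _ => ?_
    split_ifs <;> simp

lemma push_apply (g : S → S') (f : X → X') (σ : GS S X) (s' : S') :
    push g f σ s' = ∑ s, if g s = s' then relabel f * σ s * (relabel f)ᴴ else 0 := rfl

lemma relabel_single (f : X → X') (x y : X) :
    relabel f * Matrix.single x y (1 : ℂ) * (relabel f)ᴴ = Matrix.single (f x) (f y) 1 := by
  ext a b
  simp only [Matrix.mul_apply, Matrix.single_apply, relabel, Matrix.of_apply,
    Matrix.conjTranspose_apply]
  rw [Finset.sum_eq_single y, Finset.sum_eq_single x]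
  · by_cases h1 : f x = a <;> by_cases h2 : f y = b <;> simp [h1, h2]
  · intro c _ hc; simp [hc.symm]
  · simp
  · intro c _ hc; simp [hc.symm]
  · simp

lemma push_bas (g : S → S') (f : X → X') (s : S) (x y : X) :
    push g f (bas s x y) = bas (g s) (f x) (f y) := by
  funext s'
  rw [push_apply, Finset.sum_eq_single s]
  · by_cases h : g s = s'
    · subst h; simp [bas, relabel_single]
    · simp [h, bas, Pi.single_apply, Ne.symm h]
  · intro t _ ht; simp [bas, ht]
  · simp

lemma push_comp_push (g : S → S') (f : X → X') (g' : S' → S'') (f' : X' → X'') :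
    push g' f' ∘ₗ push g f = push (g' ∘ g) (f' ∘ f) :=
  GS.linearMap_ext fun s x y => by simp [push_bas]

lemma push_push (g : S → S') (f : X → X') (g' : S' → S'') (f' : X' → X'') (σ : GS S X) :
    push g' f' (push g f σ) = push (g' ∘ g) (f' ∘ f) σ :=
  LinearMap.congr_fun (push_comp_push g f g' f') σ

/-- Conjugation by operators that may depend on the classical label. -/
noncomputable def conjBy (V : S → Matrix X X ℂ) : GS S X →ₗ[ℂ] GS S X where
  toFun σ := fun s => V s * σ s * (V s)ᴴ
  map_add' σ τ := by funext s; simp [Matrix.mul_add, Matrix.add_mul]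
  map_smul' c σ := by funext s; simp

lemma conjBy_apply (V : S → Matrix X X ℂ) (σ : GS S X) (s : S) :
    conjBy V σ s = V s * σ s * (V s)ᴴ := rfl

lemma conjBy_conjBy (V V' : S → Matrix X X ℂ) (σ : GS S X) :
    conjBy V' (conjBy V σ) = conjBy (fun s => V' s * V s) σ := by
  funext s; simp [conjBy_apply, Matrix.mul_assoc]

/-- An intertwining relation on the code words suffices. `V'` may do anything off the image of the
encoding, and neither `g` nor `f` has to be injective. -/
lemma conjBy_push {g : S → S'} {f : X → X'} {V' : S' → Matrix X' X' ℂ} {V : S → Matrix X X ℂ}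
    (h : ∀ s, V' (g s) * relabel f = relabel f * V s) (σ : GS S X) :
    conjBy V' (push g f σ) = push g f (conjBy V σ) := by
  funext s'
  rw [conjBy_apply, push_apply, push_apply, Finset.mul_sum, Finset.sum_mul]
  refine Finset.sum_congr rfl fun s _ => ?_
  split_ifs with hs
  · subst hs
    have h' := congrArg Matrix.conjTranspose (h s)
    simp only [Matrix.conjTranspose_mul] at h'
    calc _ = (V' (g s) * relabel f) * σ s * ((relabel f)ᴴ * (V' (g s))ᴴ) := by
          simp only [Matrix.mul_assoc]
      _ = _ := by rw [h, h', conjBy_apply]; simp only [Matrix.mul_assoc]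
  · simp

/-- A change of encoding by a relabelling operator. -/
lemma conjBy_push_relabel {g : S → S'} {f f₂ : X → X'} {V' : S' → Matrix X' X' ℂ}
    (h : ∀ s x, V' (g s) *ᵥ ket (f x) = ket (f₂ x)) (σ : GS S X) :
    conjBy V' (push g f σ) = push g f₂ σ := by
  have key : ∀ s, V' (g s) * relabel f = relabel f₂ := fun s =>
    matrix_ext_ket fun x => by
      rw [← Matrix.mulVec_mulVec, relabel_mulVec_ket, relabel_mulVec_ket, h]
  funext s'
  rw [conjBy_apply, push_apply, push_apply, Finset.mul_sum, Finset.sum_mul]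
  refine Finset.sum_congr rfl fun s _ => ?_
  split_ifs with hs
  · subst hs
    have h' := congrArg Matrix.conjTranspose (key s)
    simp only [Matrix.conjTranspose_mul] at h'
    calc _ = (V' (g s) * relabel f) * σ s * ((relabel f)ᴴ * (V' (g s))ᴴ) := by
          simp only [Matrix.mul_assoc]
      _ = _ := by rw [h', key]
  · simp

end Basic

/-! ### Measurements. -/

section Measure

variable {W W' R R' α β : Type*} [Fintype W] [Fintype R] [Fintype W'] [Fintype R'] [Fintype α]
  [Fintype β] [DecidableEq W] [DecidableEq R] [DecidableEq W'] [DecidableEq R'] [DecidableEq α]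
  [DecidableEq β]

/-- The register contents after measuring the basis state `x`. -/
def recordOn (m : R → Option W) (s : R → α) (x : W → α) : R → α :=
  fun r => match m r with
    | none => s r
    | some i => x i

/-- The measurement `m`: whenever `m r = some i`, wire `i` is measured into register `r`. -/
noncomputable def meas (α : Type*) [Fintype α] [DecidableEq α] (m : R → Option W) :
    GS (R → α) (W → α) →ₗ[ℂ] GS (R → α) (W → α) where
  toFun σ := fun s' => Matrix.of fun x y => if ∀ r i, m r = some i → x i = y i then
      ∑ s, if recordOn m s x = s' then σ s x y else 0 else 0
  map_add' σ τ := by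
    funext s'; ext x y
    simp only [Matrix.of_apply, Pi.add_apply, Matrix.add_apply]
    split_ifs
    · rw [← Finset.sum_add_distrib]
      refine Finset.sum_congr rfl fun s _ => ?_
      split_ifs <;> simp
    · simp
  map_smul' c σ := by
    funext s'; ext x y
    simp only [Matrix.of_apply, Pi.smul_apply, Matrix.smul_apply, RingHom.id_apply]
    split_ifs
    · rw [Finset.smul_sum]
      refine Finset.sum_congr rfl fun s _ => ?_
      split_ifs <;> simp
    · simp

lemma meas_bas (m : R → Option W) (s : R → α) (x y : W → α) :
    meas α m (bas s x y) =
      if ∀ r i, m r = some i → x i = y i then bas (recordOn m s x) x y else 0 := by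
  funext s'; ext a b
  simp only [meas, LinearMap.coe_mk, AddHom.coe_mk, Matrix.of_apply]
  by_cases hab : a = x ∧ b = y
  · obtain ⟨rfl, rfl⟩ := hab
    split_ifs with h
    · rw [Finset.sum_eq_single s]
      · by_cases h' : recordOn m s a = s'
        · subst h'; simp [bas]
        · simp [h', bas, Pi.single_apply, Ne.symm h']
      · intro t _ ht; simp [bas, ht]
      · simp
    · simp
  · have h0 : ∀ t, bas s x y t a b = 0 := by
      intro t
      by_cases ht : t = s
      · subst ht
        simp only [bas, Pi.single_eq_same, Matrix.single_apply]
        rw [if_neg]; rintro ⟨rfl, rfl⟩; exact hab ⟨rfl, rfl⟩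
      · simp [bas, ht]
    have h1 : ∀ t, (if ∀ r i, m r = some i → x i = y i then bas (recordOn m s x) x y
        else (0 : GS (R → α) (W → α))) t a b = 0 := by
      intro t
      split_ifs
      · by_cases ht : t = recordOn m s x
        · subst ht
          simp only [bas, Pi.single_eq_same, Matrix.single_apply]
          rw [if_neg]; rintro ⟨rfl, rfl⟩; exact hab ⟨rfl, rfl⟩
        · simp [bas, ht]
      · simp
    rw [h1]; simp [h0]

/-- An encoding is compatible with measurement if the measured code wires separate exactly the
labels that the original measurement separates and the record is encoded correctly. This serves both
for adding idle wires and for the one-hot code. -/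
lemma meas_push {m : R → Option W} {m' : R' → Option W'} {g : (R → α) → R' → β}
    {f : (W → α) → W' → β}
    (h1 : ∀ x y, (∀ r i, m' r = some i → f x i = f y i) ↔ ∀ r i, m r = some i → x i = y i)
    (h2 : ∀ s x, recordOn m' (g s) (f x) = g (recordOn m s x)) (σ : GS (R → α) (W → α)) :
    meas β m' (push g f σ) = push g f (meas α m σ) := by
  refine LinearMap.congr_fun (f := meas β m' ∘ₗ push g f) (g := push g f ∘ₗ meas α m) ?_ σ
  refine GS.linearMap_ext fun s x y => ?_
  simp only [LinearMap.comp_apply, push_bas, meas_bas, h1, h2]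
  split_ifs
  · rw [push_bas]
  · simp

end Measure

/-! ### Layers as maps of hybrid states, and reachability by one list of layers for a whole family
of states. -/

section Layers

variable {d w c : ℕ} [NeZero d]

lemma Layer.measure_apply (m : Fin c → Option (Fin w)) (σ : HybridState d w c) :
    (Layer.measure m : Layer d w c).apply σ = meas (Fin d) m σ := by
  have h : ∀ s x, record (d := d) m s x = recordOn m s x := by
    intro s x; funext r; unfold record recordOn; cases m r <;> rfl
  funext s'; ext x y
  simp only [Layer.apply, h, meas, LinearMap.coe_mk, AddHom.coe_mk, Matrix.of_apply]
  congr 1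

lemma Layer.classical_apply (u : Fin c → CGate d c) (σ : HybridState d w c) :
    (Layer.classical u : Layer d w c).apply σ = push (fun s r => (u r).eval s r) id σ := by
  funext s'
  simp only [Layer.apply, push_apply, relabel_id]
  refine Finset.sum_congr rfl fun s _ => ?_
  simp

lemma Layer.quantum_apply (gs : List (Option (Fin c × Fin d) × QGate d w)) (hgs)
    (σ : HybridState d w c) :
    (Layer.quantum gs hgs).apply σ = conjBy (fun s => (gs.map (controlledOp s)).prod) σ := rfl

/-- At most `n` allowed layers lead from the states `A m` to the states `B m`. -/
def Reach (G : GateSet) (n : ℕ) {M : Type*} (A B : M → HybridState d w c) : Prop :=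
  ∃ Ls : List (Layer d w c), (∀ L ∈ Ls, L.Allowed G) ∧ Ls.length ≤ n ∧
    ∀ m, Ls.foldl (fun σ L => L.apply σ) (A m) = B m

variable {G : GateSet} {n n' : ℕ} {M M' : Type*} {A B C : M → HybridState d w c}

lemma Reach.refl (A : M → HybridState d w c) : Reach G 0 A A := ⟨[], by simp⟩

lemma Reach.trans (h : Reach G n A B) (h' : Reach G n' B C) : Reach G (n + n') A C := by
  obtain ⟨L, h1, h2, h3⟩ := h
  obtain ⟨L', h1', h2', h3'⟩ := h'
  refine ⟨L ++ L', ?_, ?_, ?_⟩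
  · intro l hl; rcases List.mem_append.1 hl with h | h
    · exact h1 l h
    · exact h1' l h
  · simp; omega
  · intro m; rw [List.foldl_append, h3, h3']

lemma Reach.mono (h : Reach G n A B) (hn : n ≤ n') : Reach G n' A B := by
  obtain ⟨L, h1, h2, h3⟩ := h
  exact ⟨L, h1, h2.trans hn, h3⟩

lemma Reach.comp (h : Reach G n A B) (t : M' → M) :
    Reach G n (fun m => A (t m)) (fun m => B (t m)) := by
  obtain ⟨L, h1, h2, h3⟩ := h
  exact ⟨L, h1, h2, fun m => h3 _⟩

lemma Reach.congr (h : Reach G n A B) {A' B' : M → HybridState d w c} (hA : ∀ m, A' m = A m)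
    (hB : ∀ m, B' m = B m) : Reach G n A' B' := by
  rw [funext hA, funext hB]; exact h

lemma Reach.layer (L : Layer d w c) (hL : L.Allowed G) (h : ∀ m, L.apply (A m) = B m) :
    Reach G 1 A B := ⟨[L], by simpa using hL, by simp, by simpa using h⟩

end Layers

/-! ### Operators that act site by site and read the basis label. -/

section PerSite

variable {W W' α : Type*} [Fintype W] [DecidableEq W] [Fintype W'] [DecidableEq W'] [Fintype α]
  [DecidableEq α]

/-- The operator that applies to every site `w` a matrix that may depend on the basis state. -/
def perSite (V : (W → α) → W → Matrix α α ℂ) : Matrix (W → α) (W → α) ℂ :=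
  Matrix.of fun x y => ∏ w, V y w (x w) (y w)

/-- The operator that applies to site `i` a matrix that may depend on the basis state. -/
def onT (i : W) (V : (W → α) → Matrix α α ℂ) : Matrix (W → α) (W → α) ℂ :=
  Matrix.of fun x y => if ∀ j, j ≠ i → x j = y j then V y (x i) (y i) else 0

lemma onTarget_eq_onT {d w : ℕ} (i : Fin w) (V : Basis d w → Matrix (Fin d) (Fin d) ℂ) :
    onTarget i V = onT i V := by
  ext x y; simp only [onTarget, onT, Matrix.of_apply]; congr 1

lemma perSite_apply (V : (W → α) → W → Matrix α α ℂ) (x y : W → α) :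
    perSite V x y = ∏ w, V y w (x w) (y w) := rfl

lemma onT_eq_perSite (i : W) (V : (W → α) → Matrix α α ℂ) :
    onT i V = perSite fun y w => if w = i then V y else 1 := by
  ext x y
  simp only [onT, perSite, Matrix.of_apply]
  split_ifs with h
  · rw [Finset.prod_eq_single i]
    · simp
    · intro b _ hb; rw [if_neg hb, h b hb]; simp
    · simp
  · push Not at h
    obtain ⟨j, hj, hxy⟩ := h
    symm
    apply Finset.prod_eq_zero (Finset.mem_univ j)
    rw [if_neg hj]; simp [hxy]

lemma onT_mulVec_ket (i : W) (V : (W → α) → Matrix α α ℂ) (x : W → α) :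
    onT i V *ᵥ ket x = ∑ a, V x a (x i) • ket (Function.update x i a) := by
  ext y
  rw [mulVec_ket_apply]
  simp only [onT, Matrix.of_apply, Finset.sum_apply, Pi.smul_apply, ket_apply, smul_eq_mul,
    mul_ite, mul_one, mul_zero]
  split_ifs with h
  · rw [Finset.sum_eq_single (y i)]
    · rw [if_pos]
      funext j
      by_cases hj : j = i
      · subst hj; simp
      · simp [hj, h j hj]
    · intro b _ hb
      rw [if_neg]
      intro hy; apply hb; rw [hy]; simp
    · simp
  · symm
    apply Finset.sum_eq_zero
    intro b _
    rw [if_neg]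
    intro hy; apply h; intro j hj; rw [hy]; simp [hj]

/-- By distributivity the sum over intermediate labels factors over the sites as soon as `A` sees
the same label before and after `B`. The hypothesis asks this only for transitions to which `B`
gives a nonzero amplitude. -/
lemma perSite_mul {A B : (W → α) → W → Matrix α α ℂ}
    (h : ∀ x y, (∀ w, B y w (x w) (y w) ≠ 0) → A x = A y) :
    perSite A * perSite B = perSite fun y w => A y w * B y w := by
  ext x y
  simp only [Matrix.mul_apply, perSite_apply]
  rw [Finset.prod_univ_sum]
  simp only [Fintype.piFinset_univ]
  refine Finset.sum_congr rfl fun z _ => ?_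
  rw [← Finset.prod_mul_distrib]
  by_cases hz : ∀ w, B y w (z w) (y w) ≠ 0
  · rw [h z y hz]
  · push Not at hz
    obtain ⟨w, hw⟩ := hz
    rw [Finset.prod_eq_zero (Finset.mem_univ w), Finset.prod_eq_zero (Finset.mem_univ w)] <;>
      simp [hw]

lemma perSite_one : perSite (fun (_ : W → α) (_ : W) => (1 : Matrix α α ℂ)) = 1 := by
  ext x y
  simp only [perSite_apply]
  by_cases h : x = y
  · subst h; simp
  · obtain ⟨w, hw⟩ := Function.ne_iff.1 h
    rw [Finset.prod_eq_zero (Finset.mem_univ w)]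
    · simp [h]
    · simp [hw]

lemma prod_map_ite {β N : Type*} [Monoid N] (l : List β) (t : β → W)
    (hl : l.Pairwise fun a b => t a ≠ t b) (f : β → N) (b : β) (hb : b ∈ l) :
    (l.map fun b' => if t b = t b' then f b' else 1).prod = f b := by
  induction l with
  | nil => simp at hb
  | cons a l ih =>
    rw [List.pairwise_cons] at hl
    rw [List.map_cons, List.prod_cons]
    rcases List.mem_cons.1 hb with rfl | hb
    · rw [if_pos rfl, List.prod_eq_one, mul_one]
      intro m hm
      obtain ⟨b', hb', rfl⟩ := List.mem_map.1 hm
      rw [if_neg (hl.1 b' hb')]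
    · rw [if_neg (hl.1 b hb).symm, one_mul, ih hl.2 hb]

/-- Operators on different sites that do not read each other's targets. -/
lemma prod_onT {β : Type*} (l : List β) (t : β → W) (V : β → (W → α) → Matrix α α ℂ)
    (hl : l.Pairwise fun a b => t a ≠ t b)
    (hV : ∀ b ∈ l, ∀ x y : W → α, (∀ j, (∀ b' ∈ l, b' ≠ b → j ≠ t b') → x j = y j) →
      V b x = V b y) :
    (l.map fun b => onT (t b) (V b)).prod =
      perSite fun x w => (l.map fun b => if w = t b then V b x else 1).prod := by
  induction l with
  | nil => simp [perSite_one]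
  | cons b l ih =>
    rw [List.pairwise_cons] at hl
    rw [List.map_cons, List.prod_cons, ih hl.2, onT_eq_perSite, perSite_mul]
    · simp only [List.map_cons, List.prod_cons]
    · intro x y hxy
      -- A site that is no target in the tail carries an identity factor there, and its nonvanishing
      -- forces `x j = y j`. This includes the target of `b` itself.
      have : V b x = V b y := by
        apply hV b (by simp)
        intro j hj
        have hw := hxy j
        have h1 : (l.map fun b' => if j = t b' then V b' y else 1).prod = 1 := by
          apply List.prod_eq_one
          intro a ha
          obtain ⟨b', hb', rfl⟩ := List.mem_map.1 ha
          rw [if_neg]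
          apply hj b' (by simp [hb'])
          rintro rfl
          exact hl.1 b' hb' rfl
        rw [h1] at hw
        by_contra hne
        exact hw (by simp [hne])
      rw [this]
    · intro b' hb' x y hxy
      apply hV b' (by simp [hb'])
      intro j hj
      apply hxy
      intro b'' hb'' hne
      exact hj b'' (by simp [hb'']) hne

lemma perSite_mulVec_ket_of_perm {V : (W → α) → W → Matrix α α ℂ} {x y : W → α}
    (h : ∀ w a, V x w a (x w) = if a = y w then 1 else 0) :
    perSite V *ᵥ ket x = ket y := by
  ext z
  rw [mulVec_ket_apply, perSite_apply, ket_apply]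
  simp only [h]
  by_cases hz : z = y
  · subst hz; simp
  · obtain ⟨w, hw⟩ := Function.ne_iff.1 hz
    rw [Finset.prod_eq_zero (Finset.mem_univ w)]
    · simp [hz]
    · simp [hw]

lemma perSite_mulVec_ket_of_diag {V : (W → α) → W → Matrix α α ℂ} {x : W → α} {φ : W → ℂ}
    (h : ∀ w a, V x w a (x w) = if a = x w then φ w else 0) :
    perSite V *ᵥ ket x = (∏ w, φ w) • ket x := by
  ext z
  rw [mulVec_ket_apply, perSite_apply, Pi.smul_apply, ket_apply]
  simp only [h]
  by_cases hz : z = x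
  · subst hz; simp
  · obtain ⟨w, hw⟩ := Function.ne_iff.1 hz
    rw [Finset.prod_eq_zero (Finset.mem_univ w)]
    · simp [hz]
    · simp [hw]

end PerSite

/-! ### Adding systems that contain `0`. -/

section Pad

variable {W W' α : Type*} [Fintype W] [DecidableEq W] [Fintype W'] [DecidableEq W'] [Zero α]

/-- Extension of a basis label by `0`. -/
noncomputable def pad (f : W → W') (x : W → α) : W' → α := Function.extend f x 0

lemma pad_apply {f : W → W'} (hf : Function.Injective f) (x : W → α) (i : W) :
    pad f x (f i) = x i := hf.extend_apply _ _ _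

lemma pad_apply_of_notMem {f : W → W'} (x : W → α) {j : W'} (hj : ∀ i, f i ≠ j) :
    pad f x j = 0 := Function.extend_apply' _ _ _ (by rintro ⟨i, hi⟩; exact hj i hi)

lemma pad_ext {f : W → W'} (hf : Function.Injective f) {x : W → α} {y : W' → α}
    (h1 : ∀ i, y (f i) = x i) (h2 : ∀ j, (∀ i, f i ≠ j) → y j = 0) : y = pad f x := by
  funext j
  by_cases hj : ∃ i, f i = j
  · obtain ⟨i, rfl⟩ := hj; rw [h1, pad_apply hf]
  · push Not at hj; rw [h2 j hj, pad_apply_of_notMem x hj]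

lemma update_pad {f : W → W'} (hf : Function.Injective f) (x : W → α) (i : W) (a : α) :
    Function.update (pad f x) (f i) a = pad f (Function.update x i a) := by
  apply pad_ext hf
  · intro j
    by_cases h : j = i
    · subst h; simp
    · rw [Function.update_of_ne (hf.ne h), pad_apply hf, Function.update_of_ne h]
  · intro j hj
    rw [Function.update_of_ne (hj i).symm, pad_apply_of_notMem x hj]

lemma pad_pad {W'' : Type*} [Fintype W''] [DecidableEq W''] {f : W → W'} {f' : W' → W''} (hf : Function.Injective f)
    (hf' : Function.Injective f') (x : W → α) : pad f' (pad f x) = pad (f' ∘ f) x := by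
  apply pad_ext (hf'.comp hf)
  · intro i; simp [pad_apply hf, pad_apply hf']
  · intro j hj
    by_cases h : ∃ i, f' i = j
    · obtain ⟨i, rfl⟩ := h
      rw [pad_apply hf', pad_apply_of_notMem]
      intro k hk; exact hj k (by simp [hk])
    · push Not at h
      rw [pad_apply_of_notMem _ h]

end Pad

/-! ### Layers described by targets, on a chosen part of a circuit. -/

/-- A one-qubit unitary, possibly with a control qubit and a classical control. -/
structure WireGate (W R : Type*) where
  /-- Apply the gate only if the register contains the value. -/
  cond : Option (R × Fin 2)
  /-- The control wire. -/
  ctl : Option W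
  /-- The unitary. -/
  U : Matrix.unitaryGroup (Fin 2) ℂ

section Spec

variable {W R : Type*} [Fintype W] [DecidableEq W] [Fintype R] [DecidableEq R]

/-- The matrix that the gate applies to its target. -/
def WireGate.act (g : WireGate W R) (s : R → Fin 2) (y : W → Fin 2) :
    Matrix (Fin 2) (Fin 2) ℂ :=
  if ∀ r v, g.cond = some (r, v) → s r = v then
    match g.ctl with
    | none => g.U
    | some j => (g.U : Matrix (Fin 2) (Fin 2) ℂ) ^ (y j : ℕ)
  else 1

/-- At most one gate for every target wire, with pairwise disjoint supports. -/
structure LayerSpec (W R : Type*) where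
  /-- The gate with the given target. -/
  gate : W → Option (WireGate W R)
  free : ∀ w g j, gate w = some g → g.ctl = some j → gate j = none
  inj : ∀ w w' g g' j, gate w = some g → gate w' = some g' → g.ctl = some j → g'.ctl = some j →
    w = w'

/-- The action of a layer on every wire. -/
def LayerSpec.site (L : LayerSpec W R) (s : R → Fin 2) (x : W → Fin 2) (w : W) :
    Matrix (Fin 2) (Fin 2) ℂ :=
  match L.gate w with
  | none => 1
  | some g => g.act s x

/-- The operator of a layer. -/
def LayerSpec.op (L : LayerSpec W R) (s : R → Fin 2) : Matrix (W → Fin 2) (W → Fin 2) ℂ :=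
  perSite (L.site s)

/-- Controls are never targets, by `free`; so the action of a layer is determined by the wires that
it leaves idle. -/
lemma LayerSpec.site_congr (L : LayerSpec W R) (s : R → Fin 2) {x y : W → Fin 2}
    (h : ∀ w, L.gate w = none → x w = y w) : L.site s x = L.site s y := by
  funext w
  unfold LayerSpec.site
  cases hg : L.gate w with
  | none => rfl
  | some g =>
    simp only [WireGate.act]
    cases hc : g.ctl with
    | none => rfl
    | some j => simp only []; rw [h j (L.free w g j hg hc)]

/-- The operator of a layer as a product over a list of targets. -/
lemma LayerSpec.op_eq_prod (L : LayerSpec W R) (s : R → Fin 2) {β : Type*} (l : List β)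
    (t : β → W) (hl : l.Pairwise fun a b => t a ≠ t b)
    (ht : ∀ w, (L.gate w).isSome ↔ ∃ b ∈ l, t b = w) :
    L.op s = (l.map fun b => onT (t b) fun x => L.site s x (t b)).prod := by
  rw [prod_onT _ _ _ hl]
  · unfold LayerSpec.op
    congr 1
    funext x w
    by_cases hw : ∃ b ∈ l, t b = w
    · obtain ⟨b, hb, rfl⟩ := hw
      exact (prod_map_ite l t hl (fun b => L.site s x (t b)) b hb).symm
    · rw [List.prod_eq_one]
      · rw [← ht] at hw
        unfold LayerSpec.site
        cases hg : L.gate w with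
        | none => rfl
        | some g => simp [hg] at hw
      · intro m hm
        obtain ⟨b', hb', rfl⟩ := List.mem_map.1 hm
        rw [if_neg]
        rintro rfl
        exact hw ⟨b', hb', rfl⟩
  · intro b hb x y hxy
    rw [L.site_congr s]
    intro w hw
    apply hxy
    rintro b' hb' - rfl
    have := (ht (t b')).2 ⟨b', hb', rfl⟩
    simp [hw] at this

lemma LayerSpec.exists_list (L : LayerSpec W R) : ∃ l : List W, l.Nodup ∧
    ∀ w, w ∈ l ↔ (L.gate w).isSome :=
  ⟨Finset.univ.toList.filter fun w => (L.gate w).isSome,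
    (Finset.nodup_toList _).filter _, by simp⟩

variable {w c : ℕ}

/-- The gate of the circuit that corresponds to the gate on wire `i`. -/
def LayerSpec.toGate (L : LayerSpec W R) (ι : W ↪ Fin w) (κ : R ↪ Fin c) (i : W) :
    Option (Fin c × Fin 2) × QGate 2 w :=
  match L.gate i with
  | none => (none, .single (ι i) 1)
  | some g => (g.cond.map fun rv => (κ rv.1, rv.2),
      match g.ctl with
      | none => .single (ι i) g.U
      -- A filler: `free` excludes `j = i`. The identity gate in the case `none` is a filler too,
      -- since the circuit only lists wires that carry a gate.
      | some j => if h : j = i then .single (ι i) 1 else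
          .ctrl (ι j) (ι i) (fun h' => h (ι.injective h')) g.U)

lemma LayerSpec.toGate_allowed (L : LayerSpec W R) (ι : W ↪ Fin w) (κ : R ↪ Fin c) (i : W)
    (G : GateSet) : (L.toGate ι κ i).2.Allowed G := by
  unfold LayerSpec.toGate
  cases L.gate i with
  | none => trivial
  | some g =>
    cases hc : g.ctl with
    | none => simp only [hc]; trivial
    | some j => simp only [hc]; split_ifs <;> trivial

lemma LayerSpec.toGate_support (L : LayerSpec W R) (ι : W ↪ Fin w) (κ : R ↪ Fin c) (i : W)
    (v : Fin w) (hv : v ∈ (L.toGate ι κ i).2.support) :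
    v = ι i ∨ ∃ g j, L.gate i = some g ∧ g.ctl = some j ∧ v = ι j := by
  unfold LayerSpec.toGate at hv
  cases hg : L.gate i with
  | none => simp [hg, QGate.support] at hv; exact Or.inl hv
  | some g =>
    cases hc : g.ctl with
    | none => simp [hg, hc, QGate.support] at hv; exact Or.inl hv
    | some j =>
      simp only [hg, hc] at hv
      split_ifs at hv with h
      · simp [QGate.support] at hv; exact Or.inl hv
      · simp [QGate.support] at hv
        rcases hv with hv | hv
        · exact Or.inr ⟨g, j, rfl, hc, hv⟩
        · exact Or.inl hv

lemma onT_mul_relabel_pad (ι : W ↪ Fin w) (i : W)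
    {V' : (Fin w → Fin 2) → Matrix (Fin 2) (Fin 2) ℂ}
    {V : (W → Fin 2) → Matrix (Fin 2) (Fin 2) ℂ} (h : ∀ x, V' (pad ι x) = V x) :
    onT (ι i) V' * relabel (pad (α := Fin 2) ι) = relabel (pad (α := Fin 2) ι) * onT i V := by
  refine matrix_ext_ket fun x => ?_
  rw [← Matrix.mulVec_mulVec, ← Matrix.mulVec_mulVec, relabel_mulVec_ket, onT_mulVec_ket,
    onT_mulVec_ket, Matrix.mulVec_sum]
  refine Finset.sum_congr rfl fun a _ => ?_
  rw [Matrix.mulVec_smul, relabel_mulVec_ket, h, pad_apply ι.injective, update_pad ι.injective]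

lemma onT_one (i : W) : onT (α := Fin 2) i (fun _ => 1) = 1 := by
  rw [onT_eq_perSite, ← perSite_one]
  congr 1; funext y w; split_ifs <;> rfl

lemma LayerSpec.toGate_mul_relabel (L : LayerSpec W R) (ι : W ↪ Fin w) (κ : R ↪ Fin c) (i : W)
    (s : R → Fin 2) :
    controlledOp (pad κ s) (L.toGate ι κ i) * relabel (pad (α := Fin 2) ι) =
      relabel (pad (α := Fin 2) ι) * onT i fun x => L.site s x i := by
  unfold LayerSpec.toGate LayerSpec.site
  cases hg : L.gate i with
  | none =>
    simp only [controlledOp, QGate.toOp, onTarget_eq_onT]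
    apply onT_mul_relabel_pad
    intro x; simp
  | some g =>
    obtain ⟨cond, ctl, U⟩ := g
    have key : ∀ j, ctl = some j → j ≠ i := by
      rintro j hj rfl
      have := L.free j _ j hg hj
      simp [this] at hg
    have main : ((match ctl with
      | none => QGate.single (ι i) U
      | some j => if h : j = i then QGate.single (ι i) 1 else
          QGate.ctrl (ι j) (ι i) (fun h' => h (ι.injective h')) U).toOp) * relabel (pad (α := Fin 2) ι) =
        relabel (pad (α := Fin 2) ι) * onT i fun x => match ctl with
          | none => (U : Matrix (Fin 2) (Fin 2) ℂ)
          | some j => (U : Matrix (Fin 2) (Fin 2) ℂ) ^ (x j : ℕ) := by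
      cases ctl with
      | none =>
        simp only [QGate.toOp, onTarget_eq_onT]
        exact onT_mul_relabel_pad _ _ fun x => rfl
      | some j =>
        simp only [dif_neg (key j rfl), QGate.toOp, onTarget_eq_onT]
        exact onT_mul_relabel_pad _ _ fun x => by rw [pad_apply ι.injective]
    cases cond with
    | none =>
      simp only [controlledOp, Option.map_none, WireGate.act]
      simpa using main
    | some rv =>
      obtain ⟨r, v⟩ := rv
      simp only [controlledOp, Option.map_some, WireGate.act, pad_apply κ.injective]
      by_cases h : s r = v
      · simpa [h] using main
      · simp only [h, onT_one, Matrix.mul_one, Matrix.one_mul, if_false]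
        simp [h, onT_one]

/-- The embedding of the states of some wires and registers into the states of a circuit whose
other wires and registers contain `0`. -/
noncomputable abbrev ext (ι : W ↪ Fin w) (κ : R ↪ Fin c) :
    GS (R → Fin 2) (W → Fin 2) →ₗ[ℂ] HybridState 2 w c := push (pad κ) (pad ι)

lemma list_prod_intertwine {β : Type*} {X X' : Type*} [Fintype X] [DecidableEq X] [Fintype X']
    [DecidableEq X'] (l : List β) (A : β → Matrix X' X' ℂ)
    (B : β → Matrix X X ℂ) (J : Matrix X' X ℂ) (h : ∀ b ∈ l, A b * J = J * B b) :
    (l.map A).prod * J = J * (l.map B).prod := by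
  induction l with
  | nil => simp
  | cons b l ih =>
    simp only [List.map_cons, List.prod_cons]
    rw [Matrix.mul_assoc, ih fun b hb => h b (by simp [hb]), ← Matrix.mul_assoc, h b (by simp),
      Matrix.mul_assoc]

lemma LayerSpec.reach (L : LayerSpec W R) (ι : W ↪ Fin w) (κ : R ↪ Fin c) (G : GateSet) :
    Reach G 1 (fun σ => ext ι κ σ) (fun σ => ext ι κ (conjBy L.op σ)) := by
  obtain ⟨l, hl, hl'⟩ := L.exists_list
  refine Reach.layer (.quantum (l.map (L.toGate ι κ)) ?_) ?_ ?_
  · rw [List.pairwise_map]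
    refine hl.imp_of_mem ?_
    intro a b ha hb hab
    rw [Finset.disjoint_left]
    intro v hv hv'
    rw [hl'] at ha hb
    rcases L.toGate_support ι κ a v hv with rfl | ⟨g, j, hg, hj, rfl⟩ <;>
    rcases L.toGate_support ι κ b _ hv' with h | ⟨g', j', hg', hj', h⟩
    · exact hab (ι.injective h)
    · obtain rfl := ι.injective h
      rw [L.free b g' a hg' hj'] at ha; simp at ha
    · obtain rfl := ι.injective h
      rw [L.free a g j hg hj] at hb; simp at hb
    · obtain rfl := ι.injective h
      exact hab (L.inj a b g g' j hg hg' hj hj')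
  · intro g hg
    obtain ⟨i, _, rfl⟩ := List.mem_map.1 hg
    exact L.toGate_allowed ι κ i G
  · intro σ
    rw [Layer.quantum_apply]
    apply conjBy_push
    intro s
    rw [List.map_map, L.op_eq_prod s l id (by simpa [List.Nodup] using hl) (by intro w; simp [hl'])]
    apply list_prod_intertwine
    intro b _
    exact L.toGate_mul_relabel ι κ b s

/-- At most `n` layers act on the states of the given wires and registers as conjugation by `V`. -/
def Impl (G : GateSet) (ι : W ↪ Fin w) (κ : R ↪ Fin c) (n : ℕ)
    (V : (R → Fin 2) → Matrix (W → Fin 2) (W → Fin 2) ℂ) : Prop :=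
  Reach G n (fun σ => ext ι κ σ) (fun σ => ext ι κ (conjBy V σ))

variable {G : GateSet} {ι : W ↪ Fin w} {κ : R ↪ Fin c} {n n' : ℕ}
  {V V' : (R → Fin 2) → Matrix (W → Fin 2) (W → Fin 2) ℂ}

lemma Impl.mul (h : Impl G ι κ n V) (h' : Impl G ι κ n' V') :
    Impl G ι κ (n + n') fun s => V' s * V s :=
  (Reach.trans h (Reach.comp h' fun σ => conjBy V σ)).congr (fun _ => rfl)
    fun σ => by rw [conjBy_conjBy]

lemma Impl.one : Impl G ι κ 0 fun _ => 1 :=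
  (Reach.refl _).congr (fun _ => rfl) fun σ => by
    congr 1; funext s; simp [conjBy_apply]

lemma Impl.mono (h : Impl G ι κ n V) (hn : n ≤ n') : Impl G ι κ n' V := Reach.mono h hn

lemma LayerSpec.impl (L : LayerSpec W R) : Impl G ι κ 1 L.op := L.reach ι κ G

lemma reach_meas (m : R → Option W) :
    Reach G 1 (fun σ => ext ι κ σ) (fun σ => ext ι κ (meas (Fin 2) m σ)) := by
  classical
  let m' : Fin c → Option (Fin w) := Function.extend κ (fun r => (m r).map ι) fun _ => none
  have hm1 : ∀ r, m' (κ r) = (m r).map ι := fun r => κ.injective.extend_apply _ _ _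
  have hm2 : ∀ r', (∀ r, κ r ≠ r') → m' r' = none := fun r' h =>
    Function.extend_apply' _ _ _ (by rintro ⟨r, hr⟩; exact h r hr)
  refine Reach.layer (.measure m') trivial fun σ => ?_
  rw [Layer.measure_apply]
  apply meas_push
  · intro x y
    constructor
    · intro h r i hr
      have := h (κ r) (ι i) (by simp [hm1, hr])
      simpa [pad_apply ι.injective] using this
    · intro h r' i' hr
      by_cases hr' : ∃ r, κ r = r'
      · obtain ⟨r, rfl⟩ := hr'
        rw [hm1] at hr
        obtain ⟨i, hi, rfl⟩ := Option.map_eq_some_iff.1 hr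
        simpa [pad_apply ι.injective] using h r i hi
      · push Not at hr'
        rw [hm2 r' hr'] at hr; simp at hr
  · intro s x
    apply pad_ext κ.injective
    · intro r
      unfold recordOn
      rw [hm1]
      cases m r with
      | none => simp [pad_apply κ.injective]
      | some i => simp [pad_apply ι.injective]
    · intro r' hr'
      unfold recordOn
      rw [hm2 r' hr']
      simp [pad_apply_of_notMem s hr']

/-- Classical gates on an arbitrary set of registers. -/
inductive RegGate (R : Type*) : Type _
  /-- Leave the register as it is. -/
  | keep
  /-- A function of fan-in two. -/
  | bounded (r₁ r₂ : R) (f : Fin 2 → Fin 2 → Fin 2)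
  /-- The gate `MOD_q`. -/
  | mod (T : Finset R)

/-- The value that a classical gate writes to register `r`. -/
def RegGate.eval (q : ℕ) (s : R → Fin 2) (r : R) : RegGate R → Fin 2
  | .keep => s r
  | .bounded r₁ r₂ f => f (s r₁) (s r₂)
  | .mod T => if (∑ j ∈ T, (s j : ℕ)) % q = 0 then 1 else 0

/-- The corresponding gate of a circuit. -/
def RegGate.toCGate (κ : R ↪ Fin c) (q : ℕ) : RegGate R → CGate 2 c
  | .keep => .keep
  | .bounded r₁ r₂ f => .bounded (κ r₁) (κ r₂) f
  | .mod T => .mod q (T.map κ)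

lemma reach_classical {q : ℕ} (hq : q ∈ G.classicalMod) (u : R → RegGate R) :
    Reach G 1 (fun σ => ext ι κ σ)
      (fun σ => ext ι κ (push (fun s r => (u r).eval q s r) id σ)) := by
  let u' : Fin c → CGate 2 c := Function.extend κ (fun r => (u r).toCGate κ q) fun _ => .keep
  have hm1 : ∀ r, u' (κ r) = (u r).toCGate κ q := fun r => κ.injective.extend_apply _ _ _
  have hm2 : ∀ r', (∀ r, κ r ≠ r') → u' r' = .keep := fun r' h =>
    Function.extend_apply' _ _ _ (by rintro ⟨r, hr⟩; exact h r hr)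
  refine Reach.layer (.classical u') ?_ fun σ => ?_
  · intro r'
    by_cases hr' : ∃ r, κ r = r'
    · obtain ⟨r, rfl⟩ := hr'
      rw [hm1]
      cases u r with
      | keep => trivial
      | bounded => trivial
      | mod => exact hq
    · push Not at hr'
      rw [hm2 r' hr']; trivial
  · rw [Layer.classical_apply, push_push, push_push]
    congr 2
    funext s
    apply pad_ext κ.injective
    · intro r
      simp only [Function.comp_apply]
      rw [hm1]
      cases u r with
      | keep => simp [RegGate.toCGate, CGate.eval, RegGate.eval, pad_apply κ.injective]
      | bounded => simp [RegGate.toCGate, CGate.eval, RegGate.eval, pad_apply κ.injective]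
      | mod T =>
        simp [RegGate.toCGate, CGate.eval, RegGate.eval, pad_apply κ.injective]
    · intro r' hr'
      simp only [Function.comp_apply]
      rw [hm2 r' hr']
      exact pad_apply_of_notMem s hr'

end Spec

/-! ### Decomposition of unitaries into two-level unitaries. -/

section TwoLevel

variable {ι : Type*} [Fintype ι] [DecidableEq ι]

/-- The matrix that acts as `u` on the levels `i` (index `1`) and `j` (index `0`). -/
def twoLevel (i j : ι) (u : Matrix (Fin 2) (Fin 2) ℂ) : Matrix ι ι ℂ :=
  Matrix.of fun a b =>
    if a = i then (if b = i then u 1 1 else if b = j then u 1 0 else 0)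
    else if a = j then (if b = i then u 0 1 else if b = j then u 0 0 else 0)
    else if a = b then 1 else 0

lemma twoLevel_mulVec {i j : ι} (hij : i ≠ j) (u : Matrix (Fin 2) (Fin 2) ℂ) (v : ι → ℂ) (k : ι) :
    (twoLevel i j u *ᵥ v) k = if k = i then u 1 1 * v i + u 1 0 * v j
      else if k = j then u 0 1 * v i + u 0 0 * v j else v k := by
  simp only [Matrix.mulVec, dotProduct, twoLevel, Matrix.of_apply]
  split_ifs with h1 h2
  · rw [Fintype.sum_eq_add i j hij]
    · simp [hij.symm]
    · rintro x ⟨hx, hx'⟩; simp [hx, hx']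
  · rw [Fintype.sum_eq_add i j hij]
    · simp [hij.symm]
    · rintro x ⟨hx, hx'⟩; simp [hx, hx']
  · simp

lemma twoLevel_mul {i j : ι} (hij : i ≠ j) (u u' : Matrix (Fin 2) (Fin 2) ℂ) :
    twoLevel i j u * twoLevel i j u' = twoLevel i j (u * u') := by
  refine matrix_ext_ket fun x => ?_
  rw [← Matrix.mulVec_mulVec]
  ext k
  simp only [twoLevel_mulVec hij, Matrix.mul_apply, Fin.sum_univ_two, if_true, if_neg hij.symm]
  split_ifs <;> ring

lemma twoLevel_one {i j : ι} (hij : i ≠ j) : twoLevel i j 1 = 1 := by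
  refine matrix_ext_ket fun x => ?_
  ext k
  rw [twoLevel_mulVec hij, Matrix.one_mulVec]
  split_ifs with h1 h2
  · simp [h1]
  · simp [h2]
  · rfl

lemma twoLevel_conjTranspose {i j : ι} (hij : i ≠ j) (u : Matrix (Fin 2) (Fin 2) ℂ) :
    (twoLevel i j u)ᴴ = twoLevel i j uᴴ := by
  ext a b
  simp only [twoLevel, Matrix.conjTranspose_apply, Matrix.of_apply]
  by_cases h1 : a = i <;> by_cases h2 : a = j <;> by_cases h3 : b = i <;> by_cases h4 : b = j <;>
    simp_all [eq_comm]

lemma twoLevel_mem {i j : ι} (hij : i ≠ j) (u : Matrix.unitaryGroup (Fin 2) ℂ) :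
    twoLevel i j (u : Matrix (Fin 2) (Fin 2) ℂ) ∈ Matrix.unitaryGroup ι ℂ := by
  rw [Matrix.mem_unitaryGroup_iff, Matrix.star_eq_conjTranspose, twoLevel_conjTranspose hij,
    twoLevel_mul hij, ← Matrix.star_eq_conjTranspose, Matrix.mem_unitaryGroup_iff.1 u.2,
    twoLevel_one hij]

/-- The data of a two-level unitary. -/
structure TwoLevel (ι : Type*) where
  i : ι
  j : ι
  ne : i ≠ j
  u : Matrix.unitaryGroup (Fin 2) ℂ

/-- The matrix of a two-level unitary. -/
def TwoLevel.mat (t : TwoLevel ι) : Matrix ι ι ℂ := twoLevel t.i t.j t.u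

/-- Products of at most `n` two-level unitaries. -/
def IsProdTwoLevel (n : ℕ) (U : Matrix ι ι ℂ) : Prop :=
  ∃ l : List (TwoLevel ι), l.length ≤ n ∧ (l.map TwoLevel.mat).prod = U

lemma IsProdTwoLevel.mul {n m : ℕ} {U V : Matrix ι ι ℂ} (hU : IsProdTwoLevel n U)
    (hV : IsProdTwoLevel m V) : IsProdTwoLevel (n + m) (U * V) := by
  obtain ⟨l, h1, h2⟩ := hU
  obtain ⟨l', h1', h2'⟩ := hV
  exact ⟨l ++ l', by simp; omega, by simp [h2, h2']⟩

lemma IsProdTwoLevel.one : IsProdTwoLevel 0 (1 : Matrix ι ι ℂ) := ⟨[], by simp⟩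

lemma IsProdTwoLevel.mono {n m : ℕ} {U : Matrix ι ι ℂ} (hU : IsProdTwoLevel n U) (h : n ≤ m) :
    IsProdTwoLevel m U := by
  obtain ⟨l, h1, h2⟩ := hU
  exact ⟨l, h1.trans h, h2⟩

lemma IsProdTwoLevel.of {i j : ι} (hij : i ≠ j) (u : Matrix.unitaryGroup (Fin 2) ℂ) :
    IsProdTwoLevel 1 (twoLevel i j (u : Matrix (Fin 2) (Fin 2) ℂ)) :=
  ⟨[⟨i, j, hij, u⟩], by simp, by simp [TwoLevel.mat]⟩

lemma IsProdTwoLevel.mem {n : ℕ} {U : Matrix ι ι ℂ} (hU : IsProdTwoLevel n U) :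
    U ∈ Matrix.unitaryGroup ι ℂ := by
  obtain ⟨l, _, rfl⟩ := hU
  refine Submonoid.list_prod_mem _ fun M hM => ?_
  obtain ⟨t, _, rfl⟩ := List.mem_map.1 hM
  exact twoLevel_mem t.ne t.u

lemma IsProdTwoLevel.conjTranspose {n : ℕ} {U : Matrix ι ι ℂ} (hU : IsProdTwoLevel n U) :
    IsProdTwoLevel n Uᴴ := by
  obtain ⟨l, h1, rfl⟩ := hU
  suffices ∀ l : List (TwoLevel ι), IsProdTwoLevel l.length ((l.map TwoLevel.mat).prod)ᴴ from
    (this l).mono h1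
  intro l
  induction l with
  | nil => simpa using IsProdTwoLevel.one
  | cons t l ih =>
    simp only [List.map_cons, List.prod_cons, Matrix.conjTranspose_mul, List.length_cons]
    refine ih.mul ?_
    rw [TwoLevel.mat, twoLevel_conjTranspose t.ne]
    exact IsProdTwoLevel.of t.ne (star t.u)

/-- A `2 × 2` unitary that annihilates the component with index `0`. -/
lemma exists_unitary_kill (α β : ℂ) : ∃ u : Matrix.unitaryGroup (Fin 2) ℂ,
    (u : Matrix (Fin 2) (Fin 2) ℂ) 0 1 * α + (u : Matrix (Fin 2) (Fin 2) ℂ) 0 0 * β = 0 := by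
  by_cases h : α = 0 ∧ β = 0
  · exact ⟨1, by simp [h.1, h.2]⟩
  have hpos : 0 < Complex.normSq α + Complex.normSq β := by
    rcases not_and_or.1 h with h | h
    · have := Complex.normSq_pos.2 h
      have := Complex.normSq_nonneg β
      linarith
    · have := Complex.normSq_pos.2 h
      have := Complex.normSq_nonneg α
      linarith
  set r : ℝ := Real.sqrt (Complex.normSq α + Complex.normSq β) with hr
  have hr0 : (r : ℂ) ≠ 0 := by
    exact_mod_cast (Real.sqrt_pos.2 hpos).ne'
  have hr2 : (r : ℂ) * r = α * star α + β * star β := by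
    rw [← Complex.ofReal_mul, hr, Real.mul_self_sqrt hpos.le]
    push_cast
    rw [← Complex.mul_conj, ← Complex.mul_conj]; rfl
  have hrs : star (r : ℂ) = r := Complex.conj_ofReal r
  -- A Givens rotation: the row with index `0` is orthogonal to the given vector, whose component
  -- with index `0` is `β`, and the other row completes it to a unitary.
  refine ⟨⟨!![α / r, -β / r; star β / r, star α / r], ?_⟩, ?_⟩
  · rw [Matrix.mem_unitaryGroup_iff, Matrix.star_eq_conjTranspose]
    ext a b
    fin_cases a <;> fin_cases b <;>
      simp [Matrix.mul_apply, Fin.sum_univ_two, Matrix.conjTranspose_apply] <;>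
      field_simp <;> simp only [RCLike.star_def] at hr2 <;>
      first | ring1 | linear_combination hr2 | linear_combination (-1 : ℂ) * hr2
  · simp; ring

/-- Elimination in one column: rotations in the planes `(i, j)`, `j ∈ s`, collect the weight of the
levels in `s` at level `i`. No other level is touched, so that basis vectors outside stay fixed;
this protects the columns already treated in `exists_fix`. -/
lemma exists_kill (v : ι → ℂ) (i : ι) (s : Finset ι) (hs : i ∉ s) :
    ∃ G : Matrix ι ι ℂ, IsProdTwoLevel s.card G ∧ (∀ j ∈ s, (G *ᵥ v) j = 0) ∧
      ∀ k, k ≠ i → k ∉ s → (G *ᵥ v) k = v k ∧ G *ᵥ ket k = ket k := by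
  induction s using Finset.induction_on with
  | empty => exact ⟨1, IsProdTwoLevel.one, by simp, by simp⟩
  | insert j s hj ih =>
    obtain ⟨G, h1, h2, h3⟩ := ih fun h => hs (by simp [h])
    have hij : i ≠ j := by rintro rfl; exact hs (by simp)
    obtain ⟨u, hu⟩ := exists_unitary_kill ((G *ᵥ v) i) ((G *ᵥ v) j)
    refine ⟨twoLevel i j u * G, ?_, ?_, ?_⟩
    · rw [Finset.card_insert_of_notMem hj]
      exact ((IsProdTwoLevel.of hij u).mul h1).mono (by omega)
    · intro k hk
      rw [← Matrix.mulVec_mulVec, twoLevel_mulVec hij]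
      have hki : k ≠ i := by rintro rfl; exact hs hk
      rw [if_neg hki]
      split_ifs with hkj
      · exact hu
      · exact h2 k (Finset.mem_of_mem_insert_of_ne hk hkj)
    · intro k hki hk
      rw [Finset.mem_insert, not_or] at hk
      obtain ⟨h4, h5⟩ := h3 k hki hk.2
      constructor
      · rw [← Matrix.mulVec_mulVec, twoLevel_mulVec hij, if_neg hki, if_neg hk.1, h4]
      · rw [← Matrix.mulVec_mulVec, h5]
        ext l
        rw [twoLevel_mulVec hij]
        simp only [ket_apply, if_neg hki.symm, if_neg (Ne.symm hk.1)]
        split_ifs <;> simp_all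

/-- Once the columns in `t` are basis vectors, orthonormality makes every other column vanish on
`t`. The elimination for the next column `i` therefore stays away from `t` and leaves only a
multiple `c` of the basis vector `i`, with `|c| = 1`, whose phase is removed at the end. -/
lemma exists_fix [Nontrivial ι] (U : Matrix.unitaryGroup ι ℂ) (t : Finset ι) :
    ∃ G : Matrix ι ι ℂ, IsProdTwoLevel (t.card * (Fintype.card ι + 1)) G ∧
      ∀ k ∈ t, (G * (U : Matrix ι ι ℂ)) *ᵥ ket k = ket k := by
  induction t using Finset.induction_on with
  | empty => exact ⟨1, IsProdTwoLevel.one.mono (by simp), by simp⟩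
  | insert i t hi ih =>
    obtain ⟨G, h1, h2⟩ := ih
    set U' : Matrix ι ι ℂ := G * U with hU'
    have hmem : U' ∈ Matrix.unitaryGroup ι ℂ := mul_mem h1.mem U.2
    have horth : ∀ k l, ∑ a, star (U' a k) * U' a l = if k = l then 1 else 0 := by
      intro k l
      have := congrFun (congrFun (Matrix.mem_unitaryGroup_iff'.1 hmem) k) l
      simpa [Matrix.mul_apply, Matrix.one_apply] using this
    have hcol : ∀ k ∈ t, ∀ a, U' a k = if a = k then 1 else 0 := by
      intro k hk a
      rw [← mulVec_ket_apply U', h2 k hk, ket_apply]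
    have hv0 : ∀ k ∈ t, U' k i = 0 := by
      intro k hk
      have := horth k i
      rw [if_neg (by rintro rfl; exact hi hk)] at this
      simpa [hcol k hk] using this
    obtain ⟨G', g1, g2, g3⟩ := exists_kill (U' *ᵥ ket i) i (Finset.univ \ insert i t) (by simp)
    set c := (G' *ᵥ (U' *ᵥ ket i)) i with hc
    have hvec : G' *ᵥ (U' *ᵥ ket i) = c • ket i := by
      ext k
      rw [Pi.smul_apply, ket_apply]
      by_cases hki : k = i
      · subst hki; simp [hc]
      · by_cases hkt : k ∈ t
        · rw [(g3 k hki (by simp [hkt])).1, mulVec_ket_apply, hv0 k hkt]; simp [hki]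
        · rw [g2 k (by simp [hki, hkt])]; simp [hki]
    have hcc : star c * c = 1 := by
      have hm := mul_mem g1.mem hmem
      have := congrFun (congrFun (Matrix.mem_unitaryGroup_iff'.1 hm) i) i
      rw [Matrix.mul_apply] at this
      have hentry : ∀ a, (G' * U') a i = if a = i then c else 0 := by
        intro a
        rw [← mulVec_ket_apply (G' * U'), ← Matrix.mulVec_mulVec, hvec, Pi.smul_apply, ket_apply]; simp
      simpa [Matrix.star_apply, hentry] using this
    -- A phase on the single level `i` has to be written as a two-level gate; the partner `j` is
    -- arbitrary and gets the entry `1`. This is where two levels are needed.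
    obtain ⟨j, hji⟩ := exists_ne i
    have hu : !![1, 0; 0, star c] ∈ Matrix.unitaryGroup (Fin 2) ℂ := by
      rw [Matrix.mem_unitaryGroup_iff, Matrix.star_eq_conjTranspose]
      ext a b
      fin_cases a <;> fin_cases b <;>
        simp [Matrix.mul_apply, Fin.sum_univ_two, Matrix.conjTranspose_apply]
      simpa using hcc
    refine ⟨twoLevel i j !![1, 0; 0, star c] * (G' * G), ?_, ?_⟩
    · have := (IsProdTwoLevel.of hji.symm ⟨_, hu⟩).mul (g1.mul h1)
      refine this.mono ?_
      have : (Finset.univ \ insert i t).card ≤ Fintype.card ι := Finset.card_le_univ _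
      rw [Finset.card_insert_of_notMem hi]
      linarith
    · intro k hk
      have : twoLevel i j !![1, 0; 0, star c] * (G' * G) * (U : Matrix ι ι ℂ) =
        twoLevel i j !![1, 0; 0, star c] * (G' * U') := by simp only [hU', Matrix.mul_assoc]
      rw [this, ← Matrix.mulVec_mulVec, ← Matrix.mulVec_mulVec]
      rcases Finset.mem_insert.1 hk with rfl | hkt
      · rw [hvec, Matrix.mulVec_smul]
        ext l
        rw [Pi.smul_apply, twoLevel_mulVec hji.symm]
        by_cases h1 : l = k
        · rw [mul_comm] at hcc; simpa [h1, ket_apply, hji] using hcc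
        · by_cases h2 : l = j <;> simp [h1, h2, ket_apply, hji]
      · have hki : k ≠ i := by rintro rfl; exact hi hkt
        rw [h2 k hkt, (g3 k hki (by simp [hkt])).2]
        ext l
        rw [twoLevel_mulVec hji.symm]
        by_cases h1 : l = i
        · simp [h1, ket_apply, hki.symm]
        · by_cases h2 : l = j <;> simp [h1, h2, ket_apply, hki.symm, hji]

/-- Every unitary is a product of a fixed number of two-level unitaries. -/
theorem exists_twoLevel_list [Nontrivial ι] (U : Matrix.unitaryGroup ι ℂ) :
    ∃ l : List (TwoLevel ι), l.length = Fintype.card ι * (Fintype.card ι + 1) ∧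
      (l.map TwoLevel.mat).prod = U := by
  obtain ⟨G, h1, h2⟩ := exists_fix U Finset.univ
  have hGU : G * (U : Matrix ι ι ℂ) = 1 := matrix_ext_ket fun k => by rw [h2 k (Finset.mem_univ k)]; simp
  have hG : Gᴴ = U := by
    have := Matrix.mem_unitaryGroup_iff'.1 h1.mem
    rw [Matrix.star_eq_conjTranspose] at this
    calc Gᴴ = Gᴴ * (G * (U : Matrix ι ι ℂ)) := by rw [hGU, Matrix.mul_one]
      _ = (U : Matrix ι ι ℂ) := by rw [← Matrix.mul_assoc, this, Matrix.one_mul]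
  obtain ⟨l, hl, hl'⟩ := h1.conjTranspose
  obtain ⟨i, j, hij⟩ := exists_pair_ne ι
  -- Padding with identities makes the length depend on the dimension only, so that blocks with
  -- different unitaries can proceed in lockstep.
  refine ⟨l ++ List.replicate (Fintype.card ι * (Fintype.card ι + 1) - l.length)
    ⟨i, j, hij, 1⟩, ?_, ?_⟩
  · rw [Finset.card_univ] at hl
    simp; omega
  · rw [List.map_append, List.prod_append, hl', hG]
    simp [TwoLevel.mat, twoLevel_one hij]

end TwoLevel

/-! ### Layers given by families of disjoint gates. -/

section Family

variable {W R β : Type*} [Fintype W] [DecidableEq W] [Fintype R] [DecidableEq R]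

/-- The layer that consists of a family of gates with pairwise disjoint supports. -/
noncomputable def LayerSpec.ofFamily (tgt : β → W) (ht : Function.Injective tgt)
    (g : β → WireGate W R) (h1 : ∀ b b' j, (g b).ctl = some j → tgt b' ≠ j)
    (h2 : ∀ b b' j, (g b).ctl = some j → (g b').ctl = some j → b = b') : LayerSpec W R where
  gate := Function.extend tgt (fun b => some (g b)) fun _ => none
  free := by
    intro w g' j hg hj
    by_cases hw : ∃ b, tgt b = w
    · obtain ⟨b, rfl⟩ := hw
      rw [ht.extend_apply] at hg
      obtain rfl := Option.some.inj hg
      exact Function.extend_apply' _ _ _ (by rintro ⟨b', hb'⟩; exact h1 b b' j hj hb')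
    · rw [Function.extend_apply' _ _ _ hw] at hg; simp at hg
  inj := by
    intro w w' g' g'' j hg hg' hj hj'
    by_cases hw : ∃ b, tgt b = w
    · obtain ⟨b, rfl⟩ := hw
      by_cases hw' : ∃ b, tgt b = w'
      · obtain ⟨b', rfl⟩ := hw'
        rw [ht.extend_apply] at hg hg'
        obtain rfl := Option.some.inj hg
        obtain rfl := Option.some.inj hg'
        rw [h2 b b' j hj hj']
      · rw [Function.extend_apply' _ _ _ hw'] at hg'; simp at hg'
    · rw [Function.extend_apply' _ _ _ hw] at hg; simp at hg

variable {tgt : β → W} {ht : Function.Injective tgt}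
    {g : β → WireGate W R} {h1 : ∀ b b' j, (g b).ctl = some j → tgt b' ≠ j}
    {h2 : ∀ b b' j, (g b).ctl = some j → (g b').ctl = some j → b = b'}

lemma LayerSpec.site_ofFamily (s : R → Fin 2) (x : W → Fin 2) (b : β) :
    (LayerSpec.ofFamily tgt ht g h1 h2).site s x (tgt b) = (g b).act s x := by
  unfold LayerSpec.site LayerSpec.ofFamily
  simp only [ht.extend_apply]

lemma LayerSpec.site_ofFamily_of_ne (s : R → Fin 2) (x : W → Fin 2) (w : W)
    (hw : ∀ b, tgt b ≠ w) : (LayerSpec.ofFamily tgt ht g h1 h2).site s x w = 1 := by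
  unfold LayerSpec.site LayerSpec.ofFamily
  simp only []
  rw [Function.extend_apply' _ _ _ (by rintro ⟨b', hb'⟩; exact hw b' hb')]

lemma LayerSpec.ofFamily_mulVec_ket_perm {s : R → Fin 2} {x y : W → Fin 2}
    (h : ∀ b a, (g b).act s x a (x (tgt b)) = if a = y (tgt b) then 1 else 0)
    (h' : ∀ w, (∀ b, tgt b ≠ w) → y w = x w) :
    (LayerSpec.ofFamily tgt ht g h1 h2).op s *ᵥ ket x = ket y := by
  apply perSite_mulVec_ket_of_perm
  intro w a
  by_cases hw : ∃ b, tgt b = w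
  · obtain ⟨b, rfl⟩ := hw
    rw [site_ofFamily, h]
  · push Not at hw
    rw [site_ofFamily_of_ne _ _ _ hw, h' w hw, Matrix.one_apply]

lemma LayerSpec.ofFamily_mulVec_ket_diag [Fintype β] {s : R → Fin 2} {x : W → Fin 2} {φ : β → ℂ}
    (h : ∀ b a, (g b).act s x a (x (tgt b)) = if a = x (tgt b) then φ b else 0) :
    (LayerSpec.ofFamily tgt ht g h1 h2).op s *ᵥ ket x = (∏ b, φ b) • ket x := by
  have := perSite_mulVec_ket_of_diag
    (V := (LayerSpec.ofFamily tgt ht g h1 h2).site s) (x := x)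
    (φ := Function.extend tgt φ 1) ?_
  · rw [LayerSpec.op, this]
    congr 1
    rw [← Finset.prod_image (s := Finset.univ) (g := tgt) (f := Function.extend tgt φ 1)
      ht.injOn |>.trans (Finset.prod_congr rfl fun b _ => ht.extend_apply _ _ _)]
    symm
    apply Finset.prod_subset (Finset.subset_univ _)
    intro w _ hw
    rw [Function.extend_apply']
    · rfl
    · rintro ⟨b, rfl⟩; simp at hw
  · intro w a
    by_cases hw : ∃ b, tgt b = w
    · obtain ⟨b, rfl⟩ := hw
      rw [site_ofFamily, h, ht.extend_apply]
    · rw [Function.extend_apply' _ _ _ hw]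
      push Not at hw
      rw [site_ofFamily_of_ne _ _ _ hw, Matrix.one_apply]; rfl

lemma LayerSpec.ofFamily_op_eq_prod [Fintype β] (s : R → Fin 2) :
    (LayerSpec.ofFamily tgt ht g h1 h2).op s =
      ((Finset.univ : Finset β).toList.map fun b => onT (tgt b) fun x => (g b).act s x).prod := by
  rw [LayerSpec.op_eq_prod _ s (Finset.univ : Finset β).toList tgt]
  · congr 1
    refine List.map_congr_left fun b _ => ?_
    congr 1; funext x; rw [site_ofFamily]
  · refine (Finset.nodup_toList (Finset.univ : Finset β)).imp ?_
    intro a b hab h; exact hab (ht h)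
  · intro w
    simp only [LayerSpec.ofFamily, Finset.mem_toList, Finset.mem_univ, true_and]
    by_cases hw : ∃ b, tgt b = w
    · obtain ⟨b, rfl⟩ := hw
      simp [ht.extend_apply]
    · rw [Function.extend_apply' _ _ _ hw]; simpa using hw

end Family

/-- The gate that exchanges `|0⟩` and `|1⟩`. -/
def pauliX : Matrix.unitaryGroup (Fin 2) ℂ :=
  ⟨!![0, 1; 1, 0], by
    rw [Matrix.mem_unitaryGroup_iff, Matrix.star_eq_conjTranspose]
    ext a b
    fin_cases a <;> fin_cases b <;>
      simp [Matrix.mul_apply, Fin.sum_univ_two, Matrix.conjTranspose_apply]⟩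

lemma pauliX_pow (c a b : Fin 2) :
    ((pauliX : Matrix (Fin 2) (Fin 2) ℂ) ^ (c : ℕ)) a b = if a = b + c then 1 else 0 := by
  fin_cases c <;> fin_cases a <;> fin_cases b <;> simp [pauliX]

lemma pauliX_apply (a b : Fin 2) :
    (pauliX : Matrix (Fin 2) (Fin 2) ℂ) a b = if a = b + 1 then 1 else 0 := by
  simpa using pauliX_pow 1 a b

/-! ### Unitaries on one-hot blocks. -/

section OneHot

variable {ι : Type*} [Fintype ι] [DecidableEq ι]

/-- The one-hot code; `none` is encoded by zeros. -/
def oneHot (o : Option ι) (v : ι) : Fin 2 := if o = some v then 1 else 0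

lemma oneHot_injective : Function.Injective (oneHot (ι := ι)) := by
  intro o o' h
  cases o with
  | none =>
    cases o' with
    | none => rfl
    | some v => have := congrFun h v; simp [oneHot] at this
  | some v =>
    have := congrFun h v
    by_contra hne
    rw [oneHot, oneHot, if_pos rfl, if_neg (Ne.symm hne)] at this
    simp at this

/-- The extension of an operator to the code words, with `none` left invariant. -/
def optLift (U : Matrix ι ι ℂ) : Matrix (Option ι) (Option ι) ℂ :=
  Matrix.of fun a b => match a, b with
    | none, none => 1
    | some a, some b => U a b
    | _, _ => 0

@[simp] lemma optLift_some (U : Matrix ι ι ℂ) (a b : ι) : optLift U (some a) (some b) = U a b := rfl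
@[simp] lemma optLift_none (U : Matrix ι ι ℂ) : optLift U none none = 1 := rfl
@[simp] lemma optLift_some_none (U : Matrix ι ι ℂ) (a : ι) : optLift U (some a) none = 0 := rfl
@[simp] lemma optLift_none_some (U : Matrix ι ι ℂ) (a : ι) : optLift U none (some a) = 0 := rfl

lemma optLift_mul (U V : Matrix ι ι ℂ) : optLift U * optLift V = optLift (U * V) := by
  ext a b
  cases a <;> cases b <;> simp [Matrix.mul_apply, Fintype.sum_option]

lemma optLift_one : optLift (1 : Matrix ι ι ℂ) = 1 := by
  ext a b
  cases a <;> cases b <;> simp [Matrix.one_apply]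

variable {W R B : Type*} [Fintype W] [DecidableEq W] [Fintype R] [DecidableEq R] [Fintype B]
  [DecidableEq B]

/-- The label in which the wires of the blocks are overwritten by `y`. -/
noncomputable def fill (emb : B × ι ↪ W) (x : W → Fin 2) (y : B → ι → Fin 2) : W → Fin 2 :=
  Function.extend emb (fun p => y p.1 p.2) x

lemma fill_apply (emb : B × ι ↪ W) (x : W → Fin 2) (y : B → ι → Fin 2) (b : B) (v : ι) :
    fill emb x y (emb (b, v)) = y b v := emb.injective.extend_apply _ _ _

lemma fill_apply_of_ne (emb : B × ι ↪ W) (x : W → Fin 2) (y : B → ι → Fin 2) {w : W}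
    (hw : ∀ b v, emb (b, v) ≠ w) : fill emb x y w = x w :=
  Function.extend_apply' _ _ _ (by rintro ⟨⟨b, v⟩, h⟩; exact hw b v h)

lemma fill_ext (emb : B × ι ↪ W) {x z : W → Fin 2} {y : B → ι → Fin 2}
    (h1 : ∀ b v, z (emb (b, v)) = y b v) (h2 : ∀ w, (∀ b v, emb (b, v) ≠ w) → z w = x w) :
    z = fill emb x y := by
  funext w
  by_cases hw : ∃ b v, emb (b, v) = w
  · obtain ⟨b, v, rfl⟩ := hw; rw [h1, fill_apply]
  · push Not at hw; rw [h2 w hw, fill_apply_of_ne emb x y hw]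

/-- The code between the layers of a two-level gate. -/
def midCode (t : TwoLevel ι) (o : Option ι) (v : ι) : Fin 2 :=
  oneHot o v + if v = t.j ∧ o = some t.i then 1 else 0

variable {w c : ℕ} {G : GateSet} {ιW : W ↪ Fin w} {κ : R ↪ Fin c}

/-- A CNOT from wire `i` to wire `j` in each block. Afterwards wire `j` tells whether the level is
`i` or `j`, while wire `i` tells which of the two. The CNOT is its own inverse, hence the two
directions. -/
lemma blocks_cnot (emb : B × ι ↪ W) (t : B → TwoLevel ι) :
    ∃ L : LayerSpec W R, ∀ s x (o : B → Option ι),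
      L.op s *ᵥ ket (fill emb x fun b => oneHot (o b)) = ket (fill emb x fun b => midCode (t b) (o b))
      ∧ L.op s *ᵥ ket (fill emb x fun b => midCode (t b) (o b)) =
        ket (fill emb x fun b => oneHot (o b)) := by
  have hinj : Function.Injective fun b : B => emb (b, (t b).j) := fun b b' h => by
    simpa using congrArg Prod.fst (emb.injective h)
  refine ⟨LayerSpec.ofFamily (fun b : B => emb (b, (t b).j)) hinj
    (fun b => ⟨none, some (emb (b, (t b).i)), pauliX⟩) ?_ ?_, fun s x o => ⟨?_, ?_⟩⟩
  · intro b b' j hj h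
    simp only [Option.some.injEq] at hj
    rw [← hj] at h
    have := emb.injective h
    simp only [Prod.mk.injEq] at this
    obtain ⟨rfl, h'⟩ := this
    exact (t b').ne h'.symm
  · intro b b' j hj hj'
    simp only [Option.some.injEq] at hj hj'
    have := emb.injective (hj.trans hj'.symm)
    exact congrArg Prod.fst this
  · apply LayerSpec.ofFamily_mulVec_ket_perm
    · intro b a
      simp only [WireGate.act, fill_apply]
      simp only [reduceCtorEq, false_imp_iff, implies_true, if_true, pauliX_pow]
      congr 2
      simp [midCode, oneHot]
    · intro v hv
      by_cases h : ∃ b u, emb (b, u) = v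
      · obtain ⟨b, u, rfl⟩ := h
        rw [fill_apply, fill_apply, midCode, if_neg, add_zero]
        rintro ⟨rfl, -⟩; exact hv b rfl
      · push Not at h
        rw [fill_apply_of_ne _ _ _ h, fill_apply_of_ne _ _ _ h]
  · apply LayerSpec.ofFamily_mulVec_ket_perm
    · intro b a
      simp only [WireGate.act, fill_apply]
      simp only [reduceCtorEq, false_imp_iff, implies_true, if_true, pauliX_pow]
      congr 2
      have hne := (t b).ne
      have h2 : ∀ y z : Fin 2, y = y + z + z := by decide
      simp only [midCode, oneHot, hne, true_and, false_and, if_false, add_zero]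
      exact (h2 _ _).symm
    · intro v hv
      by_cases h : ∃ b u, emb (b, u) = v
      · obtain ⟨b, u, rfl⟩ := h
        rw [fill_apply, fill_apply, midCode, if_neg, add_zero]
        rintro ⟨rfl, -⟩; exact hv b rfl
      · push Not at h
        rw [fill_apply_of_ne _ _ _ h, fill_apply_of_ne _ _ _ h]

lemma fill_update (emb : B × ι ↪ W) (x : W → Fin 2) (o : B → Option ι)
    (F : B → Option ι → ι → Fin 2) (b : B) (v : ι) (a : Fin 2) (o' : Option ι)
    (h1 : F b o' v = a) (h2 : ∀ u, u ≠ v → F b o' u = F b (o b) u) :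
    Function.update (fill emb x fun b => F b (o b)) (emb (b, v)) a =
      fill emb x fun b' => F b' (Function.update o b o' b') := by
  apply fill_ext
  · intro b' v'
    by_cases hb : b' = b
    · subst hb
      by_cases hv : v' = v
      · subst hv; simp [h1]
      · rw [Function.update_of_ne]
        · simp [fill_apply, h2 v' hv]
        · intro h; exact hv (by simpa using emb.injective h)
    · rw [Function.update_of_ne]
      · simp [fill_apply, hb]
      · intro h; exact hb (congrArg Prod.fst (emb.injective h))
  · intro w hw
    rw [Function.update_of_ne (hw b v).symm, fill_apply_of_ne _ _ _ hw]

/-- In the intermediate code the levels `i` and `j` are the states `1` and `0` of wire `i` with wire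
`j` equal to `1`, so the two-level gate is the one-qubit gate `u` on wire `i` controlled by wire
`j`. On all other levels, and on the empty block, the control is `0`. -/
lemma blocks_ctrl (emb : B × ι ↪ W) (t : B → TwoLevel ι) :
    ∃ L : LayerSpec W R, ∀ s x,
      L.op s * relabel (fun o : B → Option ι => fill emb x fun b => midCode (t b) (o b)) =
      relabel (fun o : B → Option ι => fill emb x fun b => midCode (t b) (o b)) *
        perSite fun _ b => optLift (t b).mat := by
  have hinj : Function.Injective fun b : B => emb (b, (t b).i) := fun b b' h => by
    simpa using congrArg Prod.fst (emb.injective h)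
  refine ⟨LayerSpec.ofFamily (fun b : B => emb (b, (t b).i)) hinj
    (fun b => ⟨none, some (emb (b, (t b).j)), (t b).u⟩) ?_ ?_, fun s x => ?_⟩
  · intro b b' j hj h
    simp only [Option.some.injEq] at hj
    rw [← hj] at h
    have := emb.injective h
    simp only [Prod.mk.injEq] at this
    obtain ⟨rfl, h'⟩ := this
    exact (t b').ne h'
  · intro b b' j hj hj'
    simp only [Option.some.injEq] at hj hj'
    have := emb.injective (hj.trans hj'.symm)
    exact congrArg Prod.fst this
  · rw [LayerSpec.ofFamily_op_eq_prod]
    have hper : perSite (fun (_ : B → Option ι) b => optLift (t b).mat) =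
        ((Finset.univ : Finset B).toList.map fun b => onT b fun _ => optLift (t b).mat).prod := by
      rw [prod_onT (t := fun b => b)]
      · congr 1
        funext _ b
        exact (prod_map_ite (Finset.univ : Finset B).toList (fun b => b) (Finset.nodup_toList _)
          (fun b => optLift (t b).mat) b (by simp)).symm
      · exact Finset.nodup_toList _
      · intros; rfl
    rw [hper]
    apply list_prod_intertwine
    intro b _
    refine matrix_ext_ket fun o => ?_
    rw [← Matrix.mulVec_mulVec, ← Matrix.mulVec_mulVec, relabel_mulVec_ket, onT_mulVec_ket,
      onT_mulVec_ket, Matrix.mulVec_sum]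
    simp only [Matrix.mulVec_smul, relabel_mulVec_ket, fill_apply]
    have hne := (t b).ne
    have hne' := (t b).ne.symm
    have hact : WireGate.act (R := R) ⟨none, some (emb (b, (t b).j)), (t b).u⟩ s
        (fill emb x fun b => midCode (t b) (o b)) =
        ((t b).u : Matrix (Fin 2) (Fin 2) ℂ) ^ (midCode (t b) (o b) (t b).j : ℕ) := by
      simp [WireGate.act, fill_apply]
    rw [hact]
    have hupd : ∀ a o', midCode (t b) o' (t b).i = a →
        (∀ u, u ≠ (t b).i → midCode (t b) o' u = midCode (t b) (o b) u) →
        Function.update (fill emb x fun b => midCode (t b) (o b)) (emb (b, (t b).i)) a =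
        fill emb x fun b' => midCode (t b') (Function.update o b o' b') := fun a o' h1 h2 =>
      fill_update emb x o (fun b => midCode (t b)) b _ a o' h1 h2
    rw [Fintype.sum_option, Fin.sum_univ_two]
    -- With the control on, the values `1` and `0` of wire `i` are exactly the code words of `i` and
    -- `j`; with the control off, the update of wire `i` changes nothing.
    by_cases hij : o b = some (t b).i ∨ o b = some (t b).j
    · have e1 : midCode (t b) (o b) (t b).j = 1 := by
        rcases hij with h | h <;> simp [midCode, oneHot, h, hne, hne']
      have e2 : ∀ u, u ≠ (t b).i → midCode (t b) (some (t b).i) u = midCode (t b) (o b) u := by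
        intro u hu
        rcases hij with h | h
        · rw [h]
        · rw [h]
          by_cases huj : u = (t b).j
          · subst huj; simp [midCode, oneHot, hne, hne']
          · simp [midCode, oneHot, hne, hne', huj, Ne.symm huj, hu.symm]
      have e3 : ∀ u, u ≠ (t b).i → midCode (t b) (some (t b).j) u = midCode (t b) (o b) u := by
        intro u hu
        rcases hij with h | h
        · rw [h]
          by_cases huj : u = (t b).j
          · subst huj; simp [midCode, oneHot, hne, hne']
          · simp [midCode, oneHot, hne, hne', huj, Ne.symm huj, hu.symm]
        · rw [h]
      rw [hupd 1 (some (t b).i) (by simp [midCode, oneHot, hne]) e2,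
        hupd 0 (some (t b).j) (by simp [midCode, oneHot, hne, hne']) e3, e1]
      rw [Fintype.sum_eq_add (t b).i (t b).j hne]
      · rcases hij with h | h <;>
          simp [h, TwoLevel.mat, twoLevel, hne, hne', midCode, oneHot, add_comm]
      · rintro v ⟨hv, hv'⟩
        rcases hij with h | h <;>
          simp [h, TwoLevel.mat, twoLevel, hne, hne', hv, hv']
    · rw [not_or] at hij
      have e1 : midCode (t b) (o b) (t b).j = 0 := by simp [midCode, oneHot, hij]
      have e0 : midCode (t b) (o b) (t b).i = 0 := by simp [midCode, oneHot, hij]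
      rw [e1, e0]
      have hself := hupd 0 (o b) e0 (fun u _ => rfl)
      rw [hself]
      cases hob : o b with
      | none => simp [hob]
      | some v =>
        rw [hob] at hij
        have hvi : v ≠ (t b).i := fun h => hij.1 (by rw [h])
        have hvj : v ≠ (t b).j := fun h => hij.2 (by rw [h])
        rw [Finset.sum_eq_single v]
        · simp [TwoLevel.mat, twoLevel, hvi, hvj]
        · intro v' _ hv'
          simp only [optLift_some, TwoLevel.mat, twoLevel, Matrix.of_apply, hvi, hvj, if_false, hv']
          split_ifs <;> simp
        · simp

/-- Every family of unitaries on one-hot blocks is implemented in constant depth. -/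
theorem exists_impl_blocks [Nontrivial ι] (emb : B × ι ↪ W)
    (U : B → Matrix.unitaryGroup ι ℂ) :
    ∃ V : (R → Fin 2) → Matrix (W → Fin 2) (W → Fin 2) ℂ,
      Impl G ιW κ (3 * (Fintype.card ι * (Fintype.card ι + 1))) V ∧
      ∀ s x, V s * relabel (fun o : B → Option ι => fill emb x fun b => oneHot (o b)) =
        relabel (fun o : B → Option ι => fill emb x fun b => oneHot (o b)) *
          perSite fun _ b => optLift (U b : Matrix ι ι ℂ) := by
  choose l hl hl' using fun b => exists_twoLevel_list (U b)
  simp only [← hl']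
  clear hl'
  revert l
  -- Induction on the common length of the lists: each round uses three layers for all blocks at
  -- once. The head of a list is the leftmost factor, so the tail is applied first.
  generalize Fintype.card ι * (Fintype.card ι + 1) = n
  induction n with
  | zero =>
    intro l hl
    refine ⟨fun _ => 1, Impl.one, fun s x => ?_⟩
    have : ∀ b, l b = [] := fun b => List.length_eq_zero_iff.1 (hl b)
    simp [this, optLift_one, perSite_one]
  | succ n ih =>
    intro l hl
    have hcons : ∀ b, ∃ t l', l b = t :: l' ∧ l'.length = n := fun b => by
      cases h : l b with
      | nil => have := hl b; simp [h] at this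
      | cons t l' => exact ⟨t, l', rfl, by have := hl b; simpa [h] using this⟩
    choose t l' ht hlen using hcons
    obtain ⟨V, hV, hV'⟩ := ih l' hlen
    obtain ⟨L1, h1⟩ := blocks_cnot (R := R) emb t
    obtain ⟨L2, h2⟩ := blocks_ctrl (R := R) emb t
    refine ⟨_, ((hV.mul L1.impl).mul (L2.impl)).mul L1.impl |>.mono (by omega), fun s x => ?_⟩
    have e1 : L1.op s * relabel (fun o : B → Option ι => fill emb x fun b => oneHot (o b)) =
        relabel (fun o : B → Option ι => fill emb x fun b => midCode (t b) (o b)) :=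
      matrix_ext_ket fun o => by
        rw [← Matrix.mulVec_mulVec, relabel_mulVec_ket, relabel_mulVec_ket, (h1 s x o).1]
    have e2 : L1.op s * relabel (fun o : B → Option ι => fill emb x fun b => midCode (t b) (o b)) =
        relabel (fun o : B → Option ι => fill emb x fun b => oneHot (o b)) :=
      matrix_ext_ket fun o => by
        rw [← Matrix.mulVec_mulVec, relabel_mulVec_ket, relabel_mulVec_ket, (h1 s x o).2]
    have e3 : perSite (fun (_ : B → Option ι) b => optLift ((l b).map TwoLevel.mat).prod) =
        perSite (fun (_ : B → Option ι) b => optLift (t b).mat) *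
          perSite (fun (_ : B → Option ι) b => optLift ((l' b).map TwoLevel.mat).prod) := by
      rw [perSite_mul fun _ _ _ => rfl]
      simp only [ht, List.map_cons, List.prod_cons, optLift_mul]
    rw [e3]
    set J := relabel (fun o : B → Option ι => fill emb x fun b => oneHot (o b))
    set J' := relabel (fun o : B → Option ι => fill emb x fun b => midCode (t b) (o b))
    set P := perSite (fun (_ : B → Option ι) b => optLift ((l' b).map TwoLevel.mat).prod)
    calc _ = L1.op s * (L2.op s * (L1.op s * (V s * J))) := by simp only [Matrix.mul_assoc]
      _ = L1.op s * (L2.op s * ((L1.op s * J) * P)) := by rw [hV' s x]; simp only [J, Matrix.mul_assoc]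
      _ = L1.op s * ((L2.op s * J') * P) := by rw [e1]; simp only [Matrix.mul_assoc]
      _ = (L1.op s * J') * (perSite (fun _ b => optLift (t b).mat) * P) := by
        rw [h2]; simp only [J', Matrix.mul_assoc]
      _ = _ := by rw [e2]

end OneHot

/-! ### Conjugation computed on kets. -/

section ConjBas

variable {S X Λ Λ' : Type*} [Fintype S] [Fintype X] [DecidableEq S] [DecidableEq X] [Fintype Λ]
  [Fintype Λ']

lemma conjBy_bas_apply (V : S → Matrix X X ℂ) (s : S) (x y : X) :
    conjBy V (bas s x y) = Pi.single s (Matrix.of fun a b => V s a x * star (V s b y)) := by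
  funext t
  rw [conjBy_apply]
  by_cases h : t = s
  · subst h
    ext a b
    simp only [bas, Pi.single_eq_same, Matrix.of_apply, Matrix.mul_apply,
      Matrix.conjTranspose_apply, Matrix.single_apply]
    rw [Finset.sum_eq_single y, Finset.sum_eq_single x]
    · simp
    · intro c _ hc; simp [hc.symm]
    · simp
    · intro c _ hc; simp [hc.symm]
    · simp
  · simp [bas, h]

/-- The ket and the bra of `|x⟩⟨y|` evolve separately. Hence it is enough to know the action of `V`
on basis vectors, with conjugate amplitudes for `y`. -/
lemma conjBy_bas_sum {V : S → Matrix X X ℂ} {s : S} {x y : X} {α : Λ → ℂ} {f : Λ → X}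
    {β : Λ' → ℂ} {g : Λ' → X} (hx : V s *ᵥ ket x = ∑ l, α l • ket (f l))
    (hy : V s *ᵥ ket y = ∑ l, β l • ket (g l)) :
    conjBy V (bas s x y) = ∑ l, ∑ l', (α l * star (β l')) • bas s (f l) (g l') := by
  rw [conjBy_bas_apply]
  funext t
  ext a b
  have hx' := congrFun hx a
  have hy' := congrFun hy b
  rw [mulVec_ket_apply] at hx' hy'
  simp only [Finset.sum_apply, Matrix.sum_apply, Pi.smul_apply, Matrix.smul_apply, smul_eq_mul]
    at hx' hy' ⊢
  by_cases h : t = s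
  · subst h
    simp only [Pi.single_eq_same, Matrix.of_apply, bas, Matrix.single_apply]
    rw [hx', hy', star_sum, Finset.sum_mul_sum]
    refine Finset.sum_congr rfl fun l _ => Finset.sum_congr rfl fun l' _ => ?_
    simp only [ket_apply, star_mul', eq_comm (a := f l), eq_comm (a := g l')]
    by_cases h1 : a = f l <;> by_cases h2 : b = g l' <;> simp [h1, h2]
  · simp [h, bas]

lemma conjBy_bas_ket {V : S → Matrix X X ℂ} {s : S} {x y x' y' : X} {α β : ℂ}
    (hx : V s *ᵥ ket x = α • ket x') (hy : V s *ᵥ ket y = β • ket y') :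
    conjBy V (bas s x y) = (α * star β) • bas s x' y' := by
  have := conjBy_bas_sum (Λ := Unit) (Λ' := Unit) (α := fun _ => α) (f := fun _ => x')
    (β := fun _ => β) (g := fun _ => y') (V := V) (s := s) (x := x) (y := y)
    (by simpa using hx) (by simpa using hy)
  simpa using this

end ConjBas

/-! ### Diagonal layers. -/

section Diagonal

variable {W R β : Type*} [Fintype W] [DecidableEq W] [Fintype R] [DecidableEq R] [Fintype β]
  {w c : ℕ} {G : GateSet} {ι : W ↪ Fin w} {κ : R ↪ Fin c}

/-- The phase gate `diag(1, z)`. -/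
noncomputable def phaseGate (z : Circle) : Matrix.unitaryGroup (Fin 2) ℂ :=
  ⟨!![1, 0; 0, (z : ℂ)], by
    have hz : (z : ℂ) * (starRingEnd ℂ) z = 1 := by
      rw [Complex.mul_conj, Circle.normSq_coe]; simp
    rw [Matrix.mem_unitaryGroup_iff, Matrix.star_eq_conjTranspose]
    ext a b
    fin_cases a <;> fin_cases b <;>
      simp [Matrix.mul_apply, Fin.sum_univ_two, Matrix.conjTranspose_apply, hz]⟩

lemma phaseGate_pow (z : Circle) (c a b : Fin 2) :
    ((phaseGate z : Matrix (Fin 2) (Fin 2) ℂ) ^ (c : ℕ)) a b =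
      if a = b then (if c = 1 ∧ b = 1 then (z : ℂ) else 1) else 0 := by
  fin_cases c <;> fin_cases a <;> fin_cases b <;> simp [phaseGate]

/-- The factors commute, so their order is irrelevant. The depth grows with the number of factors;
the index sets used below are `ZMod q` and its square, of bounded size. -/
lemma Impl.diag_prod {τ : Type*} [Fintype τ] {n : ℕ} (χ : τ → (R → Fin 2) → (W → Fin 2) → ℂ)
    (h : ∀ t, Impl G ι κ n fun s => Matrix.diagonal (χ t s)) :
    Impl G ι κ (n * Fintype.card τ) fun s => Matrix.diagonal fun x => ∏ t, χ t s x := by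
  classical
  have : ∀ T : Finset τ, Impl G ι κ (n * T.card)
      fun s => Matrix.diagonal fun x => ∏ t ∈ T, χ t s x := by
    intro T
    induction T using Finset.induction_on with
    | empty => simpa using Impl.one
    | insert t T ht ih =>
      have := (ih.mul (h t)).mono (n' := n * (insert t T).card)
        (by rw [Finset.card_insert_of_notMem ht]; linarith)
      simpa [Matrix.diagonal_mul_diagonal, Finset.prod_insert ht] using this
  exact this Finset.univ

lemma diagonal_of_ket {V : Matrix (W → Fin 2) (W → Fin 2) ℂ} {χ : (W → Fin 2) → ℂ}
    (h : ∀ x, V *ᵥ ket x = χ x • ket x) : V = Matrix.diagonal χ := by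
  refine matrix_ext_ket fun x => ?_
  rw [h]
  ext y
  rw [mulVec_ket_apply, Matrix.diagonal_apply, Pi.smul_apply, ket_apply]
  split_ifs with h
  · simp [h]
  · simp

lemma diagonal_mulVec_ket {X : Type*} [Fintype X] [DecidableEq X] (χ : X → ℂ) (x : X) :
    Matrix.diagonal χ *ᵥ ket x = χ x • ket x := by
  ext y
  rw [mulVec_ket_apply, Matrix.diagonal_apply, Pi.smul_apply, ket_apply]
  split_ifs with h
  · simp [h]
  · simp

/-- A layer of controlled phase gates. -/
lemma impl_cphase (tgt ctl : β → W) (ht : Function.Injective tgt) (hc : Function.Injective ctl)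
    (htc : ∀ b b', tgt b ≠ ctl b') (z : β → Circle) (cond : β → Option (R × Fin 2)) :
    Impl G ι κ 1 fun s => Matrix.diagonal fun x => ∏ b,
      if (∀ r v, cond b = some (r, v) → s r = v) ∧ x (ctl b) = 1 ∧ x (tgt b) = 1 then (z b : ℂ)
        else 1 := by
  have := (LayerSpec.ofFamily tgt ht (fun b => ⟨cond b, some (ctl b), phaseGate (z b)⟩)
    (by intro b b' j hj; simp only [Option.some.injEq] at hj; rw [← hj]; exact htc b' b)
    (by intro b b' j hj hj'; simp only [Option.some.injEq] at hj hj'; exact hc (hj.trans hj'.symm))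
    : LayerSpec W R).impl (G := G) (ι := ι) (κ := κ)
  convert this using 2 with s
  symm
  refine diagonal_of_ket fun x => LayerSpec.ofFamily_mulVec_ket_diag ?_
  intro b a
  have := phaseGate_pow (z b) (x (ctl b)) a (x (tgt b))
  simp only [WireGate.act]
  by_cases hs : ∀ r v, cond b = some (r, v) → s r = v
  · rw [if_pos hs, this]; congr 1; exact (if_congr (and_iff_right hs) rfl rfl).symm
  · rw [if_neg hs, Matrix.one_apply, if_neg (c := _ ∧ _) fun h => hs h.1]

/-- A layer of phase gates. -/
lemma impl_phase (tgt : β → W) (ht : Function.Injective tgt)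
    (z : β → Circle) (cond : β → Option (R × Fin 2)) :
    Impl G ι κ 1 fun s => Matrix.diagonal fun x => ∏ b,
      if (∀ r v, cond b = some (r, v) → s r = v) ∧ x (tgt b) = 1 then (z b : ℂ) else 1 := by
  have := (LayerSpec.ofFamily tgt ht (fun b => ⟨cond b, none, phaseGate (z b)⟩)
    (by intro b b' j hj; simp at hj) (by intro b b' j hj hj'; simp at hj)
    : LayerSpec W R).impl (G := G) (ι := ι) (κ := κ)
  convert this using 2 with s
  symm
  refine diagonal_of_ket fun x => LayerSpec.ofFamily_mulVec_ket_diag ?_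
  intro b a
  have := phaseGate_pow (z b) 1 a (x (tgt b))
  simp only [Fin.isValue, Fin.val_one, pow_one, true_and] at this
  simp only [WireGate.act]
  split_ifs <;> simp_all [Matrix.one_apply]

end Diagonal

/-! ### The Fourier transform on `ZMod q`. -/

section Fourier

variable (q : ℕ) [NeZero q] {L : Type*} [Fintype L] [DecidableEq L]

/-- The additive character `t ↦ exp (2 π i t / q)`. -/
noncomputable def omega (t : ZMod q) : ℂ := (ZMod.toCircle t : ℂ)

lemma omega_add (s t : ZMod q) : omega q (s + t) = omega q s * omega q t := by
  simp [omega, AddChar.map_add_eq_mul]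

lemma omega_zero : omega q 0 = 1 := by simp [omega]

lemma star_omega (t : ZMod q) : star (omega q t) = omega q (-t) := by
  rw [omega, omega, AddChar.map_neg_eq_inv, Circle.coe_inv_eq_conj]; rfl

lemma omega_sum {A : Type*} (s : Finset A) (f : A → ZMod q) :
    omega q (∑ a ∈ s, f a) = ∏ a ∈ s, omega q (f a) := by
  classical
  induction s using Finset.induction_on with
  | empty => simp [omega_zero]
  | insert a s ha ih => rw [Finset.sum_insert ha, Finset.prod_insert ha, omega_add, ih]

lemma sum_omega (t : ZMod q) : ∑ m : ZMod q, omega q (m * t) = if t = 0 then (q : ℂ) else 0 := by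
  have := AddChar.sum_mulShift t (ZMod.isPrimitive_stdAddChar q)
  simpa [ZMod.stdAddChar_apply, omega] using this

/-- The normalization `1 / √q`. -/
noncomputable def invSqrt : ℂ := ((Real.sqrt q : ℝ) : ℂ)⁻¹

lemma invSqrt_mul_self : invSqrt q * invSqrt q * q = 1 := by
  have hq : (0 : ℝ) < q := by exact_mod_cast Nat.pos_of_ne_zero (NeZero.ne q)
  have h : ((Real.sqrt q : ℝ) : ℂ) * ((Real.sqrt q : ℝ) : ℂ) = q := by
    rw [← Complex.ofReal_mul, Real.mul_self_sqrt hq.le]; simp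
  have h0 : ((Real.sqrt q : ℝ) : ℂ) ≠ 0 := by exact_mod_cast (Real.sqrt_pos.2 hq).ne'
  unfold invSqrt
  rw [← h]; field_simp

lemma star_invSqrt : star (invSqrt q) = invSqrt q := by
  unfold invSqrt; rw [star_inv₀]; congr 1; exact Complex.conj_ofReal _

/-- The Fourier transform on `ZMod q`. -/
noncomputable def fourier : Matrix.unitaryGroup (ZMod q) ℂ :=
  ⟨Matrix.of fun u v => invSqrt q * omega q (u * v), by
    rw [Matrix.mem_unitaryGroup_iff, Matrix.star_eq_conjTranspose]
    ext a b
    simp only [Matrix.mul_apply, Matrix.conjTranspose_apply, Matrix.of_apply, star_mul',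
      star_invSqrt, star_omega]
    have : ∀ x, invSqrt q * omega q (a * x) * (invSqrt q * omega q (-(b * x))) =
        invSqrt q * invSqrt q * omega q (x * (a - b)) := by
      intro x
      rw [show x * (a - b) = a * x + -(b * x) by ring, omega_add]; ring
    simp only [this]
    rw [← Finset.mul_sum, sum_omega, Matrix.one_apply]
    by_cases h : a = b
    · simp [h, invSqrt_mul_self]
    · simp [h, sub_eq_zero]⟩

lemma fourier_apply (u v : ZMod q) :
    (fourier q : Matrix (ZMod q) (ZMod q) ℂ) u v = invSqrt q * omega q (u * v) := rfl

lemma star_fourier_apply (u v : ZMod q) :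
    ((star (fourier q) : Matrix.unitaryGroup (ZMod q) ℂ) : Matrix (ZMod q) (ZMod q) ℂ) u v =
      invSqrt q * omega q (-(u * v)) := by
  change star ((fourier q : Matrix (ZMod q) (ZMod q) ℂ) v u) = _
  rw [fourier_apply, star_mul', star_invSqrt, star_omega, mul_comm v u]

/-- Phase kickback: if a register in uniform superposition over `m` picks up the phase `ω(m t)`, the
inverse Fourier transform writes `t` into it. The proof is the orthogonality of characters, one
factor for each `l`. -/
lemma fourier_inversion {M : Type*} [AddCommGroup M] [Module ℂ M] (t : L → ZMod q)
    (g : (L → ZMod q) → M) :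
    ∑ m : L → ZMod q, (∏ l, (invSqrt q * omega q (m l * t l))) •
      ∑ m' : L → ZMod q, (∏ l, (invSqrt q * omega q (-(m' l * m l)))) • g m' = g t := by
  simp only [Finset.smul_sum, smul_smul]
  rw [Finset.sum_comm]
  simp only [← Finset.sum_smul, ← Finset.prod_mul_distrib]
  have key : ∀ m' : L → ZMod q, ∑ m : L → ZMod q, ∏ l, (invSqrt q * omega q (m l * t l) *
      (invSqrt q * omega q (-(m' l * m l)))) = if m' = t then 1 else 0 := by
    intro m'
    have h1 := Finset.prod_univ_sum (fun _ : L => (Finset.univ : Finset (ZMod q)))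
      (fun l x => invSqrt q * omega q (x * t l) * (invSqrt q * omega q (-(m' l * x))))
    simp only [Fintype.piFinset_univ] at h1
    rw [← h1]
    have h2 : ∀ l, ∑ x : ZMod q, invSqrt q * omega q (x * t l) *
        (invSqrt q * omega q (-(m' l * x))) = if m' l = t l then 1 else 0 := by
      intro l
      have : ∀ x, invSqrt q * omega q (x * t l) * (invSqrt q * omega q (-(m' l * x))) =
          invSqrt q * invSqrt q * omega q (x * (t l - m' l)) := by
        intro x
        rw [show x * (t l - m' l) = x * t l + -(m' l * x) by ring, omega_add]; ring
      simp only [this]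
      rw [← Finset.mul_sum, sum_omega]
      by_cases h : m' l = t l
      · simp [h, invSqrt_mul_self]
      · simp [h, sub_eq_zero, Ne.symm h]
    simp only [h2]
    by_cases h : m' = t
    · simp [h]
    · obtain ⟨l, hl⟩ := Function.ne_iff.1 h
      rw [Finset.prod_eq_zero (Finset.mem_univ l) (by simp [hl]), if_neg h]
  simp [key]

end Fourier

section SomeBlocks

variable {ι B : Type*} [Fintype ι] [DecidableEq ι] [Fintype B] [DecidableEq B]

lemma perSite_optLift_mulVec_ket (U : B → Matrix ι ι ℂ) (v : B → ι) :
    perSite (fun _ b => optLift (U b)) *ᵥ ket (fun b => some (v b)) =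
      ∑ u : B → ι, (∏ b, U b (u b) (v b)) • ket fun b => some (u b) := by
  ext o
  rw [mulVec_ket_apply, perSite_apply]
  simp only [Finset.sum_apply, Pi.smul_apply, ket_apply, smul_eq_mul, mul_ite, mul_one, mul_zero]
  by_cases ho : ∃ u : B → ι, o = fun b => some (u b)
  · obtain ⟨u, rfl⟩ := ho
    rw [Finset.sum_eq_single u]
    · simp
    · intro u' _ hu'
      rw [if_neg]
      intro h
      exact hu' (funext fun b => by simpa using (congrFun h b).symm)
    · simp
  · rw [Finset.sum_eq_zero]
    · have : ∃ b, o b = none := by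
        by_contra hne
        push Not at hne
        exact ho ⟨fun b => (o b).get (Option.isSome_iff_ne_none.2 (hne b)), by simp⟩
      obtain ⟨b, hb⟩ := this
      rw [Finset.prod_eq_zero (Finset.mem_univ b)]
      simp [hb]
    · intro u _
      rw [if_neg]
      intro h; exact ho ⟨u, h⟩

end SomeBlocks

/-! ### Chains of shifted copies of the data bits. -/

section Chain

variable {D RX : Type*} [Fintype D] [DecidableEq D] [Fintype RX] [DecidableEq RX] {N : ℕ}
  {q : ℕ} [Fact q.Prime]

/-- The data wires together with the wires of the chains: for every link `(j, i)` two one-hot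
blocks for elements of `ZMod q`. -/
abbrev ChainWire (q : ℕ) (D : Type*) (N : ℕ) : Type _ := D ⊕ ((D × Fin N) × Bool × ZMod q)

/-- The wires of all blocks of one kind. -/
def chainEmb (k : Bool) : (D × Fin N) × ZMod q ↪ ChainWire q D N :=
  ⟨fun p => Sum.inr (p.1, k, p.2), fun p p' h => by
    simp only [Sum.inr.injEq, Prod.mk.injEq, true_and] at h
    exact Prod.ext h.1 h.2⟩

/-- The basis label with data `x` and chain contents `a` and `f`. -/
def conf (x : D → Fin 2) (a f : D × Fin N → Option (ZMod q)) : ChainWire q D N → Fin 2 :=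
  Sum.elim x fun p => oneHot (if p.2.1 then f p.1 else a p.1) p.2.2

@[simp] lemma conf_inl (x : D → Fin 2) (a f : D × Fin N → Option (ZMod q)) (j : D) :
    conf x a f (.inl j) = x j := rfl
@[simp] lemma conf_false (x : D → Fin 2) (a f : D × Fin N → Option (ZMod q)) (l : D × Fin N)
    (v : ZMod q) : conf x a f (.inr (l, false, v)) = oneHot (a l) v := rfl
@[simp] lemma conf_true (x : D → Fin 2) (a f : D × Fin N → Option (ZMod q)) (l : D × Fin N)
    (v : ZMod q) : conf x a f (.inr (l, true, v)) = oneHot (f l) v := rfl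

lemma conf_eq_fill_false (x : D → Fin 2) (a a' f : D × Fin N → Option (ZMod q)) :
    conf x a f = fill (chainEmb false) (conf x a' f) fun l => oneHot (a l) := by
  apply fill_ext
  · intro l v; rfl
  · rintro (j | ⟨l, k, v⟩) hw
    · rfl
    · cases k
      · exact absurd rfl (hw l v)
      · rfl

lemma conf_eq_fill_true (x : D → Fin 2) (a f f' : D × Fin N → Option (ZMod q)) :
    conf x a f = fill (chainEmb true) (conf x a f') fun l => oneHot (f l) := by
  apply fill_ext
  · intro l v; rfl
  · rintro (j | ⟨l, k, v⟩) hw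
    · rfl
    · cases k
      · rfl
      · exact absurd rfl (hw l v)

lemma pad_inl_eq_conf (x : D → Fin 2) :
    pad (Sum.inl : D → ChainWire q D N) x = conf x (fun _ => none) fun _ => none := by
  symm
  apply pad_ext Sum.inl_injective
  · intro i; rfl
  · rintro (j | ⟨l, k, v⟩) h
    · exact absurd rfl (h j)
    · cases k <;> simp [oneHot]

variable {R : Type*} [Fintype R] [DecidableEq R] {w c : ℕ} {G : GateSet}
  {ι : ChainWire q D N ↪ Fin w} {κ : R ↪ Fin c}

instance : Nontrivial (ZMod q) := ZMod.nontrivial_iff.2 (Fact.out (p := q.Prime)).one_lt.ne'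

/-- The depth of the layers that implement a unitary on one-hot blocks of length `q`. -/
def blockDepth (q : ℕ) : ℕ := 3 * (q * (q + 1))

lemma exists_impl_chain_false (U : Matrix.unitaryGroup (ZMod q) ℂ) :
    ∃ V, Impl G ι κ (blockDepth q) V ∧ ∀ s x (a : D × Fin N → ZMod q) f,
      V s *ᵥ ket (conf x (fun l => some (a l)) f) =
        ∑ a' : D × Fin N → ZMod q, (∏ l, (U : Matrix (ZMod q) (ZMod q) ℂ) (a' l) (a l)) •
          ket (conf x (fun l => some (a' l)) f) := by
  obtain ⟨V, hV, h⟩ := exists_impl_blocks (G := G) (ιW := ι) (κ := κ) (chainEmb false) fun _ => U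
  refine ⟨V, by simpa [blockDepth, ZMod.card] using hV, fun s x a f => ?_⟩
  have := congrArg (fun M => M *ᵥ ket fun l => some (a l)) (h s (conf x (fun _ => none) f))
  simp only [← Matrix.mulVec_mulVec, relabel_mulVec_ket, perSite_optLift_mulVec_ket,
    Matrix.mulVec_sum, Matrix.mulVec_smul] at this
  simpa only [← conf_eq_fill_false] using this

lemma exists_impl_chain_true (U : Matrix.unitaryGroup (ZMod q) ℂ) :
    ∃ V, Impl G ι κ (blockDepth q) V ∧ ∀ s x a (f : D × Fin N → ZMod q),
      V s *ᵥ ket (conf x a (fun l => some (f l))) =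
        ∑ f' : D × Fin N → ZMod q, (∏ l, (U : Matrix (ZMod q) (ZMod q) ℂ) (f' l) (f l)) •
          ket (conf x a (fun l => some (f' l))) := by
  obtain ⟨V, hV, h⟩ := exists_impl_blocks (G := G) (ιW := ι) (κ := κ) (chainEmb true) fun _ => U
  refine ⟨V, by simpa [blockDepth, ZMod.card] using hV, fun s x a f => ?_⟩
  have := congrArg (fun M => M *ᵥ ket fun l => some (f l)) (h s (conf x a (fun _ => none)))
  simp only [← Matrix.mulVec_mulVec, relabel_mulVec_ket, perSite_optLift_mulVec_ket,
    Matrix.mulVec_sum, Matrix.mulVec_smul] at this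
  simpa only [← conf_eq_fill_true] using this

/-- The element of `ZMod q` that belongs to a bit. -/
def bit (b : Fin 2) : ZMod q := ((b : ℕ) : ZMod q)

/-- Partial sums along a chain. -/
def pre (d : D × Fin N → ZMod q) (j : D) (n : ℕ) : ZMod q :=
  ∑ i : Fin N, if (i : ℕ) ≤ n then d (j, i) else 0

/-- The content of the chains that start at the data bits and have the given differences. -/
def chain (x : D → Fin 2) (d : D × Fin N → ZMod q) (l : D × Fin N) : ZMod q :=
  bit (x l.1) + pre d l.1 l.2

/-- The predecessor of an element of a chain. -/
def prev (x : D → Fin 2) (a : D × Fin N → ZMod q) (l : D × Fin N) : ZMod q :=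
  if (l.2 : ℕ) = 0 then bit (x l.1) else a (l.1, ⟨(l.2 : ℕ) - 1, by omega⟩)

/-- Telescoping: consecutive partial sums differ by one term, and the first link is compared with
the data bit itself. -/
lemma chain_sub_prev (x : D → Fin 2) (d : D × Fin N → ZMod q) (l : D × Fin N) :
    chain x d l - prev x (chain x d) l = d l := by
  obtain ⟨j, i⟩ := l
  unfold prev
  simp only
  have hsum : ∀ (P : Fin N → Prop) [DecidablePred P], (∀ i', P i' ↔ i' = i) →
      ∑ i' : Fin N, (if P i' then d (j, i') else 0) = d (j, i) := by
    intro P _ hP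
    simp [hP]
  split_ifs with h
  · rw [chain, add_sub_cancel_left, pre]
    apply hsum
    intro i'
    rw [Fin.ext_iff]; dsimp only; omega
  · simp only [chain, add_sub_add_left_eq_sub, pre]
    rw [← Finset.sum_sub_distrib]
    rw [← hsum (fun i' => i' = i) (fun _ => Iff.rfl)]
    refine Finset.sum_congr rfl fun i' _ => ?_
    have := i.2
    by_cases h1 : (i' : ℕ) ≤ i - 1
    · rw [if_pos (by omega), if_pos h1, sub_self, if_neg]
      rintro rfl; omega
    · by_cases h2 : i' = i
      · subst h2; simp [h1]
      · rw [if_neg, if_neg h1, sub_self, if_neg h2]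
        rw [Fin.ext_iff] at h2; omega

/-- The differences recover the increments. So a uniform superposition of chain contents is a
uniform superposition over the increments `d`, whatever `x` is. -/
lemma chain_bijective (x : D → Fin 2) :
    Function.Bijective (chain (N := N) (q := q) x) := by
  apply Function.Injective.bijective_of_finite
  intro d d' h
  funext l
  rw [← chain_sub_prev x d, ← chain_sub_prev x d', h]

/-- With one gate for every pair of possible values, exactly one of them fires on one-hot code
words. Any phase that depends on two values thus costs one controlled phase for each pair. -/
lemma prod_oneHot {α β M : Type*} [Fintype α] [DecidableEq α] [Fintype β] [DecidableEq β]
    [CommMonoid M] (a : α) (b : β) (h : α × β → M) :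
    ∏ t : α × β, (if oneHot (some a) t.1 = 1 ∧ oneHot (some b) t.2 = 1 then h t else 1) =
      h (a, b) := by
  rw [Fintype.prod_eq_single (a, b)]
  · simp [oneHot]
  · rintro ⟨a', b'⟩ hne
    rw [if_neg]
    rintro ⟨h1, h2⟩
    apply hne
    by_cases ha : a = a' <;> by_cases hb : b = b' <;> simp_all [oneHot]

lemma oneHot_some_eq_one {α : Type*} [Fintype α] [DecidableEq α] (a b : α) :
    oneHot (some a) b = 1 ↔ a = b := by
  simp [oneHot]

/-- The wire that holds the value `v` of the predecessor; for the first link the data wire. -/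
def prevWire (v : ZMod q) (l : D × Fin N) : ChainWire q D N :=
  if (l.2 : ℕ) = 0 then .inl l.1 else .inr ((l.1, ⟨(l.2 : ℕ) - 1, by omega⟩), false, v)

/-- Every element of a chain precedes at most one link, so the gates that read predecessors have
disjoint supports. This is the reason for a chain instead of comparing all links with the data bit.
-/
lemma prevWire_injective (v : ZMod q) :
    Function.Injective (prevWire (D := D) (N := N) v) := by
  rintro ⟨j, i⟩ ⟨j', i'⟩ h
  unfold prevWire at h
  simp only at h
  split_ifs at h with h1 h2
  · simp only [Sum.inl.injEq] at h
    exact Prod.ext h (Fin.ext (h1.trans h2.symm))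
  · simp only [Sum.inr.injEq, Prod.mk.injEq, Fin.mk.injEq, and_true] at h
    exact Prod.ext h.1 (Fin.ext (show (i : ℕ) = i' by omega))

/-- The phases that make the second kind of blocks measure differences along the chains. -/
lemma exists_impl_difference :
    ∃ V, Impl G ι κ (2 * (q * q)) V ∧ ∀ s x (a m : D × Fin N → ZMod q),
      V s *ᵥ ket (conf x (fun l => some (a l)) (fun l => some (m l))) =
        (∏ l, omega q (m l * (a l - prev x a l))) •
          ket (conf x (fun l => some (a l)) (fun l => some (m l))) := by
  have h1 := fun t : ZMod q × ZMod q =>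
    impl_cphase (G := G) (ι := ι) (κ := κ) (β := D × Fin N) (fun l => .inr (l, false, t.2)) (fun l => .inr (l, true, t.1))
      (fun l l' h => by simpa using h) (fun l l' h => by simpa using h) (fun l l' h => by simp at h)
      (fun _ => ZMod.toCircle (t.1 * t.2)) (fun _ => none)
  have h2 := fun t : ZMod q × ZMod q =>
    impl_cphase (G := G) (ι := ι) (κ := κ) (β := D × Fin N) (prevWire t.2) (fun l => .inr (l, true, t.1))
      (prevWire_injective _) (fun l l' h => by simpa using h)
      (fun l l' h => by unfold prevWire at h; split_ifs at h; simp at h)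
      -- The predecessor of the first link is a bit and has a single wire, which `prevWire` returns
      -- for all values; the phase must be applied only once, here for the value `1`.
      (fun l => if (l.2 : ℕ) = 0 then (if t.2 = 1 then ZMod.toCircle (-t.1) else 1) else
        ZMod.toCircle (-(t.1 * t.2))) (fun _ => none)
  refine ⟨_, ((Impl.diag_prod _ h1).mul (Impl.diag_prod _ h2)).mono ?_, fun s x a m => ?_⟩
  · simp [ZMod.card]; omega
  · rw [← Matrix.mulVec_mulVec, diagonal_mulVec_ket, Matrix.mulVec_smul, diagonal_mulVec_ket,
      smul_smul]
    congr 1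
    rw [Finset.prod_comm]
    conv_lhs => rw [mul_comm, Finset.prod_comm, mul_comm]
    rw [← Finset.prod_mul_distrib]
    refine Finset.prod_congr rfl fun l _ => ?_
    rw [mul_sub, sub_eq_add_neg, omega_add]
    congr 1
    · simp only [reduceCtorEq, false_imp_iff, implies_true, true_and, conf_true, conf_false]
      exact prod_oneHot (m l) (a l) fun t => omega q (t.1 * t.2)
    · simp only [reduceCtorEq, false_imp_iff, implies_true, true_and, conf_true, prevWire, prev]
      by_cases hl : (l.2 : ℕ) = 0
      · simp only [hl, if_true, conf_inl]
        rw [Fintype.prod_eq_single (m l, 1)]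
        · by_cases hx : x l.1 = 1
          · simp [hx, oneHot, bit, omega]
          · have : x l.1 = 0 := by omega
            simp [this, bit, omega_zero]
        · rintro ⟨m', v'⟩ hne
          by_cases hv : v' = 1
          · rw [if_neg]
            rintro ⟨h, -⟩
            rw [oneHot_some_eq_one] at h
            exact hne (by simp [hv, h])
          · simp [hv]
      · simp only [hl, if_false, conf_false]
        exact prod_oneHot (m l) (a _) fun t => omega q (-(t.1 * t.2))

/-- The normalization of a uniform superposition of all contents of the chains. -/
noncomputable def chainNorm (q : ℕ) (D : Type*) [Fintype D] (N : ℕ) : ℂ :=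
  ∏ _l : D × Fin N, invSqrt q

/-- The layers that prepare the chains. -/
lemma exists_impl_prepare :
    ∃ V, Impl G ι κ (1 + 3 * blockDepth q + 2 * (q * q)) V ∧ ∀ s x,
      V s *ᵥ ket (conf x (fun _ => none) fun _ => none) =
        ∑ d : D × Fin N → ZMod q, chainNorm q D N •
          ket (conf x (fun l => some (chain x d l)) (fun l => some (d l))) := by
  obtain ⟨Va, hVa, ha⟩ := exists_impl_chain_false (G := G) (ι := ι) (κ := κ) (fourier q)
  obtain ⟨Vf, hVf, hf⟩ := exists_impl_chain_true (G := G) (ι := ι) (κ := κ) (fourier q)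
  obtain ⟨Vd, hVd, hd⟩ := exists_impl_difference (G := G) (ι := ι) (κ := κ)
  obtain ⟨Vi, hVi, hi⟩ := exists_impl_chain_true (G := G) (ι := ι) (κ := κ) (star (fourier q))
  have hinj : Function.Injective fun b : (D × Fin N) × Bool =>
      (.inr (b.1, b.2, 0) : ChainWire q D N) := fun b b' h => by
    simp only [Sum.inr.injEq, Prod.mk.injEq, and_true] at h; exact Prod.ext h.1 h.2
  let L : LayerSpec (ChainWire q D N) R := LayerSpec.ofFamily _ hinj
    (fun _ => ⟨none, none, pauliX⟩) (by intro b b' j hj; simp at hj)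
    (by intro b b' j hj hj'; simp at hj)
  have hL : ∀ s x, L.op s *ᵥ ket (conf x (fun _ => none) fun _ => none) =
      ket (conf x (fun _ => some 0) fun _ => some 0) := by
    intro s x
    apply LayerSpec.ofFamily_mulVec_ket_perm
    · rintro ⟨l, k⟩ a
      cases k <;> simp [WireGate.act, pauliX_apply, oneHot]
    · rintro (j | ⟨l, k, v⟩) hw
      · rfl
      · have hv : (0 : ZMod q) ≠ v := by rintro rfl; exact hw (l, k) rfl
        cases k <;> simp [oneHot, hv]
  refine ⟨_, ((((L.impl.mul hVa).mul hVf).mul hVd).mul hVi).mono (by omega), fun s x => ?_⟩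
  simp only [← Matrix.mulVec_mulVec]
  rw [hL, ha s x (fun _ => 0) (fun _ => some 0)]
  simp only [Matrix.mulVec_sum, Matrix.mulVec_smul]
  -- For fixed contents `a` of the first blocks, the second blocks undergo Fourier transform, phases
  -- and inverse transform, and end up holding the differences along the chain.
  have hsum : ∀ a : D × Fin N → ZMod q,
      Vi s *ᵥ Vd s *ᵥ Vf s *ᵥ ket (conf x (fun l => some (a l)) fun _ => some 0) =
        ket (conf x (fun l => some (a l)) fun l => some (a l - prev x a l)) := by
    intro a
    rw [hf s x (fun l => some (a l)) (fun _ => 0)]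
    simp only [Matrix.mulVec_sum, Matrix.mulVec_smul, hd, hi]
    rw [← fourier_inversion q (fun l => a l - prev x a l)
      (fun m' => ket (conf x (fun l => some (a l)) fun l => some (m' l)))]
    refine Finset.sum_congr rfl fun m _ => ?_
    rw [smul_smul, ← Finset.prod_mul_distrib]
    simp only [fourier_apply, star_fourier_apply, mul_zero, omega_zero, mul_one]
  simp only [hsum, fourier_apply, mul_zero, omega_zero, mul_one]
  -- The sum over contents is reindexed by differences. Measuring `d` will then leave a single chain
  -- content for each data label.
  rw [← Function.Bijective.sum_comp (chain_bijective x)]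
  refine Finset.sum_congr rfl fun d _ => ?_
  rw [chainNorm]
  simp only [chain_sub_prev]

end Chain

/-! ### Linearity of circuits. -/

section Linear

variable {w c : ℕ} {G : GateSet}

lemma Layer.exists_linear {d : ℕ} [NeZero d] (L : Layer d w c) :
    ∃ T : HybridState d w c →ₗ[ℂ] HybridState d w c, ∀ σ, L.apply σ = T σ := by
  cases L with
  | quantum gs hgs => exact ⟨_, Layer.quantum_apply gs hgs⟩
  | measure m => exact ⟨_, Layer.measure_apply m⟩
  | classical u => exact ⟨_, Layer.classical_apply u⟩

lemma exists_linear_foldl {d : ℕ} [NeZero d] (Ls : List (Layer d w c)) :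
    ∃ T : HybridState d w c →ₗ[ℂ] HybridState d w c,
      ∀ σ, Ls.foldl (fun σ L => L.apply σ) σ = T σ := by
  induction Ls with
  | nil => exact ⟨LinearMap.id, fun σ => rfl⟩
  | cons L Ls ih =>
    obtain ⟨T, hT⟩ := ih
    obtain ⟨T', hT'⟩ := L.exists_linear
    exact ⟨T ∘ₗ T', fun σ => by simp [hT, hT']⟩

/-- The list of layers does not depend on the state and acts linearly, so its effect on single-entry
states decides. -/
lemma Reach.of_bas {d : ℕ} [NeZero d] {S X : Type*} [Fintype S] [DecidableEq S] [Fintype X]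
    [DecidableEq X] {n : ℕ} (A B : GS S X →ₗ[ℂ] HybridState d w c)
    (h : Reach G n (fun p : S × X × X => A (bas p.1 p.2.1 p.2.2))
      fun p : S × X × X => B (bas p.1 p.2.1 p.2.2)) :
    Reach G n (fun σ => A σ) (fun σ => B σ) := by
  obtain ⟨Ls, h1, h2, h3⟩ := h
  obtain ⟨T, hT⟩ := exists_linear_foldl Ls
  refine ⟨Ls, h1, h2, fun σ => ?_⟩
  rw [hT]
  refine LinearMap.congr_fun (f := T ∘ₗ A) (g := B) (GS.linearMap_ext fun s x y => ?_) σ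
  have := h3 (s, x, y)
  rw [hT] at this
  exact this

variable {W R : Type*} [Fintype W] [DecidableEq W] [Fintype R] [DecidableEq R]
  {ι : W ↪ Fin w} {κ : R ↪ Fin c} {n : ℕ} {M : Type*}

lemma Impl.reach {V : (R → Fin 2) → Matrix (W → Fin 2) (W → Fin 2) ℂ} (h : Impl G ι κ n V)
    {A B : M → GS (R → Fin 2) (W → Fin 2)} (hAB : ∀ p, conjBy V (A p) = B p) :
    Reach G n (fun p => ext ι κ (A p)) (fun p => ext ι κ (B p)) :=
  (Reach.comp h A).congr (fun _ => rfl) fun p => by rw [hAB]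

end Linear

/-! ### Classical processing of outcomes and classically controlled layers of the gadget. -/

section Gadget

variable {D RX : Type*} [Fintype D] [DecidableEq D] [Fintype RX] [DecidableEq RX] {N : ℕ}
  {q : ℕ} [Fact q.Prime]

/-- The auxiliary registers of the gadget: measured one-hot blocks, prefix sums, pairs of prefix
sums, and sums of outcomes. -/
abbrev AuxReg (q : ℕ) (D : Type*) (N : ℕ) : Type _ :=
  (Bool × (D × Fin N) × ZMod q × Fin (2 * q)) ⊕ ((D × Fin N) × ZMod q) ⊕
    ((D × D) × ZMod q × ZMod q) ⊕ (D × ZMod q)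

/-- The contents of all registers. -/
def regConf (s : RX → Fin 2) (d m π : D × Fin N → Option (ZMod q))
    (ρ : D × D → Option (ZMod q × ZMod q)) (μ : D → Option (ZMod q)) :
    RX ⊕ AuxReg q D N → Fin 2 :=
  Sum.elim s (Sum.elim (fun t => oneHot (if t.1 then m t.2.1 else d t.2.1) t.2.2.1)
    (Sum.elim (fun t => oneHot (π t.1) t.2) (Sum.elim (fun t => oneHot (ρ t.1) t.2)
      fun t => oneHot (μ t.1) t.2)))

lemma pad_inl_eq_regConf (s : RX → Fin 2) :
    pad (Sum.inl : RX → RX ⊕ AuxReg q D N) s =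
      regConf s (fun _ => none) (fun _ => none) (fun _ => none) (fun _ => none)
        fun _ => none := by
  symm
  apply pad_ext Sum.inl_injective
  · intro i; rfl
  · rintro (j | ⟨k, l, v, i⟩ | ⟨l, v⟩ | ⟨l, v⟩ | ⟨l, v⟩) h
    · exact absurd rfl (h j)
    all_goals simp [regConf, oneHot]

/-- The registers whose sum is, modulo `q`, a partial sum of outcomes minus `v`. -/
def sumRegs (RX : Type*) (k : Bool) (j : D) (n : ℕ) (v : ZMod q) :
    Finset (RX ⊕ AuxReg q D N) :=
  (Finset.univ.filter fun t : Fin N × ZMod q × Fin (2 * q) =>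
    (t.1 : ℕ) ≤ n ∧ (t.2.2 : ℕ) < t.2.1.val + if (t.1 : ℕ) = 0 then q - v.val else 0).map
    ⟨fun t => .inr (.inl (k, (j, t.1), t.2.1, t.2.2)), fun t t' h => by
      simp only [Sum.inr.injEq, Sum.inl.injEq, Prod.mk.injEq, true_and] at h
      exact Prod.ext h.1 (Prod.ext h.2.1 h.2.2)⟩

/-- `MOD_q` adds bits without weights. An outcome `u` is counted `u` times by reading that many
copies of its one-hot bit. To subtract `v`, link `0` reads `q - v` further copies, whatever its
outcome, because exactly one of its bits is `1`. Together these are fewer than `2 * q` copies, which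
explains the size of the register set. The argument `i₀` only guarantees that link `0` exists. -/
lemma sum_sumRegs (k : Bool) (j : D) (n : ℕ) (v : ZMod q) (i₀ : Fin N) (r : RX ⊕ AuxReg q D N)
    (σ : RX ⊕ AuxReg q D N → Fin 2) (d : D × Fin N → ZMod q)
    (h : ∀ l u i, σ (.inr (.inl (k, l, u, i))) = oneHot (some (d l)) u) :
    RegGate.eval q σ r (.mod (sumRegs RX k j n v)) = oneHot (some (pre d j n)) v := by
  have hv := ZMod.val_lt v
  have hN : 0 < N := i₀.pos
  have hsum : ∑ r ∈ sumRegs (N := N) RX k j n v, (σ r : ℕ) =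
      ∑ i : Fin N, if (i : ℕ) ≤ n then (d (j, i)).val + (if (i : ℕ) = 0 then q - v.val else 0)
        else 0 := by
    rw [sumRegs, Finset.sum_map, Finset.sum_filter, Fintype.sum_prod_type]
    change ∑ i : Fin N, ∑ t : ZMod q × Fin (2 * q), (if (i : ℕ) ≤ n ∧
      (t.2 : ℕ) < t.1.val + (if (i : ℕ) = 0 then q - v.val else 0) then
        ((σ (.inr (.inl (k, (j, i), t.1, t.2))) : Fin 2) : ℕ) else 0) = _
    simp only [h]
    refine Finset.sum_congr rfl fun i _ => ?_
    by_cases hi : (i : ℕ) ≤ n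
    · have hd := ZMod.val_lt (d (j, i))
      rw [Fintype.sum_prod_type, Fintype.sum_eq_single (d (j, i))]
      · simp only [hi, true_and, if_true, oneHot, Fin.isValue, Fin.val_one]
        rw [← Finset.sum_filter, Finset.sum_const, smul_eq_mul, mul_one, Fin.card_filter_val_lt]
        split_ifs <;> omega
      · intro u hu
        apply Finset.sum_eq_zero
        intro l _
        simp [oneHot, hu.symm]
    · simp [hi]
  have hcast : ((∑ r ∈ sumRegs (N := N) RX k j n v, (σ r : ℕ) : ℕ) : ZMod q) =
      pre d j n - v := by
    rw [hsum]
    push_cast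
    have : ∀ i : Fin N, (((if (i : ℕ) ≤ n then (d (j, i)).val +
        (if (i : ℕ) = 0 then q - v.val else 0) else 0 : ℕ)) : ZMod q) =
        (if (i : ℕ) ≤ n then d (j, i) else 0) + if i = (⟨0, hN⟩ : Fin N) then -v else 0 := by
      intro i
      by_cases hi0 : (i : ℕ) = 0
      · have : i = ⟨0, hN⟩ := Fin.ext hi0
        subst this
        simp [Nat.cast_sub hv.le]
      · have : i ≠ ⟨0, hN⟩ := fun h => hi0 (by rw [h])
        simp only [hi0, this, if_false, add_zero]
        split_ifs <;> simp
    rw [pre, sub_eq_add_neg, ← Finset.sum_congr rfl fun i _ => rfl]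
    have h2 := Finset.sum_congr (rfl : (Finset.univ : Finset (Fin N)) = _) fun i _ => this i
    push_cast at h2
    rw [h2, Finset.sum_add_distrib]
    simp
  simp only [RegGate.eval, oneHot]
  have : (∑ r ∈ sumRegs (N := N) RX k j n v, (σ r : ℕ)) % q = 0 ↔
      some (pre d j n) = some v := by
    rw [← Nat.dvd_iff_mod_eq_zero, ← ZMod.natCast_eq_zero_iff, hcast, sub_eq_zero,
      Option.some_inj]
  simp only [this]

variable {w c : ℕ} {G : GateSet}
  {ι : ChainWire q D N ↪ Fin w} {κ : RX ⊕ AuxReg q D N ↪ Fin c}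

/-- Reset one kind of blocks after its measurement. -/
lemma exists_impl_reset (k : Bool) :
    ∃ V, Impl G ι κ 1 V ∧ ∀ s x a f d m π ρ μ,
      (k = false → a = m) → (k = true → f = d) →
      V (regConf s d m π ρ μ) *ᵥ ket (conf x a f) =
        ket (conf x (if k then a else fun _ => none) (if k then fun _ => none else f)) := by
  have hq : 0 < 2 * q := Nat.mul_pos two_pos (Fact.out (p := q.Prime)).pos
  have hinj : Function.Injective fun t : (D × Fin N) × ZMod q =>
      (.inr (t.1, k, t.2) : ChainWire q D N) := (chainEmb k).injective
  let L : LayerSpec (ChainWire q D N) (RX ⊕ AuxReg q D N) := LayerSpec.ofFamily _ hinj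
    -- The outcomes of blocks of kind `k` are stored in registers of kind `!k`. Flipping each wire
    -- whose recorded bit is `1` clears the block; any of the copies would do, and the first is
    -- taken.
    (fun t => ⟨some (.inr (.inl (!k, t.1, t.2, ⟨0, hq⟩)), 1), none, pauliX⟩)
    (by intro b b' j hj; simp at hj)
    (by intro b b' j hj hj'; simp at hj)
  refine ⟨_, L.impl, ?_⟩
  intro s x a f d m π ρ μ h1 h2
  apply LayerSpec.ofFamily_mulVec_ket_perm
  · rintro ⟨l, v⟩ b
    cases k
    · obtain rfl := h1 rfl
      by_cases hv : a l = some v <;>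
        simp [WireGate.act, regConf, pauliX_apply, oneHot, hv, Matrix.one_apply]
    · obtain rfl := h2 rfl
      by_cases hv : f l = some v <;>
        simp [WireGate.act, regConf, pauliX_apply, oneHot, hv, Matrix.one_apply]
  · rintro (j | ⟨l, k', v⟩) hw
    · rfl
    · cases k <;> cases k'
      · exact absurd rfl (hw (l, v))
      · rfl
      · rfl
      · exact absurd rfl (hw (l, v))

/-- The diagonal phases applied between the two measurements. -/
lemma exists_impl_quadratic (e : D ≃ Fin N) (θ : D → D → ℝ) :
    ∃ V, Impl G ι κ (1 + q * q) V ∧ ∀ s x d' d m π μ f,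
      V (regConf s d m π (fun p => some (pre d' p.1 (e p.2), pre d' p.2 (e p.1))) μ) *ᵥ
        ket (conf x (fun l => some (chain x d' l)) f) =
        Complex.exp (Complex.I * ∑ j, ∑ k, (θ j k * (x j : ℕ) * (x k : ℕ) : ℝ)) •
          ket (conf x (fun l => some (chain x d' l)) f) := by
  -- The pair `j, k` uses the copy of `x j` at position `e k` and the copy of `x k` at position `e
  -- j`. No other pair uses them, so for fixed `t` all pairs fit into one layer. Here `t` is a guess
  -- of the two shifts: under the right guess the wires with values `t.1 + 1` and `t.2 + 1` carry `x
  -- j` and `x k`, and a register tells whether the guess is right.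
  have h1 := fun t : ZMod q × ZMod q =>
    impl_cphase (G := G) (ι := ι) (κ := κ) (β := {p : D × D // e p.1 < e p.2})
      (fun p => .inr ((p.1.1, e p.1.2), false, t.1 + 1))
      (fun p => .inr ((p.1.2, e p.1.1), false, t.2 + 1))
      (fun p p' h => by
        simp only [Sum.inr.injEq, Prod.mk.injEq, and_true, e.injective.eq_iff] at h
        exact Subtype.ext (Prod.ext h.1 h.2))
      (fun p p' h => by
        simp only [Sum.inr.injEq, Prod.mk.injEq, and_true, e.injective.eq_iff] at h
        exact Subtype.ext (Prod.ext h.2 h.1))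
      (fun p p' h => by
        simp only [Sum.inr.injEq, Prod.mk.injEq, e.injective.eq_iff] at h
        have h1 := p.2
        have h2 := p'.2
        rw [h.1.1, h.1.2] at h1
        exact lt_asymm h1 h2)
      -- Each unordered pair occurs once, so it takes both coefficients. The diagonal terms are
      -- phases on single data wires, since `x j * x j = x j`.
      (fun p => Circle.exp (θ p.1.1 p.1.2 + θ p.1.2 p.1.1))
      (fun p => some (.inr (.inr (.inr (.inl (p.1, t)))), 1))
  have h2 := impl_phase (G := G) (ι := ι) (κ := κ) (β := D) (fun j => .inl j) Sum.inl_injective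
    (fun j => Circle.exp (θ j j)) (fun _ => none)
  refine ⟨_, (h2.mul (Impl.diag_prod _ h1)).mono ?_, fun s x d' d m π μ f => ?_⟩
  · simp [ZMod.card]
  · rw [← Matrix.mulVec_mulVec, diagonal_mulVec_ket, Matrix.mulVec_smul, diagonal_mulVec_ket,
      smul_smul]
    congr 1
    rw [Finset.prod_comm]
    have hcases : ∀ b : Fin 2, b = 0 ∨ b = 1 := by decide
    trans (∏ j, Complex.exp (Complex.I * (θ j j * (x j : ℕ) * (x j : ℕ) : ℝ))) *
      ∏ p : {p : D × D // e p.1 < e p.2}, Complex.exp (Complex.I *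
          ((θ p.1.1 p.1.2 * (x p.1.1 : ℕ) * (x p.1.2 : ℕ) : ℝ) +
          (θ p.1.2 p.1.1 * (x p.1.2 : ℕ) * (x p.1.1 : ℕ) : ℝ)))
    · congr 1
      · refine Finset.prod_congr rfl fun j _ => ?_
        rcases hcases (x j) with h | h <;> simp [h, Circle.coe_exp, mul_comm]
      · refine Finset.prod_congr rfl ?_
        rintro ⟨⟨j, k⟩, hp⟩ -
        dsimp only
        have hbit : ∀ (b : Fin 2) (t : ZMod q),
            oneHot (some (bit b + t)) (t + 1) = 1 ↔ b = 1 := by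
          intro b t
          rw [oneHot_some_eq_one, add_comm, add_right_inj]
          fin_cases b <;> simp [bit]
        -- Only the right guess of the shifts passes the classical control.
        rw [Fintype.prod_eq_single (pre d' j (e k), pre d' k (e j))]
        · have hc : ∀ j (k : Fin N), oneHot (some (chain x d' (j, k))) (pre d' j k + 1) = 1 ↔
              x j = 1 := fun j k => hbit _ _
          by_cases hjk : x k = 1 ∧ x j = 1
          · rw [if_pos]
            · simp [hjk.1, hjk.2, Circle.coe_exp, mul_comm, mul_add, Complex.exp_add]
            · refine ⟨fun r v h => ?_, (hc _ _).2 hjk.1, (hc _ _).2 hjk.2⟩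
              simp only [Option.some.injEq, Prod.mk.injEq] at h
              rw [← h.1, ← h.2]
              simp [regConf, oneHot]
          · rw [if_neg fun h => hjk ⟨(hc _ _).1 h.2.1, (hc _ _).1 h.2.2⟩]
            rcases hcases (x j) with h | h <;> rcases hcases (x k) with h' | h' <;>
              simp_all
        · intro t ht
          rw [if_neg]
          rintro ⟨h, -⟩
          have := h _ _ rfl
          simp only [regConf, Sum.elim_inr, Sum.elim_inl, oneHot_some_eq_one] at this
          exact ht this.symm
    rw [← Complex.exp_sum, ← Complex.exp_sum,
      ← Complex.exp_add, ← Finset.mul_sum, ← Finset.mul_sum, ← mul_add]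
    congr 2
    simp only [Complex.ofReal_sum]
    rw [← Fintype.sum_prod_type' (f := fun j k => ((θ j k * (x j : ℕ) * (x k : ℕ) : ℝ) : ℂ)),
      Finset.sum_add_distrib]
    have hsub : ∀ g : D × D → ℂ, ∑ p : {p : D × D // e p.1 < e p.2}, g p.1 =
        ∑ p : D × D, if e p.1 < e p.2 then g p else 0 := by
      intro g
      rw [← Finset.sum_filter]
      exact (Finset.sum_subtype _ (by simp) g).symm
    rw [hsub fun p => ((θ p.1 p.2 * (x p.1 : ℕ) * (x p.2 : ℕ) : ℝ) : ℂ),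
      hsub fun p => ((θ p.2 p.1 * (x p.2 : ℕ) * (x p.1 : ℕ) : ℝ) : ℂ)]
    have hswap : (∑ p : D × D,
        if e p.1 < e p.2 then ((θ p.2 p.1 * (x p.2 : ℕ) * (x p.1 : ℕ) : ℝ) : ℂ) else 0) =
        ∑ p : D × D,
        if e p.2 < e p.1 then ((θ p.1 p.2 * (x p.1 : ℕ) * (x p.2 : ℕ) : ℝ) : ℂ) else 0 :=
      Fintype.sum_equiv (Equiv.prodComm D D) _ _ fun p => rfl
    rw [hswap]
    have hdiag : ∑ j, ((θ j j * (x j : ℕ) * (x j : ℕ) : ℝ) : ℂ) = ∑ p : D × D,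
        if p.1 = p.2 then ((θ p.1 p.2 * (x p.1 : ℕ) * (x p.2 : ℕ) : ℝ) : ℂ) else 0 := by
      rw [Fintype.sum_prod_type]
      simp
    rw [hdiag, ← Finset.sum_add_distrib, ← Finset.sum_add_distrib]
    refine Finset.sum_congr rfl fun p _ => ?_
    rcases lt_trichotomy (e p.1) (e p.2) with h | h | h
    · rw [if_neg (fun hp => by rw [hp] at h; exact lt_irrefl _ h), if_pos h,
        if_neg (lt_asymm h)]; simp
    · rw [if_pos (e.injective h), if_neg (by rw [h]; exact lt_irrefl _),
        if_neg (by rw [h]; exact lt_irrefl _)]; simp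
    · rw [if_neg (fun hp => by rw [hp] at h; exact lt_irrefl _ h), if_neg (lt_asymm h),
        if_pos h]; simp

end Gadget

/-! ### Composing steps on families of states. -/

section Steps

variable {w c : ℕ} {G : GateSet} {W R M Λ : Type*} [Fintype W] [DecidableEq W] [Fintype R]
  [DecidableEq R] [Fintype Λ] {ι : W ↪ Fin w} {κ : R ↪ Fin c} {n : ℕ}

/-- Since the layers do not depend on the branch `l`, all outcomes of a measurement are processed
together, with arbitrary coefficients. -/
lemma Reach.sum {d : ℕ} [NeZero d] {A B : M × Λ → HybridState d w c} (h : Reach G n A B)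
    (z : M → Λ → ℂ) :
    Reach G n (fun m => ∑ l, z m l • A (m, l)) (fun m => ∑ l, z m l • B (m, l)) := by
  obtain ⟨Ls, h1, h2, h3⟩ := h
  obtain ⟨T, hT⟩ := exists_linear_foldl Ls
  refine ⟨Ls, h1, h2, fun m => ?_⟩
  rw [hT, map_sum]
  refine Finset.sum_congr rfl fun l _ => ?_
  rw [map_smul, ← hT, h3]

lemma Reach.classical {q : ℕ} (hq : q ∈ G.classicalMod) (u : R → RegGate R)
    {σ σ' : M → R → Fin 2} {x y : M → W → Fin 2}
    (h : ∀ p r, (u r).eval q (σ p) r = σ' p r) :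
    Reach G 1 (fun p => ext ι κ (bas (σ p) (x p) (y p)))
      (fun p => ext ι κ (bas (σ' p) (x p) (y p))) := by
  refine (Reach.comp (reach_classical (ι := ι) (κ := κ) hq u)
    fun p => bas (σ p) (x p) (y p)).congr (fun _ => rfl) fun p => ?_
  refine congrArg (ext ι κ) ?_
  rw [push_bas, ← funext (h p)]
  rfl

lemma Reach.measure (m : R → Option W) {A B : M → GS (R → Fin 2) (W → Fin 2)}
    (h : ∀ p, meas (Fin 2) m (A p) = B p) :
    Reach G 1 (fun p => ext ι κ (A p)) (fun p => ext ι κ (B p)) :=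
  (Reach.comp (reach_meas (ι := ι) (κ := κ) m) A).congr (fun _ => rfl) fun p => by rw [h]

lemma Impl.of_bas {V : (R → Fin 2) → Matrix (W → Fin 2) (W → Fin 2) ℂ}
    (h : Reach G n (fun p : (R → Fin 2) × (W → Fin 2) × (W → Fin 2) =>
        ext ι κ (bas p.1 p.2.1 p.2.2))
      fun p => ext ι κ (conjBy V (bas p.1 p.2.1 p.2.2))) : Impl G ι κ n V :=
  Reach.of_bas (ext ι κ) (ext ι κ ∘ₗ conjBy V) h

end Steps

/-! ### The two measurements and the cancellation of their phases. -/

section Gadget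

variable {D RX : Type*} [Fintype D] [DecidableEq D] [Fintype RX] [DecidableEq RX] {N : ℕ}
  {q : ℕ} [Fact q.Prime]

/-- Every block of one kind is measured `2 * q` times. -/
def measChain (RX : Type*) (k : Bool) : RX ⊕ AuxReg q D N → Option (ChainWire q D N)
  | .inr (.inl (k', l, u, _)) => if k' = k then some (.inr (l, !k, u)) else none
  | _ => none

lemma meas_measChain (k : Bool) (s : RX → Fin 2) (d m π ρ μ) (x y : D → Fin 2)
    (a f a' f' : D × Fin N → Option (ZMod q)) :
    meas (Fin 2) (measChain RX k) (bas (regConf s d m π ρ μ) (conf x a f) (conf y a' f')) =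
      if (if k then a = a' else f = f') then
        bas (regConf s (if k then d else f) (if k then a else m) π ρ μ) (conf x a f) (conf y a' f')
      else 0 := by
  have hq : 0 < 2 * q := Nat.mul_pos two_pos (Fact.out (p := q.Prime)).pos
  rw [meas_bas]
  have h1 : (∀ r i, measChain RX k r = some i → conf x a f i = conf y a' f' i) ↔
      if k then a = a' else f = f' := by
    constructor
    · intro h
      have h' := fun l u => h (.inr (.inl (k, l, u, ⟨0, hq⟩))) (.inr (l, !k, u))
        (by simp [measChain])
      cases k
      · exact funext fun l => oneHot_injective (funext fun u => h' l u)
      · exact funext fun l => oneHot_injective (funext fun u => h' l u)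
    · rintro h (r | ⟨k', l, u, i⟩ | r | r | r) i' hi
      · simp [measChain] at hi
      · simp only [measChain] at hi
        split_ifs at hi
        obtain rfl := Option.some.inj hi
        cases k
        · simp only [Bool.false_eq_true, if_false] at h; simp [h]
        · simp only [if_true] at h; simp [h]
      all_goals simp [measChain] at hi
  have h2 : recordOn (measChain RX k) (regConf s d m π ρ μ) (conf x a f) =
      regConf s (if k then d else f) (if k then a else m) π ρ μ := by
    funext r
    rcases r with (r | ⟨k', l, u, i⟩ | r | r | r)
    · rfl
    · cases k <;> cases k' <;> rfl
    · rfl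
    · rfl
    · rfl
  rw [h2]
  simp only [h1]

/-- The phases that depend on the sums of the outcomes of the second measurement. -/
lemma exists_impl_correction {w c : ℕ} {G : GateSet}
    {ι : ChainWire q D N ↪ Fin w} {κ : RX ⊕ AuxReg q D N ↪ Fin c} :
    ∃ V, Impl G ι κ q V ∧ ∀ s x d m π ρ (μ : D → ZMod q) a f,
      V (regConf s d m π ρ fun j => some (μ j)) *ᵥ ket (conf x a f) =
        (∏ j, omega q (bit (x j) * μ j)) • ket (conf x a f) := by
  have h := fun v : ZMod q => impl_phase (G := G) (ι := ι) (κ := κ) (β := D) (fun j => .inl j)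
    Sum.inl_injective (fun _ => ZMod.toCircle v)
    (fun j => some (.inr (.inr (.inr (.inr (j, v)))), 1))
  refine ⟨_, (Impl.diag_prod _ h).mono (by simp [ZMod.card]), fun s x d m π ρ μ a f => ?_⟩
  rw [diagonal_mulVec_ket, Finset.prod_comm]
  congr 1
  refine Finset.prod_congr rfl fun j _ => ?_
  have hcases : ∀ b : Fin 2, b = 0 ∨ b = 1 := by decide
  rw [Fintype.prod_eq_single (μ j)]
  · rcases hcases (x j) with hx | hx
    · rw [if_neg fun h => by simp [hx] at h]; simp [hx, bit, omega_zero]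
    · rw [if_pos]
      · simp [hx, bit, omega]
      · refine ⟨fun r v h => ?_, hx⟩
        simp only [Option.some.injEq, Prod.mk.injEq] at h
        rw [← h.1, ← h.2]
        simp [regConf, oneHot]
  · intro v hv
    rw [if_neg]
    rintro ⟨h, -⟩
    have := h _ _ rfl
    simp only [regConf, Sum.elim_inr, oneHot_some_eq_one] at this
    exact hv this.symm

/-- A link contains `bit (x j)` plus a partial sum of `d`. The first summand contributes a phase in
`x j` times the total of `m` along chain `j`, which is what the correction removes; what is left
depends on the outcomes `d` and `m` only. -/
lemma omega_cancel (x : D → Fin 2) (d m : D × Fin N → ZMod q) :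
    (∏ l, omega q (-(m l * chain x d l))) * ∏ j, omega q (bit (x j) * pre m j N) =
      ∏ l, omega q (-(m l * pre d l.1 l.2)) := by
  rw [← omega_sum, ← omega_sum, ← omega_sum, ← omega_add]
  congr 1
  have h1 : ∀ j, pre m j N = ∑ i, m (j, i) := fun j => by
    unfold pre
    exact Finset.sum_congr rfl fun i _ => if_pos i.2.le
  simp only [h1, Finset.mul_sum]
  rw [← Fintype.sum_prod_type' (f := fun j i => bit (x j) * m (j, i)), ← Finset.sum_add_distrib]
  refine Finset.sum_congr rfl fun l _ => ?_
  rw [chain]; ring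

/-- After the correction the remaining outcome-dependent phase is the same for `x` and `y`, so it
cancels against its conjugate. All pairs of outcomes `(d, m)` then contribute equally, and their
weights add up to `1`. -/
lemma sum_phases (θx θy : ℂ) (x y : D → Fin 2) :
    ∑ d : D × Fin N → ZMod q, (chainNorm q D N * star (chainNorm q D N)) *
      ∑ m : D × Fin N → ZMod q,
        ((θx * ∏ l, (invSqrt q * omega q (-(m l * chain x d l)))) *
          star (θy * ∏ l, (invSqrt q * omega q (-(m l * chain y d l))))) *
        ((∏ j, omega q (bit (x j) * pre m j N)) * star (∏ j, omega q (bit (y j) * pre m j N))) =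
      θx * star θy := by
  have hterm : ∀ d m : D × Fin N → ZMod q,
      ((θx * ∏ l, (invSqrt q * omega q (-(m l * chain x d l)))) *
          star (θy * ∏ l, (invSqrt q * omega q (-(m l * chain y d l))))) *
        ((∏ j, omega q (bit (x j) * pre m j N)) * star (∏ j, omega q (bit (y j) * pre m j N))) =
      θx * star θy * (chainNorm q D N * chainNorm q D N) := by
    intro d m
    simp only [Finset.prod_mul_distrib, star_mul']
    change _ = θx * star θy * ((∏ _l : D × Fin N, invSqrt q) * ∏ _l : D × Fin N, invSqrt q)
    set c := ∏ _l : D × Fin N, invSqrt q with hc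
    have hsc : star c = c := by rw [hc, star_prod]; simp only [star_invSqrt]
    have hx := omega_cancel x d m
    have hy := congrArg star (omega_cancel y d m)
    rw [star_mul'] at hy
    have h1 : (∏ l : D × Fin N, omega q (-(m l * pre d l.1 l.2))) *
        star (∏ l : D × Fin N, omega q (-(m l * pre d l.1 l.2))) = 1 := by
      rw [star_prod, ← Finset.prod_mul_distrib]
      apply Finset.prod_eq_one
      intro l _
      rw [star_omega, ← omega_add, add_neg_cancel, omega_zero]
    rw [← hx] at h1
    rw [← hx] at hy
    rw [hsc]
    set P := ∏ l, omega q (-(m l * chain x d l))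
    set Q := ∏ j, omega q (bit (x j) * pre m j N)
    set P' := ∏ l, omega q (-(m l * chain y d l))
    set Q' := ∏ j, omega q (bit (y j) * pre m j N)
    calc _ = θx * star θy * (c * c) * ((P * Q) * (star P' * star Q')) := by ring
      _ = _ := by rw [hy, h1, mul_one]
  simp only [hterm, Finset.sum_const, nsmul_eq_mul, Finset.card_univ, Fintype.card_pi,
    Finset.prod_const, ZMod.card]
  have hsc : star (chainNorm q D N) = chainNorm q D N := by
    rw [chainNorm, star_prod]; simp only [star_invSqrt]
  have h1 : chainNorm q D N * chainNorm q D N * ((q ^ Fintype.card (D × Fin N) : ℕ) : ℂ) = 1 := by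
    rw [chainNorm, Finset.prod_const, ← mul_pow, Finset.card_univ, Nat.cast_pow, ← mul_pow,
      invSqrt_mul_self, one_pow]
  rw [hsc]
  set n : ℂ := ((q ^ Fintype.card (D × Fin N) : ℕ) : ℂ)
  set c := chainNorm q D N
  calc _ = θx * star θy * (c * c * n) * (c * c * n) := by ring
    _ = _ := by rw [h1]; ring

end Gadget

/-! ### The complete gadget for quadratic phases. -/

section Gadget

variable {D RX : Type*} [Fintype D] [DecidableEq D] [Fintype RX] [DecidableEq RX] {N : ℕ}
  {q : ℕ} [Fact q.Prime] {w c : ℕ} {G : GateSet}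
  {ι : ChainWire q D N ↪ Fin w} {κ : RX ⊕ AuxReg q D N ↪ Fin c}

/-- The phase given by a quadratic form. -/
noncomputable def quadPhase (θ : D → D → ℝ) (x : D → Fin 2) : ℂ :=
  Complex.exp (Complex.I * ∑ j, ∑ k, (θ j k * (x j : ℕ) * (x k : ℕ) : ℝ))

/-- The pairs of partial sums. -/
def crossSums (e : D ≃ Fin N) (d : D × Fin N → ZMod q) (p : D × D) : Option (ZMod q × ZMod q) :=
  some (pre d p.1 (e p.2), pre d p.2 (e p.1))

/-- The amplitudes before the second measurement. -/
noncomputable def quadAmpl (θ : D → D → ℝ) (x : D → Fin 2) (d m : D × Fin N → ZMod q) : ℂ :=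
  quadPhase θ x * ∏ l, (invSqrt q * omega q (-(m l * chain x d l)))

/-- The state of the gadget: the labels `s`, `x`, `y` of the data, and the contents of the
auxiliary registers and wires. -/
noncomputable def gadgetState (p : (RX → Fin 2) × (D → Fin 2) × (D → Fin 2))
    (d m π : D × Fin N → Option (ZMod q)) (ρ : D × D → Option (ZMod q × ZMod q))
    (μ : D → Option (ZMod q)) (a a' f f' : D × Fin N → Option (ZMod q)) :
    GS (RX ⊕ AuxReg q D N → Fin 2) (ChainWire q D N → Fin 2) :=
  bas (regConf p.1 d m π ρ μ) (conf p.2.1 a f) (conf p.2.2 a' f')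

/-- The measurement forces ket and bra to share `d`, while each keeps the chain that starts at its
own data bits. The weight of `d` does not depend on `x` or `y`: nothing about the data is revealed
and coherence survives. -/
lemma reach_prepare (ι : ChainWire q D N ↪ Fin w) (κ : RX ⊕ AuxReg q D N ↪ Fin c) :
    Reach G (1 + 3 * blockDepth q + 2 * (q * q) + 1)
    (fun p => ext ι κ (gadgetState p (fun _ => none) (fun _ => none) (fun _ => none)
      (fun _ => none) (fun _ => none) (fun _ => none) (fun _ => none) (fun _ => none)
      fun _ => none))
    (fun p => ext ι κ (∑ d : D × Fin N → ZMod q, (chainNorm q D N * star (chainNorm q D N)) •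
      gadgetState p (fun l => some (d l)) (fun _ => none) (fun _ => none) (fun _ => none)
        (fun _ => none) (fun l => some (chain p.2.1 d l)) (fun l => some (chain p.2.2 d l))
        (fun l => some (d l)) fun l => some (d l))) := by
  obtain ⟨Vp, hVp, hp⟩ := exists_impl_prepare (G := G) (ι := ι) (κ := κ)
  refine Reach.trans (hVp.reach fun p => conjBy_bas_sum (hp _ _) (hp _ _)) ?_
  refine Reach.measure (measChain RX false) fun p => ?_
  simp only [map_sum, map_smul]
  refine Finset.sum_congr rfl fun d _ => ?_
  rw [Finset.sum_eq_single d]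
  · rw [meas_measChain]; simp [gadgetState]
  · intro d' _ hd'
    rw [meas_measChain, if_neg, smul_zero]
    simp only [Bool.false_eq_true, if_false]
    intro h
    exact hd' (funext fun l => (Option.some.inj (congrFun h l)).symm)
  · simp

/-- The recorded differences first clear the second blocks and give, through `MOD_q`, the shift of
every copy; then the phases are applied. Reading the copies directly would reveal `x`. They are read
in the Fourier basis instead, which costs only phases that depend on the outcome. -/
lemma reach_quadratic (hq : q ∈ G.classicalMod) (e : D ≃ Fin N)
    (ι : ChainWire q D N ↪ Fin w) (κ : RX ⊕ AuxReg q D N ↪ Fin c) (θ : D → D → ℝ) :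
    Reach G (4 + q * q + blockDepth q + 1)
    (fun p : ((RX → Fin 2) × (D → Fin 2) × (D → Fin 2)) × (D × Fin N → ZMod q) =>
      ext ι κ (gadgetState p.1 (fun l => some (p.2 l)) (fun _ => none) (fun _ => none)
        (fun _ => none) (fun _ => none) (fun l => some (chain p.1.2.1 p.2 l))
        (fun l => some (chain p.1.2.2 p.2 l)) (fun l => some (p.2 l)) fun l => some (p.2 l)))
    (fun p => ext ι κ (∑ m : D × Fin N → ZMod q,
      (quadAmpl θ p.1.2.1 p.2 m * star (quadAmpl θ p.1.2.2 p.2 m)) •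
      gadgetState p.1 (fun l => some (p.2 l)) (fun l => some (m l))
        (fun l => some (pre p.2 l.1 l.2)) (crossSums e p.2) (fun _ => none)
        (fun l => some (m l)) (fun l => some (m l)) (fun _ => none) (fun _ => none))) := by
  obtain ⟨Vr, hVr, hr⟩ := exists_impl_reset (G := G) (ι := ι) (κ := κ) true
  obtain ⟨Vq, hVq, hqd⟩ := exists_impl_quadratic (G := G) (ι := ι) (κ := κ) e θ
  obtain ⟨Vf, hVf, hf⟩ := exists_impl_chain_false (G := G) (ι := ι) (κ := κ) (star (fourier q))
  refine ((((Reach.trans (hVr.reach (B := fun p => gadgetState p.1 (fun l => some (p.2 l))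
    (fun _ => none) (fun _ => none) (fun _ => none) (fun _ => none)
    (fun l => some (chain p.1.2.1 p.2 l)) (fun l => some (chain p.1.2.2 p.2 l))
    (fun _ => none) (fun _ => none)) ?_) (Reach.classical hq
      (fun r => match r with
      | .inr (.inr (.inl (l, v))) => .mod (sumRegs RX false l.1 l.2 v)
      | _ => .keep)
      (σ' := fun p => regConf p.1.1 (fun l => some (p.2 l)) (fun _ => none)
      (fun l => some (pre p.2 l.1 l.2)) (fun _ => none) (fun _ => none)) ?_)).trans
    (Reach.classical hq
      (fun r => match r with
      | .inr (.inr (.inr (.inl (l, v)))) => .bounded (.inr (.inr (.inl ((l.1, e l.2), v.1))))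
          -- Multiplication in `Fin 2` is conjunction: the bit says that both shifts have the
          -- guessed values.
          (.inr (.inr (.inl ((l.2, e l.1), v.2)))) fun a b => a * b
      | _ => .keep)
      (σ' := fun p => regConf p.1.1 (fun l => some (p.2 l)) (fun _ => none)
      (fun l => some (pre p.2 l.1 l.2)) (crossSums e p.2) (fun _ => none)) ?_)).trans
    ((hVq.mul hVf).reach (B := fun p => ∑ m, ∑ m',
      (quadAmpl θ p.1.2.1 p.2 m * star (quadAmpl θ p.1.2.2 p.2 m')) •
      gadgetState p.1 (fun l => some (p.2 l)) (fun _ => none)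
        (fun l => some (pre p.2 l.1 l.2)) (crossSums e p.2) (fun _ => none)
        (fun l => some (m l)) (fun l => some (m' l)) (fun _ => none) (fun _ => none))
        ?_)).trans
    (Reach.measure (measChain RX true) ?_)).mono (by omega)
  · intro p
    have h := fun x a => hr p.1.1 x a (fun l => some (p.2 l)) (fun l => some (p.2 l))
      (fun _ => none) (fun _ => none) (fun _ => none) (fun _ => none) (by simp) (by simp)
    simp only [if_true] at h
    rw [gadgetState,
      conjBy_bas_ket ((h _ _).trans (one_smul ℂ _).symm) ((h _ _).trans (one_smul ℂ _).symm)]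
    simp [gadgetState]
  · intro p r
    rcases r with (r | r | ⟨l, v⟩ | r | r)
    · rfl
    · rfl
    · exact sum_sumRegs false l.1 l.2 v l.2 _ _ p.2 fun l u i => rfl
    · rfl
    · rfl
  · intro p r
    rcases r with (r | r | r | ⟨l, v⟩ | r)
    · rfl
    · rfl
    · rfl
    · simp only [RegGate.eval, regConf, Sum.elim_inr, Sum.elim_inl, oneHot, crossSums,
        Option.some.injEq, Prod.ext_iff]
      by_cases h1 : pre p.2 l.1 (e l.2) = v.1 <;> by_cases h2 : pre p.2 l.2 (e l.1) = v.2 <;>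
        simp [h1, h2]
    · rfl
  · intro p
    have h : ∀ x, (Vf (regConf p.1.1 (fun l => some (p.2 l)) (fun _ => none)
          (fun l => some (pre p.2 l.1 l.2)) (crossSums e p.2) (fun _ => none)) *
        Vq (regConf p.1.1 (fun l => some (p.2 l)) (fun _ => none)
          (fun l => some (pre p.2 l.1 l.2)) (crossSums e p.2) (fun _ => none))) *ᵥ
        ket (conf x (fun l => some (chain x p.2 l)) fun _ => none) =
        ∑ m, quadAmpl θ x p.2 m • ket (conf x (fun l => some (m l)) fun _ => none) := by
      intro x
      have := hqd p.1.1 x p.2 (fun l => some (p.2 l)) (fun _ => none)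
          (fun l => some (pre p.2 l.1 l.2)) (fun _ => none) (fun _ => none)
      rw [← Matrix.mulVec_mulVec]
      refine (congrArg _ this).trans ?_
      rw [Matrix.mulVec_smul, hf, Finset.smul_sum]
      refine Finset.sum_congr rfl fun m _ => ?_
      rw [smul_smul]
      simp only [star_fourier_apply]
      rfl
    exact conjBy_bas_sum (h _) (h _)
  · intro p
    simp only [map_sum, map_smul]
    refine Finset.sum_congr rfl fun d _ => ?_
    rw [Finset.sum_eq_single d]
    · rw [gadgetState, meas_measChain]; simp [gadgetState]
    · intro d' _ hd'
      rw [gadgetState, meas_measChain, if_neg, smul_zero]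
      simp only [if_true]
      intro h
      exact hd' (funext fun l => (Option.some.inj (congrFun h l)).symm)
    · simp

/-- The copies are reset, the chain totals of `m` control the compensating phases on the data wires,
and all auxiliary registers are overwritten by `0`. Only then can the gadget be used again on the
same wires and registers. -/
lemma reach_correction (hq : q ∈ G.classicalMod) (e : D ≃ Fin N)
    (ι : ChainWire q D N ↪ Fin w) (κ : RX ⊕ AuxReg q D N ↪ Fin c) :
    Reach G (3 + q)
    (fun p : (((RX → Fin 2) × (D → Fin 2) × (D → Fin 2)) × (D × Fin N → ZMod q)) ×
        (D × Fin N → ZMod q) =>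
      ext ι κ (gadgetState p.1.1 (fun l => some (p.1.2 l)) (fun l => some (p.2 l))
        (fun l => some (pre p.1.2 l.1 l.2)) (crossSums e p.1.2) (fun _ => none)
        (fun l => some (p.2 l)) (fun l => some (p.2 l)) (fun _ => none) (fun _ => none)))
    (fun p => ext ι κ (((∏ j, omega q (bit (p.1.1.2.1 j) * pre p.2 j N)) *
      star (∏ j, omega q (bit (p.1.1.2.2 j) * pre p.2 j N))) •
      gadgetState p.1.1 (fun _ => none) (fun _ => none) (fun _ => none)
      (fun _ => none) (fun _ => none) (fun _ => none) (fun _ => none) (fun _ => none)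
      fun _ => none)) := by
  obtain ⟨Vs, hVs, hs⟩ := exists_impl_reset (G := G) (ι := ι) (κ := κ) false
  obtain ⟨Vc, hVc, hc⟩ := exists_impl_correction (G := G) (ι := ι) (κ := κ)
  have h3 := Reach.classical (ι := ι) (κ := κ) hq
    (fun r => match r with
      | .inl r => .keep
      | .inr r => .bounded (.inr r) (.inr r) fun _ _ => 0)
    (σ := fun p : (((RX → Fin 2) × (D → Fin 2) × (D → Fin 2)) × (D × Fin N → ZMod q)) ×
        (D × Fin N → ZMod q) => regConf p.1.1.1 (fun l => some (p.1.2 l))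
      (fun l => some (p.2 l)) (fun l => some (pre p.1.2 l.1 l.2)) (crossSums e p.1.2)
      (fun j => some (pre p.2 j N)))
    (σ' := fun p => regConf p.1.1.1 (fun _ => none) (fun _ => none) (fun _ => none)
      (fun _ => none) (fun _ => none))
    (x := fun p => conf p.1.1.2.1 (fun _ => none) fun _ => none)
    (y := fun p => conf p.1.1.2.2 (fun _ => none) fun _ => none)
    fun p r => by
      rcases r with (r | r | r | r | r)
      · rfl
      all_goals simp [RegGate.eval, regConf, oneHot]
  -- A sum over one branch carries the scalar factor through the classical layer.
  have h3' := Reach.sum (Λ := Unit) (h3.comp Prod.fst)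
    fun p _ => (∏ j, omega q (bit (p.1.1.2.1 j) * pre p.2 j N)) *
      star (∏ j, omega q (bit (p.1.1.2.2 j) * pre p.2 j N))
  refine ((((hVs.reach (B := fun p => gadgetState p.1.1 (fun l => some (p.1.2 l))
    (fun l => some (p.2 l)) (fun l => some (pre p.1.2 l.1 l.2)) (crossSums e p.1.2)
    (fun _ => none) (fun _ => none) (fun _ => none) (fun _ => none) (fun _ => none)) ?_).trans
    (Reach.classical hq
      (fun r => match r with
      | .inr (.inr (.inr (.inr (j, v)))) => .mod (sumRegs RX true j N v)
      | _ => .keep)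
      (σ' := fun p => regConf p.1.1.1 (fun l => some (p.1.2 l))
        (fun l => some (p.2 l)) (fun l => some (pre p.1.2 l.1 l.2)) (crossSums e p.1.2)
        (fun j => some (pre p.2 j N))) ?_)).trans
    (hVc.reach fun p => conjBy_bas_ket (hc _ _ _ _ _ _ _ _ _) (hc _ _ _ _ _ _ _ _ _))).trans
    (h3'.congr ?_ ?_)).mono (by omega)
  · intro p
    have h := fun x => hs p.1.1.1 x (fun l => some (p.2 l)) (fun _ => none)
      (fun l => some (p.1.2 l)) (fun l => some (p.2 l)) (fun l => some (pre p.1.2 l.1 l.2))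
      (crossSums e p.1.2) (fun _ => none) (by simp) (by simp)
    simp only [Bool.false_eq_true, if_false] at h
    rw [gadgetState, conjBy_bas_ket ((h _).trans (one_smul ℂ _).symm)
      ((h _).trans (one_smul ℂ _).symm)]
    simp [gadgetState]
  · intro p r
    rcases r with (r | r | r | r | ⟨j, v⟩)
    · rfl
    · rfl
    · rfl
    · rfl
    · exact sum_sumRegs true j N v (e j) _ _ p.2 fun l u i => rfl
  · intro p
    simp only [Finset.univ_unique, Finset.sum_singleton, map_smul]
  · intro p
    simp only [Finset.univ_unique, Finset.sum_singleton, map_smul]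
    rfl

/-- The depth of the gadget for quadratic phases. -/
def quadDepth (q : ℕ) : ℕ := 4 * blockDepth q + 3 * (q * q) + q + 10

/-- Arbitrary quadratic phases in constant depth. -/
theorem impl_quadratic (hq : q ∈ G.classicalMod) (e : D ≃ Fin N)
    (ι : ChainWire q D N ↪ Fin w) (κ : RX ⊕ AuxReg q D N ↪ Fin c) (θ : D → D → ℝ) :
    Impl G (Function.Embedding.inl.trans ι) (Function.Embedding.inl.trans κ) (quadDepth q)
      fun _ : RX → Fin 2 => Matrix.diagonal (quadPhase θ) := by
  have h1 := reach_prepare (G := G) ι κ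
  have h2 := reach_quadratic hq e ι κ θ
  have h3 := reach_correction hq e ι κ
  -- The correction is applied in every branch `m`, weighted by the amplitudes of the second
  -- measurement.
  have h23 := h2.trans ((h3.sum fun p m => quadAmpl θ p.1.2.1 p.2 m *
    star (quadAmpl θ p.1.2.2 p.2 m)).congr (fun p => by simp only [map_sum, map_smul])
    fun p => rfl)
  have h := (h1.trans ((h23.sum fun _ _ => chainNorm q D N * star (chainNorm q D N)).congr
    (fun p => by simp only [map_sum, map_smul]) fun p => rfl)).mono (n' := quadDepth q)
    (by unfold quadDepth; omega)
  have hext : ∀ p : (RX → Fin 2) × (D → Fin 2) × (D → Fin 2),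
      ext (Function.Embedding.inl.trans ι) (Function.Embedding.inl.trans κ)
        (bas p.1 p.2.1 p.2.2) = ext ι κ (gadgetState p (fun _ => none) (fun _ => none)
      (fun _ => none) (fun _ => none) (fun _ => none) (fun _ => none) (fun _ => none)
      (fun _ => none) fun _ => none) := by
    intro p
    simp only [ext, push_bas, gadgetState, ← pad_inl_eq_conf, ← pad_inl_eq_regConf]
    rw [pad_pad Sum.inl_injective κ.injective, pad_pad Sum.inl_injective ι.injective,
      pad_pad Sum.inl_injective ι.injective]
    rfl
  refine Impl.of_bas (h.congr hext fun p => ?_)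
  have hb := conjBy_bas_ket (V := fun _ : RX → Fin 2 => Matrix.diagonal (quadPhase θ)) (s := p.1)
    (diagonal_mulVec_ket (quadPhase θ) p.2.1) (diagonal_mulVec_ket (quadPhase θ) p.2.2)
  have hsum := sum_phases (q := q) (N := N) (quadPhase θ p.2.1) (quadPhase θ p.2.2) p.2.1 p.2.2
  rw [hb, map_smul, hext, ← hsum]
  simp only [map_smul, Finset.sum_smul, Finset.smul_sum, Finset.mul_sum, smul_smul, quadAmpl]

end Gadget

/-! ### Dropping auxiliary wires that return to `0`. -/

section Restrict

variable {W W' R : Type*} [Fintype W] [DecidableEq W] [Fintype W'] [DecidableEq W'] [Fintype R]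
  [DecidableEq R] {w c : ℕ} {G : GateSet} {κ : R ↪ Fin c} {n : ℕ}

lemma ext_trans (f : W ↪ W') (ι : W' ↪ Fin w) (κ : R ↪ Fin c)
    (σ : GS (R → Fin 2) (W → Fin 2)) :
    ext (f.trans ι) κ σ = ext ι κ (push id (pad f) σ) := by
  rw [ext, ext, push_push]
  congr 2
  funext x
  exact (pad_pad f.injective ι.injective x).symm

lemma Impl.congr {W : Type*} [Fintype W] [DecidableEq W] {ι : W ↪ Fin w}
    {V V' : (R → Fin 2) → Matrix (W → Fin 2) (W → Fin 2) ℂ} (h : Impl G ι κ n V)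
    (hV : ∀ s, V' s = V s) : Impl G ι κ n V' := by rwa [funext hV]

/-- Wires that contain `0` before and after can be dropped. -/
lemma Impl.restrict {f : W ↪ W'} {ι : W' ↪ Fin w}
    {V : (R → Fin 2) → Matrix (W' → Fin 2) (W' → Fin 2) ℂ} (h : Impl G ι κ n V)
    {V' : (R → Fin 2) → Matrix (W → Fin 2) (W → Fin 2) ℂ}
    (hV : ∀ s, V s * relabel (pad (α := Fin 2) f) = relabel (pad (α := Fin 2) f) * V' s) : Impl G (f.trans ι) κ n V' :=
  (Reach.comp h fun σ => push id (pad f) σ).congr (fun σ => ext_trans f ι κ σ) fun σ => by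
    rw [ext_trans, conjBy_push (g := id) hV]

lemma Impl.restrict_relabel {f : W ↪ W'} {ι : W' ↪ Fin w}
    {V : (R → Fin 2) → Matrix (W' → Fin 2) (W' → Fin 2) ℂ} (h : Impl G ι κ n V)
    {t : (R → Fin 2) → (W → Fin 2) → W → Fin 2}
    (hV : ∀ s x, V s *ᵥ ket (pad f x) = ket (pad f (t s x))) :
    Impl G (f.trans ι) κ n fun s => relabel (t s) :=
  h.restrict fun s => matrix_ext_ket fun x => by
    rw [← Matrix.mulVec_mulVec, ← Matrix.mulVec_mulVec, relabel_mulVec_ket, relabel_mulVec_ket,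
      relabel_mulVec_ket, hV]

end Restrict

/-! ### Rotations by affine functions of the bits. -/

section Rotation

/-- The matrix `H diag(1, exp (i φ)) H`. -/
noncomputable def rot (φ : ℝ) : Matrix (Fin 2) (Fin 2) ℂ :=
  Matrix.of fun a b => if a = b then (1 + Complex.exp (Complex.I * φ)) / 2 else
    (1 - Complex.exp (Complex.I * φ)) / 2

lemma rot_neg_mul (φ : ℝ) : rot (-φ) * rot φ = 1 := by
  have h : Complex.exp (Complex.I * (-φ : ℝ)) * Complex.exp (Complex.I * φ) = 1 := by
    rw [← Complex.exp_add]; simp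
  set u := Complex.exp (Complex.I * (-φ : ℝ)) with hu
  set v := Complex.exp (Complex.I * φ) with hv
  ext a b
  fin_cases a <;> fin_cases b <;>
    simp [rot, Matrix.mul_apply, Fin.sum_univ_two, ← hv] <;>
    simp only [Complex.ofReal_neg, mul_neg] at hu <;> rw [← hu] <;>
    first | linear_combination h / 2 | linear_combination -(h / 2)

lemma exp_pi_mul (n : ℕ) : Complex.exp (Complex.I * ((Real.pi * n : ℝ) : ℂ)) = (-1) ^ n := by
  rw [← Complex.exp_pi_mul_I, ← Complex.exp_nat_mul]
  push_cast; ring_nf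

lemma exp_two_pi_mul (n : ℤ) :
    Complex.exp (Complex.I * ((2 * Real.pi * n : ℝ) : ℂ)) = 1 := by
  rw [← Complex.exp_int_mul_two_pi_mul_I n]
  push_cast; ring_nf

lemma rot_pi_mul (n : ℕ) (a b : Fin 2) :
    rot (Real.pi * n) a b = if a = b + Fin.ofNat 2 n then 1 else 0 := by
  simp only [rot, Matrix.of_apply, exp_pi_mul]
  rcases Nat.even_or_odd n with h | h
  · have : Fin.ofNat 2 n = 0 := Fin.ext (Nat.even_iff.1 h)
    rw [h.neg_one_pow, this]; norm_num
  · have : Fin.ofNat 2 n = 1 := Fin.ext (Nat.odd_iff.1 h)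
    rw [h.neg_one_pow, this]
    fin_cases a <;> fin_cases b <;> norm_num <;> rfl

/-- The Hadamard gate. -/
noncomputable def hadamard : Matrix.unitaryGroup (Fin 2) ℂ :=
  ⟨Matrix.of fun a b => invSqrt 2 * if a = 1 ∧ b = 1 then -1 else 1, by
    have h := invSqrt_mul_self 2
    push_cast at h
    rw [Matrix.mem_unitaryGroup_iff, Matrix.star_eq_conjTranspose]
    have hs : (starRingEnd ℂ) (invSqrt 2) = invSqrt 2 := star_invSqrt 2
    ext a b
    fin_cases a <;> fin_cases b <;>
      simp [Matrix.mul_apply, Fin.sum_univ_two, Matrix.conjTranspose_apply, hs] <;>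
      linear_combination h⟩

lemma hadamard_mul_diagonal_mul (φ : ℝ) :
    (hadamard : Matrix (Fin 2) (Fin 2) ℂ) *
      (Matrix.diagonal fun a : Fin 2 => Complex.exp (Complex.I * ((φ * (a : ℕ) : ℝ) : ℂ))) *
      (hadamard : Matrix (Fin 2) (Fin 2) ℂ) = rot φ := by
  have h := invSqrt_mul_self 2
  push_cast at h
  ext a b
  fin_cases a <;> fin_cases b <;>
    simp [hadamard, rot, Matrix.mul_apply, Fin.sum_univ_two, Matrix.diagonal_apply] <;>
    ring_nf <;> ring_nf at h <;> [skip; skip; skip; skip]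
  · linear_combination (1 / 2 + Complex.exp (Complex.I * φ) / 2) * h
  · linear_combination (1 / 2 - Complex.exp (Complex.I * φ) / 2) * h
  · linear_combination (1 / 2 - Complex.exp (Complex.I * φ) / 2) * h
  · linear_combination (1 / 2 + Complex.exp (Complex.I * φ) / 2) * h

variable {D RX : Type*} [Fintype D] [DecidableEq D] [Fintype RX] [DecidableEq RX] {N : ℕ}
  {q : ℕ} [Fact q.Prime] {w c : ℕ} {G : GateSet}

/-- Rotations of the wires in `T` by angles that are given by the other wires. -/
noncomputable def rotOp (T : Finset D) (φ : D → (D → Fin 2) → ℝ) :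
    Matrix (D → Fin 2) (D → Fin 2) ℂ :=
  perSite fun x w => if w ∈ T then rot (φ w x) else 1

lemma rotOp_neg_mul (T : Finset D) (φ : D → (D → Fin 2) → ℝ)
    (h : ∀ x y, (∀ w, w ∉ T → x w = y w) → ∀ w ∈ T, φ w x = φ w y) :
    rotOp T (fun w x => -φ w x) * rotOp T φ = 1 := by
  rw [rotOp, rotOp, perSite_mul, ← perSite_one]
  · congr 1
    funext x w
    split_ifs
    · exact rot_neg_mul _
    · simp
  · intro x y hxy
    funext w
    split_ifs with hw
    · rw [h x y _ w hw]
      intro w' hw'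
      have := hxy w'
      rw [if_neg hw', Matrix.one_apply] at this
      by_contra hne
      exact this (if_neg hne)
    · rfl

/-- The angle that is an affine function of the bits. -/
noncomputable def affAngle (θ₀ : D → ℝ) (θ : D → D → ℝ) (w : D) (x : D → Fin 2) : ℝ :=
  θ₀ w + ∑ j, θ w j * (x j : ℕ)

lemma affAngle_congr {T : Finset D} {θ₀ : D → ℝ} {θ : D → D → ℝ}
    (hθ : ∀ w ∈ T, ∀ j ∈ T, θ w j = 0) (x y : D → Fin 2) (h : ∀ w, w ∉ T → x w = y w) (w : D)
    (hw : w ∈ T) : affAngle θ₀ θ w x = affAngle θ₀ θ w y := by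
  unfold affAngle
  congr 1
  refine Finset.sum_congr rfl fun j _ => ?_
  by_cases hj : j ∈ T
  · rw [hθ w hw j hj]; simp
  · rw [h j hj]

/-- Between Hadamard gates on `T`, the phase `exp(i φ x w)` becomes the rotation by `φ`. If `φ` is
affine in the bits, the sum of all `φ w x * x w` is a quadratic form, so one call of the gadget
serves all targets. Without couplings inside `T` the angles do not change while the targets do. -/
theorem impl_rot (hq : q ∈ G.classicalMod) (e : D ≃ Fin N)
    (ι : ChainWire q D N ↪ Fin w) (κ : RX ⊕ AuxReg q D N ↪ Fin c) (T : Finset D) (θ₀ : D → ℝ)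
    (θ : D → D → ℝ) (hθ : ∀ w ∈ T, ∀ j ∈ T, θ w j = 0) :
    Impl G (Function.Embedding.inl.trans ι) (Function.Embedding.inl.trans κ) (quadDepth q + 2)
      fun _ : RX → Fin 2 => rotOp T (affAngle θ₀ θ) := by
  -- The constant term of an angle sits on the diagonal, as `x j * x j = x j`; there it replaces `θ
  -- j j`, which vanishes on `T`.
  have hQ := impl_quadratic (G := G) hq e ι κ fun j k => if j ∈ T then
    (if j = k then θ₀ j else θ j k) else 0
  let L : LayerSpec D RX := LayerSpec.ofFamily (fun b : {w // w ∈ T} => b.1)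
    Subtype.val_injective (fun _ => ⟨none, none, hadamard⟩) (by intro b b' j hj; simp at hj)
    (by intro b b' j hj hj'; simp at hj)
  have hL : ∀ s, L.op s = perSite fun _ w => if w ∈ T then
      (hadamard : Matrix (Fin 2) (Fin 2) ℂ) else 1 := by
    intro s
    unfold LayerSpec.op
    congr 1
    funext x w
    by_cases hw : w ∈ T
    · rw [if_pos hw]
      have := LayerSpec.site_ofFamily (ht := Subtype.val_injective)
        (g := fun _ : {w // w ∈ T} => (⟨none, none, hadamard⟩ : WireGate D RX))
        (h1 := by intro b b' j hj; simp at hj) (h2 := by intro b b' j hj hj'; simp at hj)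
        s x ⟨w, hw⟩
      refine this.trans ?_
      simp [WireGate.act]
    · rw [if_neg hw]
      exact LayerSpec.site_ofFamily_of_ne s x w fun b hb => hw (hb ▸ b.2)
  have hD : (Matrix.diagonal (quadPhase fun j k => if j ∈ T then
      (if j = k then θ₀ j else θ j k) else 0) : Matrix (D → Fin 2) (D → Fin 2) ℂ) =
      perSite fun x w => if w ∈ T then Matrix.diagonal fun a : Fin 2 =>
        Complex.exp (Complex.I * ((affAngle θ₀ θ w x * (a : ℕ) : ℝ) : ℂ)) else 1 := by
    symm
    refine diagonal_of_ket fun x => ?_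
    rw [perSite_mulVec_ket_of_diag (φ := fun w => Complex.exp (Complex.I *
      ((if w ∈ T then affAngle θ₀ θ w x * (x w : ℕ) else 0 : ℝ) : ℂ)))]
    · congr 1
      rw [← Complex.exp_sum, quadPhase, ← Finset.mul_sum]
      congr 2
      simp only [← Complex.ofReal_sum]
      congr 1
      refine Finset.sum_congr rfl fun j _ => ?_
      split_ifs with hj
      · unfold affAngle
        have hx : ((x j : ℕ) : ℝ) * (x j : ℕ) = (x j : ℕ) := by
          have : ∀ b : Fin 2, (b : ℕ) * (b : ℕ) = (b : ℕ) := by decide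
          exact_mod_cast this (x j)
        have h1 : ∀ k, (if j = k then θ₀ j else θ j k) * (x j : ℕ) * (x k : ℕ) =
            (if j = k then θ₀ j * (x j : ℕ) else 0) + θ j k * (x k : ℕ) * (x j : ℕ) := by
          intro k
          by_cases hk : j = k
          · subst hk
            rw [hθ j hj j hj, if_pos rfl, if_pos rfl]
            linear_combination θ₀ j * hx
          · rw [if_neg hk, if_neg hk]; ring
        simp only [h1, Finset.sum_add_distrib, Finset.sum_ite_eq, Finset.mem_univ, if_true,
          add_mul, Finset.sum_mul]
      · simp
    · intro w a
      by_cases hw : w ∈ T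
      · simp only [hw, if_true, Matrix.diagonal_apply]
        split_ifs with h
        · rw [h]
        · rfl
      · simp [hw, Matrix.one_apply]
  refine (((L.impl.mul hQ).mul L.impl).mono (by omega)).congr fun s => ?_
  rw [hL, hD, perSite_mul (B := fun _ w => if w ∈ T then
    (hadamard : Matrix (Fin 2) (Fin 2) ℂ) else 1), perSite_mul fun _ _ _ => rfl, rotOp]
  · congr 1
    funext x w
    split_ifs
    · rw [← mul_assoc, hadamard_mul_diagonal_mul]
    · simp
  · intro x y hxy
    funext w
    split_ifs with hw
    · rw [affAngle_congr hθ x y _ w hw]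
      intro w' hw'
      have := hxy w'
      rw [if_neg hw', Matrix.one_apply] at this
      by_contra hne
      exact this (if_neg hne)
    · rfl

end Rotation

/-! ### Phase estimation against a guess, and parities. -/

section Arithmetic

lemma exists_two_pow_mul_odd {δ : ℤ} {m : ℕ} (h : ¬ (2 : ℤ) ^ m ∣ δ) :
    ∃ k < m, ∃ t : ℤ, δ = 2 ^ k * (2 * t + 1) := by
  induction m with
  | zero => simp at h
  | succ m ih =>
    by_cases hm : (2 : ℤ) ^ m ∣ δ
    · obtain ⟨u, rfl⟩ := hm
      refine ⟨m, by omega, ?_⟩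
      rcases Int.even_or_odd u with hu | ⟨t, rfl⟩
      · obtain ⟨t, rfl⟩ := hu
        exact absurd ⟨t, by ring⟩ h
      · exact ⟨t, rfl⟩
    · obtain ⟨k, hk, t, ht⟩ := ih hm
      exact ⟨k, by omega, t, ht⟩

/-- Bits that are obtained from phase estimation with the guess `s` vanish if and only if the
guess is right. -/
lemma estimate_correct {m : ℕ} (h s : ℕ) (hs : s < 2 ^ m) (y : Fin m → Fin 2)
    (hy : ∀ k : Fin m, rot (2 * Real.pi * ((h : ℝ) - s) / 2 ^ ((k : ℕ) + 1)) (y k) 0 ≠ 0) :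
    (∀ k, y k = 0) ↔ h % 2 ^ m = s := by
  have hcases : ∀ b : Fin 2, b = 0 ∨ b = 1 := by decide
  constructor
  · intro h0
    by_contra hne
    have hdvd : ¬ (2 : ℤ) ^ m ∣ (h : ℤ) - s := by
      intro hd
      apply hne
      have : h ≡ s [MOD 2 ^ m] := by
        rw [Nat.modEq_iff_dvd]
        push_cast
        rw [← neg_sub]
        exact hd.neg_right
      rw [this, Nat.mod_eq_of_lt hs]
    -- At the 2-adic valuation `k` of `h - s` the angle is an odd multiple of `π`. That bit is
    -- flipped with certainty, which contradicts its being `0`.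
    obtain ⟨k, hk, t, ht⟩ := exists_two_pow_mul_odd hdvd
    apply hy ⟨k, hk⟩
    rw [h0]
    have hr : (h : ℝ) - s = 2 ^ k * (2 * t + 1) := by exact_mod_cast congrArg (Int.cast (R := ℝ)) ht
    have hang : 2 * Real.pi * ((h : ℝ) - s) / 2 ^ (k + 1) =
        2 * Real.pi * (t : ℤ) + Real.pi * (1 : ℕ) := by
      rw [hr, pow_succ]; field_simp; push_cast; ring
    simp only [rot, Matrix.of_apply, if_true, hang]
    rw [Complex.ofReal_add, mul_add, Complex.exp_add, exp_two_pi_mul, exp_pi_mul]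
    simp
  · intro hmod k
    by_contra hne
    apply hy k
    have hk1 : y k = 1 := (hcases (y k)).resolve_left hne
    have hr : (h : ℝ) = 2 ^ m * (h / 2 ^ m : ℕ) + s := by
      have := Nat.div_add_mod h (2 ^ m)
      rw [hmod] at this
      exact_mod_cast this.symm
    have hpow : (2 : ℝ) ^ m = 2 ^ ((k : ℕ) + 1) * 2 ^ (m - (k + 1)) := by
      rw [← pow_add]; congr 1; omega
    obtain ⟨n, hn⟩ : ∃ n : ℤ, n = ((2 ^ (m - (k + 1)) * (h / 2 ^ m) : ℕ) : ℤ) := ⟨_, rfl⟩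
    have hn' : (n : ℝ) = 2 ^ (m - (k + 1)) * (h / 2 ^ m : ℕ) := by
      rw [hn, Int.cast_natCast, Nat.cast_mul, Nat.cast_pow, Nat.cast_ofNat]
    -- If the guess is right, every angle is a multiple of `2π` and no bit can flip.
    have hang : 2 * Real.pi * ((h : ℝ) - s) / 2 ^ ((k : ℕ) + 1) = 2 * Real.pi * n := by
      rw [hr, add_sub_cancel_right, hpow, hn']
      field_simp
    simp only [rot, Matrix.of_apply, hang, exp_two_pi_mul, hk1]
    simp

/-- Orthogonality of the characters of `F_2^m`: averaging the signs of all parities detects the zero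
string. So an unbounded conjunction is affine in `2 ^ m` parity bits and can serve as a rotation
angle. -/
lemma sum_parity {m : ℕ} (y : Fin m → Fin 2) :
    ∑ S : Fin m → Fin 2, (1 - 2 * ((Fin.ofNat 2 (∑ k, (S k : ℕ) * (y k : ℕ)) : Fin 2) : ℕ) : ℝ) =
      if ∀ k, y k = 0 then 2 ^ m else 0 := by
  have h1 : ∀ n : ℕ, (1 - 2 * ((Fin.ofNat 2 n : Fin 2) : ℕ) : ℝ) = (-1) ^ n := by
    intro n
    rw [Fin.val_ofNat]
    rcases Nat.even_or_odd n with h | h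
    · rw [h.neg_one_pow, Nat.even_iff.1 h]; norm_num
    · rw [h.neg_one_pow, Nat.odd_iff.1 h]; norm_num
  simp only [h1, ← Finset.prod_pow_eq_pow_sum]
  have h2 := Finset.prod_univ_sum (fun _ : Fin m => (Finset.univ : Finset (Fin 2)))
    (fun k b => (-1 : ℝ) ^ ((b : ℕ) * (y k : ℕ)))
  simp only [Fintype.piFinset_univ] at h2
  rw [← h2]
  have hcases : ∀ b : Fin 2, b = 0 ∨ b = 1 := by decide
  split_ifs with h
  · simp [h, Finset.prod_const, one_add_one_eq_two]
  · push Not at h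
    obtain ⟨k, hk⟩ := h
    apply Finset.prod_eq_zero (Finset.mem_univ k)
    simp [(hcases (y k)).resolve_left hk]

end Arithmetic

lemma mulVec_ket_sum {X : Type*} [Fintype X] [DecidableEq X] (M : Matrix X X ℂ) (x : X) :
    M *ᵥ ket x = ∑ o, M o x • ket o := by
  ext y
  rw [mulVec_ket_apply]
  simp [ket_apply]

/-! ### The oracle for functions of weighted sums. -/

section Oracle

variable {X : Type*} [Fintype X] [DecidableEq X] {m : ℕ}

/-- Data wires, wires for phase estimation with every guess, and wires for parities. -/
abbrev OracleWire (X : Type*) (m : ℕ) : Type _ :=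
  X ⊕ (X × Fin (2 ^ m) × Fin m) ⊕ (X × Fin (2 ^ m) × (Fin m → Fin 2))

/-- The wires for phase estimation. -/
def estWires (X : Type*) [Fintype X] (m : ℕ) : Finset (OracleWire X m) :=
  Finset.univ.map ⟨fun t => .inr (.inl t), fun t t' h => by simpa using h⟩

/-- The wires for parities. -/
def parWires (X : Type*) [Fintype X] (m : ℕ) : Finset (OracleWire X m) :=
  Finset.univ.map ⟨fun t => .inr (.inr t), fun t t' h => by simpa using h⟩

@[simp] lemma est_mem_estWires (t : X × Fin (2 ^ m) × Fin m) :
    (.inr (.inl t) : OracleWire X m) ∈ estWires X m :=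
  Finset.mem_map.2 ⟨t, Finset.mem_univ _, rfl⟩

@[simp] lemma inl_notMem_estWires (j : X) : (.inl j : OracleWire X m) ∉ estWires X m := fun h => by
  obtain ⟨t, -, ht⟩ := Finset.mem_map.1 h
  exact absurd ht Sum.inr_ne_inl

@[simp] lemma par_notMem_estWires (t : X × Fin (2 ^ m) × (Fin m → Fin 2)) :
    (.inr (.inr t) : OracleWire X m) ∉ estWires X m := fun h => by
  obtain ⟨t', -, ht⟩ := Finset.mem_map.1 h
  exact absurd (Sum.inr_injective ht) Sum.inl_ne_inr

@[simp] lemma par_mem_parWires (t : X × Fin (2 ^ m) × (Fin m → Fin 2)) :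
    (.inr (.inr t) : OracleWire X m) ∈ parWires X m :=
  Finset.mem_map.2 ⟨t, Finset.mem_univ _, rfl⟩

@[simp] lemma inl_notMem_parWires (j : X) : (.inl j : OracleWire X m) ∉ parWires X m := fun h => by
  obtain ⟨t, -, ht⟩ := Finset.mem_map.1 h
  exact absurd ht Sum.inr_ne_inl

@[simp] lemma est_notMem_parWires (t : X × Fin (2 ^ m) × Fin m) :
    (.inr (.inl t) : OracleWire X m) ∉ parWires X m := fun h => by
  obtain ⟨t', -, ht⟩ := Finset.mem_map.1 h
  exact absurd (Sum.inr_injective ht) Sum.inr_ne_inl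

/-- The guesses of the phase estimation. -/
noncomputable def estConst : OracleWire X m → ℝ :=
  Sum.elim 0 (Sum.elim (fun t => -(2 * Real.pi * (t.2.1 : ℕ) / 2 ^ ((t.2.2 : ℕ) + 1))) 0)

/-- The coefficients of the phase estimation. -/
noncomputable def estCoef (wt : X → X → ℕ) : OracleWire X m → OracleWire X m → ℝ :=
  Sum.elim 0 (Sum.elim (fun t =>
    Sum.elim (fun j => 2 * Real.pi * wt t.1 j / 2 ^ ((t.2.2 : ℕ) + 1)) 0) 0)

/-- The angles of the phase estimation. -/
noncomputable def estAngle (wt : X → X → ℕ) : OracleWire X m → (OracleWire X m → Fin 2) → ℝ :=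
  affAngle estConst (estCoef wt)

/-- The angles of the computation of parities. -/
noncomputable def parAngle : OracleWire X m → (OracleWire X m → Fin 2) → ℝ :=
  affAngle 0 (Sum.elim 0 (Sum.elim 0 fun t => Sum.elim 0 (Sum.elim (fun t' =>
    if t'.1 = t.1 ∧ t'.2.1 = t.2.1 then Real.pi * (t.2.2 t'.2.2 : ℕ) else 0) 0)))

/-- The angles of the evaluation. -/
noncomputable def evalAngle (g : X → ℕ → Bool) :
    OracleWire X m → (OracleWire X m → Fin 2) → ℝ :=
  affAngle (Sum.elim (fun z => Real.pi * ∑ s : Fin (2 ^ m), if g z s then 1 else 0) 0)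
    (Sum.elim (fun z => Sum.elim 0 (Sum.elim 0 fun t =>
      if t.1 = z ∧ g z t.2.1 then -(2 * Real.pi / 2 ^ m) else 0)) 0)

/-- The weighted sum of the data bits. -/
def weight (wt : X → X → ℕ) (z : X) (x : X → Fin 2) : ℕ := ∑ j, wt z j * (x j : ℕ)

lemma estAngle_apply (wt : X → X → ℕ) (t : X × Fin (2 ^ m) × Fin m)
    (o : OracleWire X m → Fin 2) : estAngle wt (.inr (.inl t)) o =
      2 * Real.pi * ((weight wt t.1 (fun j => o (.inl j)) : ℝ) - (t.2.1 : ℕ)) /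
        2 ^ ((t.2.2 : ℕ) + 1) := by
  simp only [estAngle, estConst, estCoef, affAngle, Sum.elim_inr, Sum.elim_inl, Fintype.sum_sum_type, weight,
    Pi.zero_apply, zero_mul, Finset.sum_const_zero, add_zero]
  push_cast
  rw [mul_sub, sub_div, Finset.mul_sum, Finset.sum_div, sub_eq_neg_add]
  congr 1
  refine Finset.sum_congr rfl fun j _ => ?_
  ring

lemma parAngle_apply (t : X × Fin (2 ^ m) × (Fin m → Fin 2)) (o : OracleWire X m → Fin 2) :
    parAngle (.inr (.inr t)) o =
      Real.pi * ((∑ k, (t.2.2 k : ℕ) * (o (.inr (.inl (t.1, t.2.1, k))) : ℕ) : ℕ) : ℝ) := by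
  simp only [parAngle, affAngle, Sum.elim_inr, Sum.elim_inl, Fintype.sum_sum_type,
    Pi.zero_apply, zero_mul, Finset.sum_const_zero, add_zero, zero_add, Fintype.sum_prod_type]
  rw [Fintype.sum_eq_single t.1, Fintype.sum_eq_single t.2.1]
  · simp [Finset.mul_sum, mul_assoc]
  · intro s hs; simp [hs]
  · intro z hz; simp [hz]

/-- The indicator of `r = s` is the average over `S` of `1 - 2 * parity`. Multiplying by `π * g z s`
and summing over `s` gives the constant term and the coefficient `-2π / 2^m` of the angle. -/
lemma evalAngle_apply (g : X → ℕ → Bool) (z : X) (o : OracleWire X m → Fin 2)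
    (r : ℕ) (hr : r < 2 ^ m)
    (ho : ∀ s : Fin (2 ^ m), ∑ S : Fin m → Fin 2, (1 - 2 * (o (.inr (.inr (z, s, S))) : ℕ) : ℝ) =
      if r = s then 2 ^ m else 0) :
    evalAngle g (.inl z) o = Real.pi * ((if g z r then 1 else 0 : ℕ) : ℝ) := by
  simp only [evalAngle, affAngle, Sum.elim_inr, Sum.elim_inl, Fintype.sum_sum_type,
    Pi.zero_apply, zero_mul, Finset.sum_const_zero, add_zero, zero_add, Fintype.sum_prod_type]
  rw [Fintype.sum_eq_single z (by intro z' hz; simp [hz]), Finset.mul_sum,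
    ← Finset.sum_add_distrib]
  have h : ∀ s : Fin (2 ^ m), (Real.pi * (if g z s then 1 else 0) + ∑ S : Fin m → Fin 2,
      (if z = z ∧ g z s then -(2 * Real.pi / 2 ^ m) else 0) *
        ((o (.inr (.inr (z, s, S))) : ℕ) : ℝ)) =
      if (⟨r, hr⟩ : Fin (2 ^ m)) = s then Real.pi * ((if g z r then 1 else 0 : ℕ) : ℝ) else 0 := by
    intro s
    have hs := ho s
    rw [Finset.sum_sub_distrib, ← Finset.mul_sum] at hs
    simp only [Finset.sum_const, Finset.card_univ, Fintype.card_pi, Fintype.card_fin,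
      Finset.prod_const, nsmul_eq_mul, mul_one] at hs
    push_cast at hs
    rw [← Finset.mul_sum]
    have h2 : (2 : ℝ) ^ m ≠ 0 := by positivity
    simp only [Fin.ext_iff, true_and]
    by_cases hg : g z s = true
    · simp only [hg, if_true]
      by_cases hrs : r = s
      · rw [if_pos hrs, if_pos (by rw [hrs]; exact hg)]
        rw [if_pos hrs] at hs
        have : ∑ S : Fin m → Fin 2, ((o (.inr (.inr (z, s, S))) : ℕ) : ℝ) = 0 := by linarith
        rw [this]; simp
      · rw [if_neg hrs]
        rw [if_neg hrs] at hs
        have : ∑ S : Fin m → Fin 2, ((o (.inr (.inr (z, s, S))) : ℕ) : ℝ) = 2 ^ m / 2 := by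
          linarith
        rw [this]; field_simp; ring
    · simp only [hg, if_false, Bool.false_eq_true]
      by_cases hrs : r = s
      · rw [if_pos hrs, hrs, if_neg hg]; simp
      · rw [if_neg hrs]; simp
  refine (Finset.sum_congr rfl fun s _ => h s).trans ?_
  simp

end Oracle

section Oracle

variable {X : Type*} [Fintype X] [DecidableEq X] {m : ℕ}

/-- The bits that the oracle adds to the data wires. -/
def flips (m : ℕ) (wt : X → X → ℕ) (g : X → ℕ → Bool) (Z : Finset X) (x : X → Fin 2) (z : X) :
    Fin 2 := if z ∈ Z ∧ g z (weight wt z x % 2 ^ m) then 1 else 0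

/-- The parities of the wires for phase estimation. -/
def parities (o : OracleWire X m → Fin 2) : OracleWire X m → Fin 2 :=
  Sum.elim 0 (Sum.elim 0 fun t =>
    Fin.ofNat 2 (∑ k, (t.2.2 k : ℕ) * (o (.inr (.inl (t.1, t.2.1, k))) : ℕ)))

lemma rotOp_parAngle_mulVec_ket (o : OracleWire X m → Fin 2) :
    rotOp (parWires X m) parAngle *ᵥ ket o = ket (o + parities o) := by
  apply perSite_mulVec_ket_of_perm
  rintro (j | t | t) a
  · rw [if_neg (by simp)]
    simp [Matrix.one_apply, parities]
  · rw [if_neg (by simp)]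
    simp [Matrix.one_apply, parities]
  · rw [if_pos (by simp), parAngle_apply, rot_pi_mul]
    rfl

lemma rotOp_evalAngle_mulVec_ket (wt : X → X → ℕ) (g : X → ℕ → Bool) (Z : Finset X)
    (x : X → Fin 2) (o : OracleWire X m → Fin 2)
    (ho : ∀ z, ∀ s : Fin (2 ^ m),
      (∀ k, o (.inr (.inl (z, s, k))) = 0) ↔ weight wt z x % 2 ^ m = s)
    (ho' : ∀ t, o (.inr (.inr t)) =
      Fin.ofNat 2 (∑ k, (t.2.2 k : ℕ) * (o (.inr (.inl (t.1, t.2.1, k))) : ℕ))) :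
    rotOp (Z.map Function.Embedding.inl) (evalAngle g) *ᵥ ket o =
      ket (o + Sum.elim (flips m wt g Z x) 0) := by
  apply perSite_mulVec_ket_of_perm
  rintro (z | t) a
  · by_cases hz : z ∈ Z
    · rw [if_pos (by simpa using hz), evalAngle_apply g z o (weight wt z x % 2 ^ m)
        (Nat.mod_lt _ (by positivity)), rot_pi_mul]
      · simp only [Pi.add_apply, Sum.elim_inl, flips, hz, true_and]
        congr 3
        split_ifs <;> rfl
      · intro s
        have := sum_parity fun k => o (.inr (.inl (z, s, k)))
        simp only [ho' (z, s, _)]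
        rw [this]
        exact if_congr (ho z s) rfl rfl
    · rw [if_neg (by simpa using hz)]
      simp [Matrix.one_apply, flips, hz]
  · rw [if_neg (by simp)]
    simp [Matrix.one_apply]

/-- The flipped data wires have weight `0`, so phase estimation does not notice the flips. This is
what allows it to be undone after the data have changed. -/
lemma rotOp_estAngle_apply_add (wt : X → X → ℕ) (b : OracleWire X m → Fin 2)
    (hb : ∀ t, b (.inr t) = 0) (hw : ∀ z j, b (.inl j) ≠ 0 → wt z j = 0)
    (o o' : OracleWire X m → Fin 2) :
    rotOp (estWires X m) (estAngle wt) (o + b) (o' + b) =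
      rotOp (estWires X m) (estAngle wt) o o' := by
  rw [rotOp, perSite_apply, perSite_apply]
  refine Finset.prod_congr rfl ?_
  rintro (j | t | t) -
  · rw [if_neg (by simp), if_neg (by simp)]
    simp [Matrix.one_apply]
  · have hwt : weight wt t.1 (fun j => (o' + b) (.inl j)) = weight wt t.1 fun j => o' (.inl j) := by
      unfold weight
      refine Finset.sum_congr rfl fun j _ => ?_
      by_cases hj : b (.inl j) = 0
      · simp [hj]
      · simp [hw t.1 j hj]
    rw [if_pos (by simp), if_pos (by simp), estAngle_apply, estAngle_apply,
      hwt]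
    simp [hb]
  · rw [if_neg (by simp), if_neg (by simp)]
    simp [Matrix.one_apply]

/-- What a nonvanishing amplitude after phase estimation tells about the label. -/
lemma of_rotOp_estAngle_ne_zero (wt : X → X → ℕ) (x : X → Fin 2) (o : OracleWire X m → Fin 2)
    (h : rotOp (estWires X m) (estAngle wt) o (pad Sum.inl x) ≠ 0) :
    (∀ z, ∀ s : Fin (2 ^ m),
      (∀ k, o (.inr (.inl (z, s, k))) = 0) ↔ weight wt z x % 2 ^ m = s) ∧
    ∀ t, o (.inr (.inr t)) = 0 := by
  rw [rotOp, perSite_apply, Finset.prod_ne_zero_iff] at h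
  have hx : ∀ t, pad (Sum.inl : X → OracleWire X m) x (.inr t) = 0 := fun t =>
    pad_apply_of_notMem x (by simp)
  have hx' : ∀ j, pad (Sum.inl : X → OracleWire X m) x (.inl j) = x j := fun j =>
    pad_apply Sum.inl_injective x j
  constructor
  · intro z s
    refine estimate_correct _ _ s.2 _ fun k => ?_
    have := h (.inr (.inl (z, s, k))) (Finset.mem_univ _)
    rw [if_pos (by simp), estAngle_apply, hx] at this
    simpa only [hx'] using this
  · intro t
    have := h (.inr (.inr t)) (Finset.mem_univ _)
    rw [if_neg (by simp), Matrix.one_apply, hx] at this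
    by_contra hne
    exact this (if_neg hne)

/-- Phase estimation for wrong guesses leaves a superposition of many strings, but in each branch of
nonzero amplitude the predicate "all zero" has the right value. The steps in the middle therefore
act in all branches as the same translation by `b`, which commutes with phase estimation, and the
inverse rotations remove the superposition. -/
lemma oracle_mulVec_ket (wt : X → X → ℕ) (g : X → ℕ → Bool) (Z : Finset X)
    (hZ : ∀ z, ∀ j ∈ Z, wt z j = 0) (x : X → Fin 2) :
    (rotOp (estWires X m) (fun w x => -estAngle wt w x) * (rotOp (parWires X m) parAngle *
      (rotOp (Z.map Function.Embedding.inl) (evalAngle g) * (rotOp (parWires X m) parAngle *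
        rotOp (estWires X m) (estAngle wt))))) *ᵥ ket (pad Sum.inl x) =
      ket (pad Sum.inl (x + flips m wt g Z x)) := by
  set b : OracleWire X m → Fin 2 := Sum.elim (flips m wt g Z x) 0 with hb
  have hbz : ∀ z j, b (.inl j) ≠ 0 → wt z j = 0 := by
    intro z j hj
    apply hZ
    by_contra hne
    apply hj
    simp [hb, flips, hne]
  have htwo : ∀ a : Fin 2, a + a = 0 := by decide
  have hpar : ∀ o c : OracleWire X m → Fin 2, (∀ t, c (.inr (.inl t)) = 0) →
      parities (o + c) = parities o := by
    intro o c hc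
    unfold parities
    simp only [Pi.add_apply, hc, add_zero]
  have hmid : ∀ o : OracleWire X m → Fin 2,
      rotOp (estWires X m) (estAngle wt) o (pad Sum.inl x) ≠ 0 →
      rotOp (parWires X m) parAngle *ᵥ rotOp (Z.map Function.Embedding.inl) (evalAngle g) *ᵥ
        rotOp (parWires X m) parAngle *ᵥ ket o = ket (o + b) := by
    intro o ho
    obtain ⟨h1, h2⟩ := of_rotOp_estAngle_ne_zero wt x o ho
    have hp : parities (o + parities o) = parities o := hpar _ _ fun t => rfl
    rw [rotOp_parAngle_mulVec_ket, rotOp_evalAngle_mulVec_ket wt g Z x,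
      rotOp_parAngle_mulVec_ket, hpar _ _ fun t => rfl, hp]
    · congr 1
      -- The second computation of parities sees the same estimation bits as the first, so the
      -- parities cancel in `Fin 2`.
      funext w
      simp only [Pi.add_apply]
      rw [add_right_comm, add_assoc (o w), htwo, add_zero]
    · intro z s
      rw [← h1]
      simp [parities]
    · intro t
      rw [Pi.add_apply, h2, zero_add]
      simp [parities]
  have hpad : pad Sum.inl (x + flips m wt g Z x) = pad Sum.inl x + b := by
    symm
    apply pad_ext Sum.inl_injective
    · intro j; simp [hb, pad_apply Sum.inl_injective]
    · rintro (j | t) h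
      · exact absurd rfl (h j)
      · rw [Pi.add_apply, pad_apply_of_notMem x h]; rfl
  have hinv : rotOp (estWires X m) (fun w x => -estAngle wt w x) *
      rotOp (estWires X m) (estAngle wt) = 1 := by
    apply rotOp_neg_mul
    apply affAngle_congr
    intro w hw j hj
    simp only [estWires, Finset.mem_map, Finset.mem_univ, true_and,
      Function.Embedding.coeFn_mk] at hw hj
    obtain ⟨t, rfl⟩ := hw
    obtain ⟨t', rfl⟩ := hj
    rfl
  simp only [← Matrix.mulVec_mulVec]
  conv_lhs => rw [mulVec_ket_sum (rotOp (estWires X m) (estAngle wt))]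
  have hsum : rotOp (parWires X m) parAngle *ᵥ
      rotOp (Z.map Function.Embedding.inl) (evalAngle g) *ᵥ rotOp (parWires X m) parAngle *ᵥ
      (∑ o, rotOp (estWires X m) (estAngle wt) o (pad Sum.inl x) • ket o) =
      rotOp (estWires X m) (estAngle wt) *ᵥ ket (pad Sum.inl x + b) := by
    -- Translation by `b` matches the branches of phase estimation on the old data with those on the
    -- new data.
    rw [mulVec_ket_sum, ← Equiv.sum_comp (Equiv.addRight b) fun o =>
      rotOp (estWires X m) (estAngle wt) o (pad Sum.inl x + b) • ket o]
    simp only [Matrix.mulVec_sum, Matrix.mulVec_smul, Equiv.coe_addRight]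
    refine Finset.sum_congr rfl fun o _ => ?_
    rw [rotOp_estAngle_apply_add wt b (fun t => rfl) hbz]
    by_cases ho : rotOp (estWires X m) (estAngle wt) o (pad Sum.inl x) = 0
    · rw [ho, zero_smul, zero_smul]
    · rw [hmid o ho]
  rw [hsum, Matrix.mulVec_mulVec, hinv, Matrix.one_mulVec, hpad]

variable {q : ℕ} [Fact q.Prime] {w c N : ℕ} {G : GateSet} {RX : Type*} [Fintype RX]
  [DecidableEq RX]

/-- The depth of the oracle. -/
def oracleDepth (q : ℕ) : ℕ := 5 * (quadDepth q + 2)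

lemma affAngle_neg {D : Type*} [Fintype D] (θ₀ : D → ℝ) (θ : D → D → ℝ) :
    (fun w x => -affAngle θ₀ θ w x) = affAngle (fun w => -θ₀ w) fun w j => -θ w j := by
  funext w x
  simp only [affAngle, neg_add, neg_mul, Finset.sum_neg_distrib]

/-- Arbitrary functions of a weighted sum of bits modulo a power of two are added to any number of
wires in constant depth. -/
theorem impl_oracle (hq : q ∈ G.classicalMod) (e : OracleWire X m ≃ Fin N)
    (ι : ChainWire q (OracleWire X m) N ↪ Fin w) (κ : RX ⊕ AuxReg q (OracleWire X m) N ↪ Fin c)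
    (wt : X → X → ℕ) (g : X → ℕ → Bool) (Z : Finset X) (hZ : ∀ z, ∀ j ∈ Z, wt z j = 0) :
    Impl G (Function.Embedding.inl.trans (Function.Embedding.inl.trans ι))
      (Function.Embedding.inl.trans κ) (oracleDepth q)
      fun _ : RX → Fin 2 => relabel fun x => x + flips m wt g Z x := by
  have hest : ∀ w ∈ estWires X m, ∀ j ∈ estWires X m,
      estCoef wt w j = 0 := by
    intro w hw j hj
    simp only [estWires, Finset.mem_map, Finset.mem_univ, true_and,
      Function.Embedding.coeFn_mk] at hw hj
    obtain ⟨t, rfl⟩ := hw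
    obtain ⟨t', rfl⟩ := hj
    rfl
  have h1 := impl_rot (G := G) hq e ι κ (estWires X m) estConst (estCoef wt) hest
  have h2 := impl_rot (G := G) hq e ι κ (estWires X m) (fun w => -estConst w)
    (fun w j => -estCoef wt w j) (fun w hw j hj => by rw [hest w hw j hj, neg_zero])
  rw [← affAngle_neg] at h2
  have h3 := impl_rot (G := G) hq e ι κ (parWires X m) 0
    (Sum.elim 0 (Sum.elim 0 fun t => Sum.elim 0 (Sum.elim (fun t' =>
      if t'.1 = t.1 ∧ t'.2.1 = t.2.1 then Real.pi * (t.2.2 t'.2.2 : ℕ) else 0) 0))) (by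
    intro w hw j hj
    simp only [parWires, Finset.mem_map, Finset.mem_univ, true_and,
      Function.Embedding.coeFn_mk] at hw hj
    obtain ⟨t, rfl⟩ := hw
    obtain ⟨t', rfl⟩ := hj
    rfl)
  have h4 := impl_rot (G := G) hq e ι κ (Z.map Function.Embedding.inl)
    (Sum.elim (fun z => Real.pi * ∑ s : Fin (2 ^ m), if g z s then 1 else 0) 0)
    (Sum.elim (fun z => Sum.elim 0 (Sum.elim 0 fun t =>
      if t.1 = z ∧ g z t.2.1 then -(2 * Real.pi / 2 ^ m) else 0)) 0) (by
    intro w hw j hj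
    simp only [Finset.mem_map, Function.Embedding.inl_apply] at hw hj
    obtain ⟨t, -, rfl⟩ := hw
    obtain ⟨t', -, rfl⟩ := hj
    rfl)
  have h := ((((h1.mul h3).mul h4).mul h3).mul h2).mono (n' := oracleDepth q)
    (by unfold oracleDepth; omega)
  exact h.restrict_relabel fun s x => oracle_mulVec_ket wt g Z hZ x

end Oracle

/-- All oracles on the given wires are available in depth `n`. -/
def HasOracle {X R : Type*} [Fintype X] [DecidableEq X] [Fintype R] [DecidableEq R] {w c : ℕ}
    (G : GateSet) (ι : X ↪ Fin w) (κ : R ↪ Fin c) (m n : ℕ) : Prop :=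
  ∀ (wt : X → X → ℕ) (g : X → ℕ → Bool) (Z : Finset X), (∀ z, ∀ j ∈ Z, wt z j = 0) →
    Impl G ι κ n fun _ : R → Fin 2 => relabel fun x => x + flips m wt g Z x

/-! ### Simulation of controlled powers by routing. -/

section Simulation

/-- The wires of the simulation: encoded inputs and outputs, qudits in one-hot encoding, blocks
for the application of powers of unitaries, and control bits. -/
abbrev SimWire (α β : Type*) (w p : ℕ) : Type _ :=
  α ⊕ β ⊕ (Fin w × Fin p) ⊕ (Fin w × Fin p × Fin p) ⊕ Fin w

/-- The registers of the simulation: registers in one-hot encoding and conjunctions. -/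
abbrev SimReg (c p : ℕ) : Type := (Fin c × Fin p) ⊕ (Fin c × Fin p × Fin p)

variable {α β : Type*} [Fintype α] [DecidableEq α] [Fintype β] [DecidableEq β] {w c p : ℕ}

/-- Labels of the wires of the simulation. -/
def simLabel (u : α → Fin 2) (v : β → Fin 2) (d : Fin w → Option (Fin p))
    (z : Fin w → Fin p → Option (Fin p)) (k : Fin w → Fin 2) : SimWire α β w p → Fin 2 :=
  Sum.elim u (Sum.elim v (Sum.elim (fun t => oneHot (d t.1) t.2)
    (Sum.elim (fun t => oneHot (z t.1 t.2.1) t.2.2) k)))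

/-- The encoded basis states of the qudits. -/
def encWire (α β : Type*) (x : Basis p w) : SimWire α β w p → Fin 2 :=
  simLabel 0 0 (fun i => some (x i)) (fun _ _ => none) 0

/-- The encoded contents of the registers. -/
def encReg (s : Basis p c) : SimReg c p → Fin 2 :=
  Sum.elim (fun t => oneHot (some (s t.1)) t.2) 0

/-- Blocks that contain `x i` at the position given by `n i`. -/
def select (x n : Basis p w) (i : Fin w) (t : Fin p) : Option (Fin p) :=
  if t = n i then some (x i) else none

/-- Block `(i, t)` always applies `U i ^ t`, and empty blocks stay empty. Placing the qudit into
block `n i` thus selects the power: control of the gate is replaced by control of the routing. -/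
lemma perSite_select [Nontrivial (Fin p)] (U : Fin w → Matrix (Fin p) (Fin p) ℂ)
    (x n : Basis p w) :
    perSite (fun (_ : Fin w × Fin p → Option (Fin p)) b => optLift (U b.1 ^ (b.2 : ℕ))) *ᵥ
        ket (fun b => select x n b.1 b.2) =
      ∑ x' : Basis p w, (∏ i, (U i ^ (n i : ℕ)) (x' i) (x i)) •
        ket fun b : Fin w × Fin p => select x' n b.1 b.2 := by
  ext o
  rw [mulVec_ket_apply, perSite_apply]
  simp only [Finset.sum_apply, Pi.smul_apply, ket_apply, smul_eq_mul, mul_ite, mul_one, mul_zero]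
  by_cases ho : ∃ x' : Basis p w, o = fun b => select x' n b.1 b.2
  · obtain ⟨x', rfl⟩ := ho
    rw [Finset.sum_eq_single x', if_pos rfl, Fintype.prod_prod_type]
    · refine Finset.prod_congr rfl fun i _ => ?_
      rw [Fintype.prod_eq_single (n i)]
      · simp [select]
      · intro t ht; simp [select, ht]
    · intro x'' _ hne
      rw [if_neg]
      intro h
      apply hne
      funext i
      simpa [select] using (congrFun h (i, n i)).symm
    · simp
  · rw [Finset.sum_eq_zero]
    · by_contra hne
      have hne := Finset.prod_ne_zero_iff.1 hne
      apply ho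
      have h1 : ∀ i, ∃ v, o (i, n i) = some v := by
        intro i
        have := hne (i, n i) (Finset.mem_univ _)
        cases h : o (i, n i) with
        | none => simp [h, select] at this
        | some v => exact ⟨v, rfl⟩
      choose x' hx' using h1
      refine ⟨x', funext fun b => ?_⟩
      obtain ⟨i, t⟩ := b
      by_cases ht : t = n i
      · subst ht; simp [select, hx']
      · have := hne (i, t) (Finset.mem_univ _)
        cases h : o (i, t) with
        | none => simp [select, ht]
        | some v => simp [h, select, ht] at this
    · intro x' _
      rw [if_neg]
      intro h; exact ho ⟨x', h⟩

variable {W C : ℕ} {G : GateSet} {ι : SimWire α β w p ↪ Fin W} {κ : SimReg c p ↪ Fin C}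

/-- The wires of the blocks. -/
def blockEmb (α β : Type*) (w p : ℕ) : (Fin w × Fin p) × Fin p ↪ SimWire α β w p :=
  ⟨fun t => .inr (.inr (.inr (.inl (t.1.1, t.1.2, t.2)))), fun t t' h => by
    simp only [Sum.inr.injEq, Sum.inl.injEq, Prod.mk.injEq] at h
    exact Prod.ext (Prod.ext h.1 h.2.1) h.2.2⟩

lemma exists_impl_powers [Nontrivial (Fin p)] (U : Fin w → Matrix.unitaryGroup (Fin p) ℂ) :
    ∃ V, Impl G ι κ (3 * (p * (p + 1))) V ∧ ∀ s d k (x n : Basis p w),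
      V s *ᵥ ket (simLabel 0 0 d (select x n) k) =
        ∑ x' : Basis p w, (∏ i, ((U i : Matrix (Fin p) (Fin p) ℂ) ^ (n i : ℕ)) (x' i) (x i)) •
          ket (simLabel 0 0 d (select x' n) k) := by
  obtain ⟨V, hV, h⟩ := exists_impl_blocks (G := G) (ιW := ι) (κ := κ) (blockEmb α β w p)
    fun b => U b.1 ^ (b.2 : ℕ)
  refine ⟨V, by simpa using hV, fun s d k x n => ?_⟩
  have hfill : ∀ x' : Basis p w, simLabel 0 0 d (select x' n) k =
      fill (blockEmb α β w p) (simLabel 0 0 d (fun _ _ => none) k)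
        fun b => oneHot (select x' n b.1 b.2) := by
    intro x'
    apply fill_ext
    · rintro ⟨i, t⟩ v; rfl
    · rintro (j | j | j | ⟨i, t, v⟩ | j) hw
      · rfl
      · rfl
      · rfl
      · exact absurd rfl (hw (i, t) v)
      · rfl
  have := congrArg (fun M => M *ᵥ ket fun b => select x n b.1 b.2)
    (h s (simLabel 0 0 d (fun _ _ => none) k))
  simp only [← Matrix.mulVec_mulVec, relabel_mulVec_ket] at this
  rw [hfill, this]
  have hsel := perSite_select (fun i => (U i : Matrix (Fin p) (Fin p) ℂ)) x n
  refine (congrArg _ hsel).trans ?_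
  simp only [Matrix.mulVec_sum, Matrix.mulVec_smul, relabel_mulVec_ket, hfill]

/-- Is the classical control of the gate with the given target satisfied? -/
def condBit (cond : Fin w → Option (Fin c × Fin p)) (s : Basis p c) (i : Fin w) : Fin 2 :=
  if ∀ r v, cond i = some (r, v) → s r = v then 1 else 0

/-- The classical condition is copied to a qubit so that the oracle can read it together with the
quantum controls. The same layer clears it later. -/
lemma exists_impl_cond (cond : Fin w → Option (Fin c × Fin p)) :
    ∃ V, Impl G ι κ 1 V ∧ ∀ s d z,
      V (encReg s) *ᵥ ket (simLabel 0 0 d z 0) = ket (simLabel 0 0 d z (condBit cond s)) ∧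
      V (encReg s) *ᵥ ket (simLabel 0 0 d z (condBit cond s)) = ket (simLabel 0 0 d z 0) := by
  have hinj : Function.Injective fun i : Fin w =>
      (.inr (.inr (.inr (.inr i))) : SimWire α β w p) := fun i j h => by simpa using h
  let L : LayerSpec (SimWire α β w p) (SimReg c p) := LayerSpec.ofFamily _ hinj
    (fun i => ⟨(cond i).map fun rv => (.inl rv, 1), none, pauliX⟩)
    (by intro b b' j hj; simp at hj) (by intro b b' j hj hj'; simp at hj)
  have hact : ∀ s i y, (⟨(cond i).map fun rv => (.inl rv, 1), none, pauliX⟩ :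
      WireGate (SimWire α β w p) (SimReg c p)).act (encReg s) y =
      if condBit cond s i = 1 then (pauliX : Matrix (Fin 2) (Fin 2) ℂ) else 1 := by
    intro s i y
    have hiff : (∀ r v, ((cond i).map fun rv => ((.inl rv : SimReg c p), (1 : Fin 2))) =
        some (r, v) → encReg s r = v) ↔ ∀ r v, cond i = some (r, v) → s r = v := by
      constructor
      · intro h r v hrv
        have := h (.inl (r, v)) 1 (by rw [hrv]; rfl)
        simpa [encReg, oneHot] using this
      · intro h r v hrv
        obtain ⟨⟨r', v'⟩, h1, h2⟩ := Option.map_eq_some_iff.1 hrv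
        simp only [Prod.mk.injEq] at h2
        rw [← h2.1, ← h2.2]
        simp [encReg, oneHot, h r' v' h1]
    by_cases h : ∀ r v, cond i = some (r, v) → s r = v
    · rw [WireGate.act, if_pos (hiff.2 h), condBit, if_pos h, if_pos rfl]
    · rw [WireGate.act, if_neg (mt hiff.1 h), condBit, if_neg h, if_neg (by decide)]
  have hcases : ∀ b : Fin 2, b = 0 ∨ b = 1 := by decide
  refine ⟨_, L.impl, fun s d z => ⟨?_, ?_⟩⟩
  · apply LayerSpec.ofFamily_mulVec_ket_perm
    · intro i a
      rw [hact]
      rcases hcases (condBit cond s i) with h | h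
      · simp only [h, simLabel, Sum.elim_inr, Pi.zero_apply, zero_ne_one, if_false,
          Matrix.one_apply]
      · simp only [h, simLabel, Sum.elim_inr, Pi.zero_apply, if_true, pauliX_apply]
        rfl
    · rintro (j | j | j | j | j) hj
      · rfl
      · rfl
      · rfl
      · rfl
      · exact absurd rfl (hj j)
  · apply LayerSpec.ofFamily_mulVec_ket_perm
    · intro i a
      rw [hact]
      rcases hcases (condBit cond s i) with h | h
      · simp only [h, simLabel, Sum.elim_inr, Pi.zero_apply, zero_ne_one, if_false,
          Matrix.one_apply]
        rfl
      · simp only [h, simLabel, Sum.elim_inr, Pi.zero_apply, if_true, pauliX_apply]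
        rfl
    · rintro (j | j | j | j | j) hj
      · rfl
      · rfl
      · rfl
      · rfl
      · exact absurd rfl (hj j)

end Simulation

section Simulation

variable {α β : Type*} [Fintype α] [DecidableEq α] [Fintype β] [DecidableEq β] {w c p : ℕ}
  {W C : ℕ} {G : GateSet} {ι : SimWire α β w p ↪ Fin W} {κ : SimReg c p ↪ Fin C} {m m₀ n : ℕ}

lemma oneHot_add_self {ι : Type*} [DecidableEq ι] (o : Option ι) (v : ι) :
    oneHot o v + oneHot o v = 0 := by
  unfold oneHot; split_ifs <;> rfl

/-- The weights with which the oracle reads the qudits. -/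
def gateWeight (m₀ : ℕ) (wt : Fin w → Fin w → Fin p → ℕ) :
    SimWire α β w p → SimWire α β w p → ℕ :=
  Sum.elim 0 (Sum.elim 0 (Sum.elim 0 (Sum.elim
    (fun t => Sum.elim 0 (Sum.elim 0 (Sum.elim
      (fun t' => wt t.1 t'.1 t'.2 + if t'.1 = t.1 ∧ t'.2 = t.2.2 then 2 * 2 ^ m₀ else 0)
      (Sum.elim 0 fun i => if i = t.1 then 2 ^ m₀ else 0)))) 0)))

/-- The function of the weighted sum that the oracle computes. -/
def gateFun (m₀ : ℕ) (f : Fin w → ℕ → Fin p) [NeZero p] : SimWire α β w p → ℕ → Bool :=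
  Sum.elim (fun _ _ => false) (Sum.elim (fun _ _ => false) (Sum.elim (fun _ _ => false) (Sum.elim
    (fun t h => decide (h / (2 * 2 ^ m₀) = 1 ∧
      (if h / 2 ^ m₀ % 2 = 1 then f t.1 (h % 2 ^ m₀) else 0) = t.2.1)) fun _ _ => false)))

/-- The number of times that the unitaries are applied. -/
def powers [NeZero p] (wt : Fin w → Fin w → Fin p → ℕ) (f : Fin w → ℕ → Fin p) (k : Fin w → Fin 2)
    (x : Basis p w) (i : Fin w) : Fin p :=
  if k i = 1 then f i (∑ j, wt i j (x j)) else 0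

/-- One number packs three fields: the sum of the controls below `2 ^ m₀`, the condition bit at `2 ^
m₀`, and at `2 * 2 ^ m₀` the test whether the qudit has the value `v`. Hence `m = m₀ + 2` suffices,
and `gateFun` unpacks the fields; an unsatisfied condition selects the power `0`. -/
lemma weight_gateWeight (wt : Fin w → Fin w → Fin p → ℕ) (x : Basis p w)
    (z : Fin w → Fin p → Option (Fin p)) (k : Fin w → Fin 2) (i : Fin w) (t v : Fin p) :
    weight (gateWeight m₀ wt) (.inr (.inr (.inr (.inl (i, t, v)))) : SimWire α β w p)
      (simLabel 0 0 (fun i => some (x i)) z k) =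
      (∑ j, wt i j (x j)) + (if x i = v then 2 * 2 ^ m₀ else 0) + 2 ^ m₀ * (k i : ℕ) := by
  simp only [weight, gateWeight, simLabel, Fintype.sum_sum_type, Sum.elim_inl, Sum.elim_inr,
    Pi.zero_apply, zero_mul, Finset.sum_const_zero, zero_add, add_mul, Finset.sum_add_distrib,
    ite_mul, Finset.sum_ite_eq', Finset.mem_univ, if_true]
  congr 2
  · rw [Fintype.sum_prod_type]
    refine Finset.sum_congr rfl fun j _ => ?_
    rw [Fintype.sum_eq_single (x j)]
    · simp [oneHot]
    · intro v' hv'; simp [oneHot, hv'.symm]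
  · rw [Fintype.sum_eq_single (i, v)]
    · simp only [oneHot, Option.some.injEq, and_self, if_true]
      split_ifs <;> simp
    · rintro ⟨j, v'⟩ hne
      rw [if_neg]
      rintro ⟨rfl, rfl⟩
      exact hne rfl

lemma flips_gate [NeZero p] (hm : m = m₀ + 2) (wt : Fin w → Fin w → Fin p → ℕ)
    (f : Fin w → ℕ → Fin p)
    (x : Basis p w) (hx : ∀ i, ∑ j, wt i j (x j) < 2 ^ m₀)
    (z : Fin w → Fin p → Option (Fin p)) (k : Fin w → Fin 2) :
    flips m (gateWeight m₀ wt) (gateFun m₀ f)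
      (Finset.univ.map (blockEmb α β w p)) (simLabel 0 0 (fun i => some (x i)) z k) =
      simLabel 0 0 (fun _ => none) (select x (powers wt f k x)) 0 := by
  have hnm : ∀ j : SimWire α β w p, (∀ t, blockEmb α β w p t ≠ j) →
      j ∉ Finset.univ.map (blockEmb α β w p) := by
    intro j hj h
    obtain ⟨t, -, ht⟩ := Finset.mem_map.1 h
    exact hj t ht
  funext j
  rcases j with (j | j | j | ⟨i, t, v⟩ | j)
  · rw [flips, if_neg fun h => hnm _ (by intro t h; cases h) h.1]; rfl
  · rw [flips, if_neg fun h => hnm _ (by intro t h; cases h) h.1]; rfl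
  · rw [flips, if_neg fun h => hnm _ (by intro t h; cases h) h.1]; rfl
  · have hmem : (.inr (.inr (.inr (.inl (i, t, v)))) : SimWire α β w p) ∈
        Finset.univ.map (blockEmb α β w p) :=
      Finset.mem_map.2 ⟨((i, t), v), Finset.mem_univ _, rfl⟩
    rw [flips, weight_gateWeight]
    have hS := hx i
    set S := ∑ j, wt i j (x j)
    have hM : 0 < 2 ^ m₀ := by positivity
    set M := 2 ^ m₀
    have h4 : 2 ^ m = 4 * M := by rw [hm, pow_add]; ring
    have hk : (k i : ℕ) < 2 := (k i).2
    have hcond : (gateFun m₀ f (.inr (.inr (.inr (.inl (i, t, v)))) : SimWire α β w p)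
        ((S + (if x i = v then 2 * M else 0) + M * (k i : ℕ)) % 2 ^ m) = true) ↔
        x i = v ∧ powers wt f k x i = t := by
      have hlt : S + (if x i = v then 2 * M else 0) + M * (k i : ℕ) < 2 ^ m := by
        rw [h4]
        have : M * (k i : ℕ) ≤ M := by nlinarith
        split_ifs <;> omega
      rw [Nat.mod_eq_of_lt hlt]
      simp only [gateFun, Sum.elim_inr, Sum.elim_inl, decide_eq_true_eq, powers]
      have e1 : (S + (if x i = v then 2 * M else 0) + M * (k i : ℕ)) / (2 * M) = 1 ↔ x i = v := by
        have hle : M * (k i : ℕ) ≤ M := by nlinarith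
        split_ifs with h
        · simp only [h, iff_true]
          rw [Nat.div_eq_iff (by omega)]; omega
        · simp only [h, iff_false]
          rw [Nat.div_eq_of_lt (by omega)]; omega
      have e2 : (S + (if x i = v then 2 * M else 0) + M * (k i : ℕ)) % M = S := by
        rw [Nat.add_mul_mod_self_left]
        split_ifs
        · rw [mul_comm, Nat.add_mul_mod_self_left, Nat.mod_eq_of_lt hS]
        · rw [add_zero, Nat.mod_eq_of_lt hS]
      have e3 : (S + (if x i = v then 2 * M else 0) + M * (k i : ℕ)) / M % 2 = (k i : ℕ) := by
        rw [Nat.add_mul_div_left _ _ hM]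
        split_ifs
        · rw [mul_comm 2 M, Nat.add_mul_div_left _ _ hM, Nat.div_eq_of_lt hS]; omega
        · rw [add_zero, Nat.div_eq_of_lt hS]; omega
      rw [e1, e2, e3]
      have : ((k i : ℕ) = 1) ↔ k i = 1 := by rw [Fin.ext_iff]; rfl
      simp only [this]
      rfl
    simp only [hmem, true_and, hcond, simLabel, Sum.elim_inr, Sum.elim_inl, oneHot, select]
    by_cases h1 : x i = v <;> by_cases h2 : powers wt f k x i = t
    · simp [h1, h2]
    · simp [h1, h2, Ne.symm h2]
    · simp [h1, h2]
    · simp [h1, h2, Ne.symm h2]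
  · rw [flips, if_neg fun h => hnm _ (by intro t h; cases h) h.1]; rfl

/-- The weights with which the oracle reads the blocks. -/
def gatherWeight : SimWire α β w p → SimWire α β w p → ℕ :=
  Sum.elim 0 (Sum.elim 0 (Sum.elim
    (fun t => Sum.elim 0 (Sum.elim 0 (Sum.elim 0 (Sum.elim
      (fun t' => if t'.1 = t.1 ∧ t'.2.2 = t.2 then 1 else 0) 0)))) 0))

/-- The one-hot wires. -/
def dataEmb (α β : Type*) (w p : ℕ) : Fin w × Fin p ↪ SimWire α β w p :=
  ⟨fun t => .inr (.inr (.inl t)), fun t t' h => by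
    simpa only [Sum.inr.injEq, Sum.inl.injEq] using h⟩

/-- Of all blocks of qudit `i` one is filled, so adding over `t` reads off its value without
knowledge of `n`. This erases the data wires after the routing and restores them after the
unitaries. -/
lemma flips_gather (hm : 1 ≤ m) (x n : Basis p w) (d : Fin w → Option (Fin p))
    (k : Fin w → Fin 2) :
    flips m gatherWeight (fun _ h => decide (h = 1))
      (Finset.univ.map (dataEmb α β w p)) (simLabel 0 0 d (select x n) k) =
      simLabel 0 0 (fun i => some (x i)) (fun _ _ => none) 0 := by
  have hnm : ∀ j : SimWire α β w p, (∀ t, dataEmb α β w p t ≠ j) →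
      j ∉ Finset.univ.map (dataEmb α β w p) := by
    intro j hj h
    obtain ⟨t, -, ht⟩ := Finset.mem_map.1 h
    exact hj t ht
  have h1m : 1 < 2 ^ m := Nat.one_lt_two_pow (by omega)
  funext j
  rcases j with (j | j | ⟨i, v⟩ | j | j)
  · rw [flips, if_neg fun h => hnm _ (by intro t h; cases h) h.1]; rfl
  · rw [flips, if_neg fun h => hnm _ (by intro t h; cases h) h.1]; rfl
  · have hmem : (.inr (.inr (.inl (i, v))) : SimWire α β w p) ∈
        Finset.univ.map (dataEmb α β w p) :=
      Finset.mem_map.2 ⟨(i, v), Finset.mem_univ _, rfl⟩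
    have hw : weight gatherWeight (.inr (.inr (.inl (i, v))) : SimWire α β w p)
        (simLabel 0 0 d (select x n) k) = if x i = v then 1 else 0 := by
      simp only [weight, gatherWeight, simLabel, Fintype.sum_sum_type, Sum.elim_inl, Sum.elim_inr,
        Pi.zero_apply, zero_mul, Finset.sum_const_zero, zero_add, add_zero]
      rw [Fintype.sum_eq_single (i, n i, v)]
      · simp only [select, oneHot, and_self, if_true, one_mul, Option.some.injEq]
        split_ifs <;> rfl
      · rintro ⟨i', t, v'⟩ hne
        by_cases h : i' = i ∧ v' = v
        · obtain ⟨rfl, rfl⟩ := h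
          have : t ≠ n i' := by rintro rfl; exact hne rfl
          simp [select, oneHot, this]
        · simp [h]
    rw [flips, hw]
    simp only [hmem, true_and, decide_eq_true_eq, simLabel, Sum.elim_inr, Sum.elim_inl, oneHot,
      Option.some.injEq]
    by_cases h : x i = v
    · simp [h, Nat.mod_eq_of_lt h1m]
    · simp [h]
  · rw [flips, if_neg fun h => hnm _ (by intro t h; cases h) h.1]; rfl
  · rw [flips, if_neg fun h => hnm _ (by intro t h; cases h) h.1]; rfl

end Simulation

section Simulation

variable {α β : Type*} [Fintype α] [DecidableEq α] [Fintype β] [DecidableEq β] {w c p : ℕ}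
  {W C : ℕ} {G : GateSet} {ι : SimWire α β w p ↪ Fin W} {κ : SimReg c p ↪ Fin C} {m m₀ n : ℕ}

@[simp] lemma oneHot_none {ι : Type*} [DecidableEq ι] (v : ι) : oneHot none v = 0 := by
  simp [oneHot]

lemma simLabel_add_blocks (d : Fin w → Option (Fin p)) (z : Fin w → Fin p → Option (Fin p))
    (k : Fin w → Fin 2) :
    (simLabel 0 0 d (fun _ _ => none) k + simLabel 0 0 (fun _ => none) z 0 :
      SimWire α β w p → Fin 2) = simLabel 0 0 d z k ∧
    (simLabel 0 0 d z k + simLabel 0 0 (fun _ => none) z 0 :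
      SimWire α β w p → Fin 2) = simLabel 0 0 d (fun _ _ => none) k := by
  constructor <;> funext j <;> rcases j with (j | j | j | j | j) <;>
    simp [simLabel, oneHot_add_self]

lemma simLabel_add_data (d : Fin w → Option (Fin p)) (z : Fin w → Fin p → Option (Fin p))
    (k : Fin w → Fin 2) :
    (simLabel 0 0 (fun _ => none) z k + simLabel 0 0 d (fun _ _ => none) 0 :
      SimWire α β w p → Fin 2) = simLabel 0 0 d z k ∧
    (simLabel 0 0 d z k + simLabel 0 0 d (fun _ _ => none) 0 :
      SimWire α β w p → Fin 2) = simLabel 0 0 (fun _ => none) z k := by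
  constructor <;> funext j <;> rcases j with (j | j | j | j | j) <;>
    simp [simLabel, oneHot_add_self]

/-- The simulation of a layer of possibly controlled powers of unitaries. -/
theorem reach_powers [NeZero p] [Nontrivial (Fin p)] (hO : HasOracle G ι κ m n)
    (hm : m = m₀ + 2) (U : Fin w → Matrix.unitaryGroup (Fin p) ℂ)
    (cond : Fin w → Option (Fin c × Fin p)) (wt : Fin w → Fin w → Fin p → ℕ)
    (f : Fin w → ℕ → Fin p) (hwt : ∀ i (x : Basis p w), ∑ j, wt i j (x j) < 2 ^ m₀)
    (hinv : ∀ k (x x' : Basis p w), (∀ i, ((U i : Matrix (Fin p) (Fin p) ℂ) ^ (powers wt f k x i : ℕ))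
      (x' i) (x i) ≠ 0) → powers wt f k x' = powers wt f k x) :
    Reach G (4 * n + 3 * (p * (p + 1)) + 2)
      (fun σ : HybridState p w c => ext ι κ (push encReg (encWire α β) σ))
      (fun σ => ext ι κ (push encReg (encWire α β) (conjBy (fun s => perSite fun x i =>
        (U i : Matrix (Fin p) (Fin p) ℂ) ^ (powers wt f (condBit cond s) x i : ℕ)) σ))) := by
  obtain ⟨VK, hVK, hK⟩ := exists_impl_cond (G := G) (ι := ι) (κ := κ) cond
  obtain ⟨VB, hVB, hB⟩ := exists_impl_powers (G := G) (ι := ι) (κ := κ) U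
  have hZ := hO (gateWeight m₀ wt) (gateFun m₀ f) (Finset.univ.map (blockEmb α β w p)) (by
    intro z j hj
    obtain ⟨t, -, rfl⟩ := Finset.mem_map.1 hj
    rcases z with (z | z | z | z | z) <;> rfl)
  have hD := hO gatherWeight (fun _ h => decide (h = 1)) (Finset.univ.map (dataEmb α β w p)) (by
    intro z j hj
    obtain ⟨t, -, rfl⟩ := Finset.mem_map.1 hj
    rcases z with (z | z | z | z | z) <;> rfl)
  -- Set the condition bits, copy the data into the selected blocks, erase the original, apply the
  -- powers, write the new data back, empty the blocks, clear the condition bits.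
  have h := ((((((hVK.mul hZ).mul hD).mul hVB).mul hD).mul hZ).mul hVK).mono
    (n' := 4 * n + 3 * (p * (p + 1)) + 2) (by omega)
  refine (Reach.comp h fun σ : HybridState p w c => push encReg (encWire α β) σ).congr
    (fun _ => rfl) fun σ => ?_
  congr 1
  symm
  apply conjBy_push
  intro s
  refine matrix_ext_ket fun x => ?_
  set k := condBit cond s
  have s1 : ∀ x' : Basis p w, (relabel fun y => y + flips m (gateWeight m₀ wt) (gateFun m₀ f)
      (Finset.univ.map (blockEmb α β w p)) y) *ᵥ
      ket (simLabel 0 0 (fun i => some (x' i)) (fun _ _ => none) k) =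
      ket (simLabel 0 0 (fun i => some (x' i)) (select x' (powers wt f k x')) k) := by
    intro x'
    rw [relabel_mulVec_ket, flips_gate hm wt f x' (fun i => hwt i x'), (simLabel_add_blocks _ _ _).1]
  have s1' : ∀ x' : Basis p w, (relabel fun y => y + flips m (gateWeight m₀ wt) (gateFun m₀ f)
      (Finset.univ.map (blockEmb α β w p)) y) *ᵥ
      ket (simLabel 0 0 (fun i => some (x' i)) (select x' (powers wt f k x')) k) =
      ket (simLabel 0 0 (fun i => some (x' i)) (fun _ _ => none) k) := by
    intro x'
    rw [relabel_mulVec_ket, flips_gate hm wt f x' (fun i => hwt i x'), (simLabel_add_blocks _ _ _).2]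
  have s2 : ∀ x' n' : Basis p w, (relabel fun y => y + flips m gatherWeight
      (fun _ h => decide (h = 1)) (Finset.univ.map (dataEmb α β w p)) y) *ᵥ
      ket (simLabel 0 0 (fun i => some (x' i)) (select x' n') k) =
      ket (simLabel 0 0 (fun _ => none) (select x' n') k) := by
    intro x' n'
    rw [relabel_mulVec_ket, flips_gather (by omega) x' n', (simLabel_add_data _ _ _).2]
  have s2' : ∀ x' n' : Basis p w, (relabel fun y => y + flips m gatherWeight
      (fun _ h => decide (h = 1)) (Finset.univ.map (dataEmb α β w p)) y) *ᵥ
      ket (simLabel 0 0 (fun _ => none) (select x' n') k) =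
      ket (simLabel 0 0 (fun i => some (x' i)) (select x' n') k) := by
    intro x' n'
    rw [relabel_mulVec_ket, flips_gather (by omega) x' n', (simLabel_add_data _ _ _).1]
  simp only [← Matrix.mulVec_mulVec, relabel_mulVec_ket (encWire α β)]
  rw [encWire, (hK s _ _).1, s1, s2, hB, mulVec_ket_sum (perSite _)]
  simp only [Matrix.mulVec_sum, Matrix.mulVec_smul, s2', relabel_mulVec_ket (encWire α β)]
  refine Finset.sum_congr rfl fun x' _ => ?_
  -- The blocks are emptied by recomputing the powers from the new data `x'`. Branches of zero
  -- amplitude do not matter, and in the others `hinv` gives the same powers.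
  by_cases h0 : ∏ i, ((U i : Matrix (Fin p) (Fin p) ℂ) ^ (powers wt f k x i : ℕ)) (x' i) (x i) = 0
  · rw [h0, zero_smul, perSite_apply, h0, zero_smul]
  · rw [← hinv k x x' fun i => Finset.prod_ne_zero_iff.1 h0 i (Finset.mem_univ _), s1', (hK s _ _).2,
      hinv k x x' fun i => Finset.prod_ne_zero_iff.1 h0 i (Finset.mem_univ _)]
    rfl

end Simulation

/-! ### Quantum gates as powers selected by weighted sums. -/

section QuantumLayer

variable {w c p : ℕ} [NeZero p]

lemma val_one_of_nontrivial [Nontrivial (Fin p)] : ((1 : Fin p) : ℕ) = 1 := by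
  have h : 2 ≤ p := Fin.nontrivial_iff_two_le.1 inferInstance
  have : ((1 : Fin p) : ℕ) = 1 % p := Fin.val_one' p
  rw [this, Nat.mod_eq_of_lt (by omega)]

/-- The shift as a unitary. -/
def shiftUnitary (p : ℕ) [NeZero p] : Matrix.unitaryGroup (Fin p) ℂ :=
  ⟨shiftX p, by
    rw [Matrix.mem_unitaryGroup_iff']
    ext x y
    simp only [Matrix.star_eq_conjTranspose, Matrix.mul_apply, Matrix.conjTranspose_apply, shiftX,
      Matrix.of_apply, Matrix.one_apply]
    simp only [apply_ite star, star_one, star_zero, ite_mul, one_mul, zero_mul,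
      Finset.sum_ite_eq', Finset.mem_univ, if_true, add_left_inj]⟩

/-- The wire that a gate changes. -/
def QGate.target : QGate p w → Fin w
  | .single i _ => i
  | .ctrl _ i _ _ => i
  | .multiCtrl _ _ i _ _ => i
  | .threshold _ i _ _ => i

/-- The unitary that a gate applies to its target. -/
def QGate.unitary : QGate p w → Matrix.unitaryGroup (Fin p) ℂ
  | .single _ U => U
  | .ctrl _ _ _ U => U
  | .multiCtrl _ _ _ _ U => U
  | .threshold _ _ _ _ => shiftUnitary p

/-- The weights of the controls of a gate. -/
def QGate.weight : QGate p w → Fin w → Fin p → ℕ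
  | .single _ _ => fun _ _ => 0
  | .ctrl j _ _ _ => fun j' v => if j' = j then v else 0
  | .multiCtrl T a _ _ _ => fun j v => if j ∈ T ∧ v = a j then 1 else 0
  | .threshold T _ _ _ => fun j v => if j ∈ T then v else 0

/-- The power of the unitary as a function of the weight. -/
def QGate.power : QGate p w → ℕ → Fin p
  | .single _ _ => fun _ => 1
  | .ctrl _ _ _ _ => fun h => Fin.ofNat p h
  | .multiCtrl T _ _ _ _ => fun h => if h = T.card then 1 else 0
  | .threshold _ _ _ t => fun h => if t ≤ h then 1 else 0

lemma QGate.target_mem_support (g : QGate p w) : g.target ∈ g.support := by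
  cases g <;> simp [QGate.target, QGate.support]

lemma QGate.weight_eq_zero (g : QGate p w) {j : Fin w} (hj : j ∉ g.support ∨ j = g.target)
    (v : Fin p) : g.weight j v = 0 := by
  cases g with
  | single => rfl
  | ctrl j' i h U =>
    simp only [QGate.weight]
    rw [if_neg]
    rintro rfl
    rcases hj with hj | hj
    · simp [QGate.support] at hj
    · exact h hj
  | multiCtrl T a i hi U =>
    simp only [QGate.weight]
    rw [if_neg]
    rintro ⟨hT, -⟩
    rcases hj with hj | hj
    · simp [QGate.support, hT] at hj
    · subst hj; exact hi hT
  | threshold T i hi t =>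
    simp only [QGate.weight]
    rw [if_neg]
    intro hT
    rcases hj with hj | hj
    · simp [QGate.support, hT] at hj
    · subst hj; exact hi hT

lemma QGate.weight_le (g : QGate p w) (j : Fin w) (v : Fin p) : g.weight j v ≤ p := by
  have hp : 1 ≤ p := NeZero.one_le
  have hv := v.2
  cases g <;> simp only [QGate.weight] <;> try split_ifs
  all_goals omega

/-- All kinds of gates fit one pattern. The weight of a multiply controlled gate counts its
satisfied controls and is compared with their number; the weight of a single control is already the
exponent, below `p`. -/
lemma QGate.toOp_eq [Nontrivial (Fin p)] (g : QGate p w) :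
    g.toOp = onT g.target fun y =>
      (g.unitary : Matrix (Fin p) (Fin p) ℂ) ^ (g.power (∑ j, g.weight j (y j)) : ℕ) := by
  cases g with
  | single i U =>
    simp only [QGate.toOp, QGate.target, QGate.unitary, QGate.power, onTarget_eq_onT,
      val_one_of_nontrivial, pow_one]
  | ctrl j i h U =>
    simp only [QGate.toOp, QGate.target, QGate.unitary, QGate.power, onTarget_eq_onT,
      QGate.weight, Finset.sum_ite_eq', Finset.mem_univ, if_true, Fin.val_ofNat,
      Nat.mod_eq_of_lt (Fin.is_lt _)]
  | multiCtrl T a i hi U =>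
    simp only [QGate.toOp, QGate.target, QGate.unitary, QGate.power, onTarget_eq_onT]
    congr 1
    funext y
    have h : (∑ j, if j ∈ T ∧ y j = a j then 1 else 0) = T.card ↔ ∀ j ∈ T, y j = a j := by
      rw [Finset.sum_boole, Nat.cast_id, ← Finset.filter_filter, Finset.filter_univ_mem,
        Finset.card_filter_eq_iff]
    have h' : (∑ j, (QGate.multiCtrl T a i hi U).weight j (y j)) = T.card ↔
        ∀ j ∈ T, y j = a j := h
    by_cases hT : ∀ j ∈ T, y j = a j
    · rw [if_pos hT, if_pos (h'.2 hT), val_one_of_nontrivial, pow_one]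
    · rw [if_neg hT, if_neg (mt h'.1 hT)]; simp
  | threshold T i hi t =>
    simp only [QGate.toOp, QGate.target, QGate.unitary, QGate.power, onTarget_eq_onT,
      QGate.weight, Finset.sum_ite_mem, Finset.univ_inter]
    congr 1
    funext y
    split_ifs
    · rw [val_one_of_nontrivial, pow_one]; rfl
    · simp

variable (gs : List (Option (Fin c × Fin p) × QGate p w))

/-- The gate of a layer with a given target. -/
def gateAt (i : Fin w) : Option (Option (Fin c × Fin p) × QGate p w) :=
  gs.find? fun g => g.2.target = i

variable {gs}

lemma prod_map_gateAt {N : Type*} [Monoid N]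
    (hgs : gs.Pairwise fun g h => g.2.target ≠ h.2.target)
    (F : Option (Fin c × Fin p) × QGate p w → N) (i : Fin w) :
    (gs.map fun g => if i = g.2.target then F g else 1).prod = (gateAt gs i).elim 1 F := by
  cases h : gateAt gs i with
  | none =>
    rw [gateAt, List.find?_eq_none] at h
    refine List.prod_eq_one fun m hm => ?_
    obtain ⟨g, hg, rfl⟩ := List.mem_map.1 hm
    rw [if_neg]
    intro hi
    simpa [hi] using h g hg
  | some g =>
    have h1 := List.find?_some h
    simp only [decide_eq_true_eq] at h1
    rw [← h1]
    exact prod_map_ite gs (fun g => g.2.target) hgs F g (List.mem_of_find?_eq_some h)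

lemma disjoint_support (hgs : gs.Pairwise fun g h => Disjoint g.2.support h.2.support)
    {g h : Option (Fin c × Fin p) × QGate p w} (hg : g ∈ gs) (hh : h ∈ gs) (hne : g ≠ h) :
    Disjoint g.2.support h.2.support :=
  haveI : Std.Symm fun g h : Option (Fin c × Fin p) × QGate p w =>
    Disjoint g.2.support h.2.support := ⟨fun _ _ h => h.symm⟩
  hgs.forall hg hh hne

lemma gateAt_eq_none (hgs : gs.Pairwise fun g h => Disjoint g.2.support h.2.support)
    {g : Option (Fin c × Fin p) × QGate p w} (hg : g ∈ gs) {j : Fin w}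
    (hj : j ∈ g.2.support) (hj' : j ≠ g.2.target) : gateAt gs j = none := by
  cases h : gateAt gs j with
  | none => rfl
  | some g' =>
    exfalso
    have h1 := List.find?_some h
    simp only [decide_eq_true_eq] at h1
    have hne : g ≠ g' := by rintro rfl; exact hj' h1.symm
    have hd := disjoint_support hgs hg (List.mem_of_find?_eq_some h) hne
    exact Finset.disjoint_left.1 hd hj (h1 ▸ g'.2.target_mem_support)

/-- The data of the simulation of a layer of quantum gates. -/
def layerWeight (gs : List (Option (Fin c × Fin p) × QGate p w)) (i : Fin w) :
    Fin w → Fin p → ℕ :=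
  (gateAt gs i).elim (fun _ _ => 0) fun g => g.2.weight

/-- The powers that a layer of quantum gates applies. -/
def layerPower (gs : List (Option (Fin c × Fin p) × QGate p w)) (i : Fin w) : ℕ → Fin p :=
  (gateAt gs i).elim (fun _ => 0) fun g => g.2.power

/-- The unitaries that a layer of quantum gates applies. -/
def layerUnitary (gs : List (Option (Fin c × Fin p) × QGate p w)) (i : Fin w) :
    Matrix.unitaryGroup (Fin p) ℂ :=
  (gateAt gs i).elim 1 fun g => g.2.unitary

/-- The classical controls of a layer of quantum gates. -/
def layerCond (gs : List (Option (Fin c × Fin p) × QGate p w)) (i : Fin w) :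
    Option (Fin c × Fin p) :=
  (gateAt gs i).bind fun g => g.1

lemma layerWeight_sum_le (i : Fin w) (x : Basis p w) :
    ∑ j, layerWeight gs i j (x j) ≤ w * p := by
  refine (Finset.sum_le_card_nsmul _ _ p fun j _ => ?_).trans (by simp)
  unfold layerWeight
  cases gateAt gs i with
  | none => simp
  | some g => exact g.2.weight_le _ _

/-- The weight of a gate depends on its controls only. Supports are disjoint, so no gate of the
layer targets a control, and a nonzero amplitude leaves idle wires unchanged. -/
lemma powers_layer_congr (hgs : gs.Pairwise fun g h => Disjoint g.2.support h.2.support)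
    (k : Fin w → Fin 2) (x x' : Basis p w)
    (h : ∀ i, ((layerUnitary gs i : Matrix (Fin p) (Fin p) ℂ) ^
      (powers (layerWeight gs) (layerPower gs) k x i : ℕ)) (x' i) (x i) ≠ 0) :
    powers (layerWeight gs) (layerPower gs) k x' = powers (layerWeight gs) (layerPower gs) k x := by
  have hx : ∀ i, gateAt gs i = none → x' i = x i := by
    intro i hi
    by_contra hne
    apply h i
    simp [layerUnitary, hi, Matrix.one_apply_ne hne]
  funext i
  unfold powers
  have hs : ∑ j, layerWeight gs i j (x' j) = ∑ j, layerWeight gs i j (x j) := by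
    refine Finset.sum_congr rfl fun j _ => ?_
    unfold layerWeight
    cases hi : gateAt gs i with
    | none => rfl
    | some g =>
      simp only [Option.elim_some]
      by_cases hj : j ∉ g.2.support ∨ j = g.2.target
      · rw [g.2.weight_eq_zero hj, g.2.weight_eq_zero hj]
      · push Not at hj
        rw [hx j (gateAt_eq_none hgs (List.mem_of_find?_eq_some hi) hj.1 hj.2)]
  rw [hs]

lemma prod_controlledOp [Nontrivial (Fin p)]
    (hgs : gs.Pairwise fun g h => Disjoint g.2.support h.2.support) (s : Basis p c) :
    (gs.map (controlledOp s)).prod = perSite fun x i =>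
      (layerUnitary gs i : Matrix (Fin p) (Fin p) ℂ) ^
        (powers (layerWeight gs) (layerPower gs) (condBit (layerCond gs) s) x i : ℕ) := by
  have ht : gs.Pairwise fun g h => g.2.target ≠ h.2.target := by
    refine hgs.imp fun {g h} hd he => ?_
    exact Finset.disjoint_left.1 hd g.2.target_mem_support (he ▸ h.2.target_mem_support)
  have hop : ∀ g : Option (Fin c × Fin p) × QGate p w, controlledOp s g =
      onT g.2.target fun y => if ∀ r v, g.1 = some (r, v) → s r = v then
        (g.2.unitary : Matrix (Fin p) (Fin p) ℂ) ^ (g.2.power (∑ j, g.2.weight j (y j)) : ℕ)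
        else 1 := by
    rintro ⟨o, g⟩
    have h1 : onT (α := Fin p) g.target (fun _ => 1) = 1 := by
      rw [onT_eq_perSite]; simp [perSite_one]
    cases o with
    | none => simp [controlledOp, g.toOp_eq]
    | some rv =>
      obtain ⟨r, v⟩ := rv
      by_cases h : s r = v
      · subst h
        simp [controlledOp, g.toOp_eq]
      · simp [controlledOp, h, h1]
  have hfun : controlledOp s = _ := funext hop
  rw [hfun, prod_onT gs (fun g => g.2.target) _ ht]
  · congr 1
    funext x i
    rw [prod_map_gateAt ht]
    cases hi : gateAt gs i with
    | none =>
      have hU : layerUnitary gs i = 1 := by rw [layerUnitary, hi]; rfl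
      rw [hU]; simp
    | some g =>
      have hU : layerUnitary gs i = g.2.unitary := by rw [layerUnitary, hi]; rfl
      have hP : layerPower gs i = g.2.power := by rw [layerPower, hi]; rfl
      have hW : layerWeight gs i = g.2.weight := by rw [layerWeight, hi]; rfl
      have hC : layerCond gs i = g.1 := by rw [layerCond, hi]; rfl
      rw [Option.elim_some, powers, hU, hP, hW]
      by_cases h : ∀ r v, g.1 = some (r, v) → s r = v
      · rw [if_pos h, if_pos (by rw [condBit, hC, if_pos h])]
      · rw [if_neg h, if_neg (by rw [condBit, hC, if_neg h]; decide)]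
        simp
  · intro g hg x y hxy
    have : ∀ j, g.2.weight j (x j) = g.2.weight j (y j) := by
      intro j
      by_cases hj : j ∉ g.2.support
      · rw [g.2.weight_eq_zero (.inl hj), g.2.weight_eq_zero (.inl hj)]
      · push Not at hj
        rw [hxy j fun g' hg' hne he => ?_]
        have hd := disjoint_support hgs hg hg' hne.symm
        exact Finset.disjoint_left.1 hd hj (he ▸ g'.2.target_mem_support)
    simp only [this]

end QuantumLayer

/-! ### Simulation of quantum layers and measurements. -/

section Simulation

variable {α β : Type*} [Fintype α] [DecidableEq α] [Fintype β] [DecidableEq β] {w c p : ℕ}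
  {W C : ℕ} {G : GateSet} {ι : SimWire α β w p ↪ Fin W} {κ : SimReg c p ↪ Fin C} {m m₀ n : ℕ}
  [NeZero p] [Nontrivial (Fin p)]

lemma reach_quantum (hO : HasOracle G ι κ m n) (hm : m = m₀ + 2) (hw : w * p < 2 ^ m₀)
    (gs : List (Option (Fin c × Fin p) × QGate p w)) (hgs) :
    Reach G (4 * n + 3 * (p * (p + 1)) + 2)
      (fun σ : HybridState p w c => ext ι κ (push encReg (encWire α β) σ))
      (fun σ => ext ι κ (push encReg (encWire α β) ((Layer.quantum gs hgs).apply σ))) := by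
  refine (reach_powers hO hm (layerUnitary gs) (layerCond gs) (layerWeight gs) (layerPower gs)
    (fun i x => (layerWeight_sum_le i x).trans_lt hw)
    (fun k x x' h => powers_layer_congr hgs k x x' h)).congr (fun _ => rfl) fun σ => ?_
  simp only [Layer.quantum_apply, prod_controlledOp hgs]

/-- Measuring all `p` wires of a one-hot block reveals the value of the qudit and nothing else, and
the record is already the one-hot code of the register. -/
lemma reach_measure (mr : Fin c → Option (Fin w)) :
    Reach G 1
      (fun σ : HybridState p w c => ext ι κ (push encReg (encWire α β) σ))
      (fun σ => ext ι κ (push encReg (encWire α β) ((Layer.measure mr).apply σ))) := by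
  let m' : SimReg c p → Option (SimWire α β w p) :=
    Sum.elim (fun t => (mr t.1).map fun i => .inr (.inr (.inl (i, t.2)))) fun _ => none
  refine ((reach_meas (G := G) (ι := ι) (κ := κ) m').comp
    fun σ : HybridState p w c => push encReg (encWire α β) σ).congr (fun _ => rfl) fun σ => ?_
  rw [Layer.measure_apply, meas_push]
  · intro x y
    constructor
    · intro h r i hr
      have := h (.inl (r, y i)) (.inr (.inr (.inl (i, y i)))) (by simp [m', hr])
      simpa [encWire, simLabel, oneHot] using this
    · rintro h (⟨r, v⟩ | r) j hj
      · simp only [m', Sum.elim_inl] at hj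
        obtain ⟨i, hi, rfl⟩ := Option.map_eq_some_iff.1 hj
        simp [encWire, simLabel, h r i hi]
      · simp [m'] at hj
  · intro s x
    funext r
    rcases r with ⟨r, v⟩ | r
    · cases h : mr r with
      | none => simp [recordOn, m', h, encReg]
      | some i => simp [recordOn, m', h, encReg, encWire, simLabel]
    · simp [recordOn, m', encReg]

end Simulation

/-! ### Changing the encoding of registers and of wires. -/

section RegLabels

variable {X R S Y : Type*} [Fintype X] [DecidableEq X] [Fintype R] [DecidableEq R]
  [Fintype S] [DecidableEq S] [Fintype Y] [DecidableEq Y] {w c : ℕ} {G : GateSet}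
  {ι : X ↪ Fin w} {κ : R ↪ Fin c}

lemma Reach.regLabels {q : ℕ} (hq : q ∈ G.classicalMod) (u : R → RegGate R)
    {g g' : S → R → Fin 2} (f : Y → X → Fin 2) (h : ∀ s r, (u r).eval q (g s) r = g' s r) :
    Reach G 1 (fun σ : GS S Y => ext ι κ (push g f σ)) (fun σ => ext ι κ (push g' f σ)) := by
  refine ((reach_classical (G := G) (ι := ι) (κ := κ) hq u).comp
    fun σ : GS S Y => push g f σ).congr (fun _ => rfl) fun σ => ?_
  have : g' = (fun s r => (u r).eval q s r) ∘ g := funext fun s => funext fun r => (h s r).symm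
  rw [this, push_push g f (fun s r => (u r).eval q s r) id σ, Function.id_comp]

lemma Impl.wireLabels {n : ℕ} {V : (R → Fin 2) → Matrix (X → Fin 2) (X → Fin 2) ℂ}
    (hV : Impl G ι κ n V) (g : S → R → Fin 2) {f f' : Y → X → Fin 2}
    (h : ∀ s y, V (g s) *ᵥ ket (f y) = ket (f' y)) :
    Reach G n (fun σ : GS S Y => ext ι κ (push g f σ)) (fun σ => ext ι κ (push g f' σ)) := by
  refine (Reach.comp hV fun σ : GS S Y => push g f σ).congr (fun _ => rfl) fun σ => ?_
  rw [conjBy_push_relabel (f₂ := f') h]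

end RegLabels

/-! ### Simulation of classical layers and of whole circuits. -/

section Simulation

variable {α β : Type*} [Fintype α] [DecidableEq α] [Fintype β] [DecidableEq β] {w c p : ℕ}
  {W C : ℕ} {G : GateSet} {ι : SimWire α β w p ↪ Fin W} {κ : SimReg c p ↪ Fin C} {m m₀ n : ℕ}

/-- The conjunctions that a layer of classical gates needs. -/
def pairReg (u : Fin c → CGate p c) (s : Basis p c) (t : Fin c × Fin p × Fin p) : Fin 2 :=
  match u t.1 with
  | .bounded r₁ r₂ _ => oneHot (some (s r₁)) t.2.1 * oneHot (some (s r₂)) t.2.2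
  | _ => 0

lemma sum_oneHot_mul_oneHot (a b : Fin p) (P : Fin p × Fin p → Prop) [DecidablePred P] :
    ∑ t ∈ Finset.univ.filter P, ((oneHot (some a) t.1 * oneHot (some b) t.2 : Fin 2) : ℕ) =
      if P (a, b) then 1 else 0 := by
  have h : ∀ t : Fin p × Fin p, ((oneHot (some a) t.1 * oneHot (some b) t.2 : Fin 2) : ℕ) =
      if t = (a, b) then 1 else 0 := by
    rintro ⟨x, y⟩
    simp only [oneHot, Option.some.injEq, Prod.mk.injEq]
    by_cases h1 : a = x <;> by_cases h2 : b = y <;> simp [h1, h2, Ne.symm, eq_comm]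
  simp only [h, Finset.sum_ite_eq', Finset.mem_filter, Finset.mem_univ, true_and]

/-- A function of two `p`-ary values is computed on one-hot registers in three layers: conjunctions
of input bits, output bits, clearing. The conjunctions for pairs with `f ≠ v` sum to `0` or `1`, and
because `q ≥ 2`, `MOD_q` of this sum is the output bit for `v`. -/
lemma reach_classicalLayer [NeZero p] {q : ℕ} (hq : q ∈ G.classicalMod) (hq2 : 2 ≤ q)
    (u : Fin c → CGate p c) (hu : (Layer.classical (w := w) u).Allowed ⟨True, True, ∅⟩) :
    Reach G 3
      (fun σ : HybridState p w c => ext ι κ (push encReg (encWire α β) σ))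
      (fun σ => ext ι κ (push encReg (encWire α β) ((Layer.classical u).apply σ))) := by
  let u₁ : SimReg c p → RegGate (SimReg c p) := Sum.elim (fun _ => .keep) fun t =>
    match u t.1 with
    | .bounded r₁ r₂ _ => .bounded (.inl (r₁, t.2.1)) (.inl (r₂, t.2.2)) (· * ·)
    | _ => .keep
  let u₂ : SimReg c p → RegGate (SimReg c p) := Sum.elim (fun t =>
    match u t.1 with
    | .bounded _ _ f => .mod ((Finset.univ.filter fun ab : Fin p × Fin p => f ab.1 ab.2 ≠ t.2).map
        ⟨fun ab => .inr (t.1, ab), fun ab ab' h => by simpa using h⟩)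
    | _ => .keep) fun _ => .keep
  let u₃ : SimReg c p → RegGate (SimReg c p) := Sum.elim (fun _ => .keep) fun t =>
    .bounded (.inr t) (.inr t) fun _ _ => 0
  let ev : Basis p c → Basis p c := fun s r => (u r).eval s r
  have h₁ := Reach.regLabels (G := G) (ι := ι) (κ := κ) hq u₁ (g := encReg)
    (g' := fun s => Sum.elim (fun t => oneHot (some (s t.1)) t.2) (pairReg u s))
    (encWire (w := w) (p := p) α β) (by
      rintro s (r | t)
      · rfl
      · simp only [u₁, Sum.elim_inr, pairReg]
        cases u t.1 <;> rfl)
  have h₂ := Reach.regLabels (G := G) (ι := ι) (κ := κ) hq u₂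
    (g := fun s => Sum.elim (fun t => oneHot (some (s t.1)) t.2) (pairReg u s))
    (g' := fun s => Sum.elim (fun t => oneHot (some (ev s t.1)) t.2) (pairReg u s))
    (encWire (w := w) (p := p) α β) (by
      rintro s (⟨r, v⟩ | t)
      · simp only [u₂, Sum.elim_inl, ev]
        cases hr : u r with
        | keep => rfl
        -- The source class has no classical `MOD` gates.
        | mod q' T => exact absurd (show (u r).Allowed ⟨True, True, ∅⟩ from hu r) (by
            rw [hr]; exact Set.notMem_empty q')
        | bounded r₁ r₂ f =>
          have hp : ∀ ab, pairReg u s (r, ab) =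
              oneHot (some (s r₁)) ab.1 * oneHot (some (s r₂)) ab.2 := fun ab => by
            simp only [pairReg, hr]
          refine (congrArg (fun k => if k % q = 0 then (1 : Fin 2) else 0)
            (?_ : _ = if f (s r₁) (s r₂) ≠ v then 1 else 0)).trans ?_
          · rw [Finset.sum_map]
            exact (Finset.sum_congr rfl fun ab _ => congrArg Fin.val (hp ab)).trans
              (sum_oneHot_mul_oneHot _ _ _)
          · simp only [oneHot, Option.some.injEq, CGate.eval]
            by_cases h : f (s r₁) (s r₂) = v
            · simp [h]
            · simp [h, Nat.mod_eq_of_lt hq2]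
      · rfl)
  have h₃ := Reach.regLabels (G := G) (ι := ι) (κ := κ) hq u₃
    (g := fun s => Sum.elim (fun t => oneHot (some (ev s t.1)) t.2) (pairReg u s))
    (g' := fun s => encReg (ev s))
    (encWire (w := w) (p := p) α β) (by
      rintro s (r | t) <;> rfl)
  refine ((h₁.trans h₂).trans h₃).congr (fun _ => rfl) fun σ => ?_
  rw [Layer.classical_apply]
  exact congrArg _ (push_push _ _ _ _ σ)

/-- The depth of the simulation of a layer. -/
def layerDepth (p n : ℕ) : ℕ := 4 * n + 3 * (p * (p + 1)) + 3

lemma reach_layer [NeZero p] [Nontrivial (Fin p)] (hO : HasOracle G ι κ m n) (hm : m = m₀ + 2)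
    (hw : w * p < 2 ^ m₀) {q : ℕ} (hq : q ∈ G.classicalMod) (hq2 : 2 ≤ q) (L : Layer p w c)
    (hL : L.Allowed ⟨True, True, ∅⟩) :
    Reach G (layerDepth p n)
      (fun σ : HybridState p w c => ext ι κ (push encReg (encWire α β) σ))
      (fun σ => ext ι κ (push encReg (encWire α β) (L.apply σ))) := by
  cases L with
  | quantum gs hgs => exact (reach_quantum hO hm hw gs hgs).mono (by unfold layerDepth; omega)
  | measure mr => exact (reach_measure mr).mono (by unfold layerDepth; omega)
  | classical u => exact (reach_classicalLayer hq hq2 u hL).mono (by unfold layerDepth; omega)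

lemma reach_layers [NeZero p] [Nontrivial (Fin p)] (hO : HasOracle G ι κ m n) (hm : m = m₀ + 2)
    (hw : w * p < 2 ^ m₀) {q : ℕ} (hq : q ∈ G.classicalMod) (hq2 : 2 ≤ q)
    (Ls : List (Layer p w c)) (hL : ∀ L ∈ Ls, L.Allowed ⟨True, True, ∅⟩) :
    Reach G (Ls.length * layerDepth p n)
      (fun σ : HybridState p w c => ext ι κ (push encReg (encWire α β) σ))
      (fun σ => ext ι κ (push encReg (encWire α β) (Ls.foldl (fun σ L => L.apply σ) σ))) := by
  induction Ls with
  | nil => exact (Reach.refl _).mono (Nat.zero_le _)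
  | cons L Ls ih =>
    have h := (reach_layer (α := α) (β := β) hO hm hw hq hq2 L (hL L (by simp))).trans
      ((ih fun L' h => hL L' (by simp [h])).comp L.apply)
    exact h.mono (by rw [List.length_cons]; linarith)

end Simulation

/-! ### Oracles between code words and one-hot blocks. -/

section Codes

variable {α β : Type*} [Fintype α] [DecidableEq α] [Fintype β] [DecidableEq β] {w c p : ℕ} {m : ℕ}

/-- The weights with which an oracle for one-hot wires reads code words. -/
def decodeWeight (cα : Fin w → α → ℕ) (cβ : Fin w → β → ℕ) :
    SimWire α β w p → SimWire α β w p → ℕ :=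
  Sum.elim 0 (Sum.elim 0 (Sum.elim
    (fun t => Sum.elim (cα t.1) (Sum.elim (cβ t.1) 0)) 0))

/-- The function that an oracle for one-hot wires computes. -/
def decodeFun (D : Fin w → Fin p → ℕ → Bool) : SimWire α β w p → ℕ → Bool :=
  Sum.elim (fun _ _ => false) (Sum.elim (fun _ _ => false) (Sum.elim
    (fun t => D t.1 t.2) fun _ _ => false))

lemma flips_decode {cα : Fin w → α → ℕ} {cβ : Fin w → β → ℕ} {D : Fin w → Fin p → ℕ → Bool}
    {u : α → Fin 2} {v : β → Fin 2} {d' : Fin w → Option (Fin p)}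
    (h : ∀ i b, D i b ((∑ t, cα i t * (u t : ℕ) + ∑ t, cβ i t * (v t : ℕ)) % 2 ^ m) = true ↔
      d' i = some b) (d : Fin w → Option (Fin p)) (k : Fin w → Fin 2) :
    flips m (decodeWeight cα cβ) (decodeFun D) (Finset.univ.map (dataEmb α β w p))
      (simLabel u v d (fun _ _ => none) k) = simLabel 0 0 d' (fun _ _ => none) 0 := by
  have hnm : ∀ j : SimWire α β w p, (∀ t, dataEmb α β w p t ≠ j) →
      j ∉ Finset.univ.map (dataEmb α β w p) := by
    intro j hj h
    obtain ⟨t, -, ht⟩ := Finset.mem_map.1 h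
    exact hj t ht
  funext j
  rcases j with (j | j | ⟨i, b⟩ | j | j)
  · rw [flips, if_neg fun h => hnm _ (by intro t h; cases h) h.1]; rfl
  · rw [flips, if_neg fun h => hnm _ (by intro t h; cases h) h.1]; rfl
  · have hmem : (.inr (.inr (.inl (i, b))) : SimWire α β w p) ∈
        Finset.univ.map (dataEmb α β w p) :=
      Finset.mem_map.2 ⟨(i, b), Finset.mem_univ _, rfl⟩
    have hw : weight (decodeWeight cα cβ) (.inr (.inr (.inl (i, b))) : SimWire α β w p)
        (simLabel u v d (fun _ _ => none) k) =
        ∑ t, cα i t * (u t : ℕ) + ∑ t, cβ i t * (v t : ℕ) := by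
      simp only [weight, decodeWeight, simLabel, Fintype.sum_sum_type, Sum.elim_inl, Sum.elim_inr,
        Pi.zero_apply, zero_mul, Finset.sum_const_zero, zero_add, add_zero]
    rw [flips, hw]
    have hD := h i b
    simp only [hmem, true_and, decodeFun, Sum.elim_inr, Sum.elim_inl, simLabel, oneHot]
    by_cases h' : d' i = some b
    · rw [if_pos (hD.2 h'), if_pos h']
    · rw [if_neg (mt hD.1 h'), if_neg h']
  · rw [flips, if_neg fun h => hnm _ (by intro t h; cases h) h.1]; rfl
  · rw [flips, if_neg fun h => hnm _ (by intro t h; cases h) h.1]; rfl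

/-- The weights with which an oracle for code words reads one-hot wires. -/
def readWeight (sα : α → Fin w) (sβ : β → Fin w) : SimWire α β w p → SimWire α β w p → ℕ :=
  Sum.elim (fun t => Sum.elim 0 (Sum.elim 0 (Sum.elim
      (fun t' => if t'.1 = sα t then t'.2 else 0) 0)))
    (Sum.elim (fun t => Sum.elim 0 (Sum.elim 0 (Sum.elim
      (fun t' => if t'.1 = sβ t then t'.2 else 0) 0))) 0)

/-- The function that an oracle for code words computes. -/
def readFun [NeZero p] (gα : α → Fin p → Fin 2) (gβ : β → Fin p → Fin 2) :
    SimWire α β w p → ℕ → Bool :=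
  Sum.elim (fun t h => decide (gα t (Fin.ofNat p h) = 1))
    (Sum.elim (fun t h => decide (gβ t (Fin.ofNat p h) = 1)) fun _ _ => false)

lemma sum_mul_oneHot (y : Basis p w) (i : Fin w) :
    ∑ t : Fin w × Fin p, (if t.1 = i then (t.2 : ℕ) else 0) *
      (oneHot (some (y t.1)) t.2 : ℕ) = y i := by
  rw [Fintype.sum_eq_single (i, y i)]
  · simp [oneHot]
  · rintro ⟨j, v⟩ hne
    by_cases h : j = i
    · subst h
      have : y j ≠ v := by rintro rfl; exact hne rfl
      simp [oneHot, this]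
    · simp [h]

lemma ite_eq_one_fin_two (b : Fin 2) : (if b = 1 then 1 else 0 : Fin 2) = b := by
  revert b; decide

/-- Weighting the one-hot wire of `v` by `v` yields the value of the qudit, and `p ≤ 2 ^ m` prevents
a reduction. The oracle then looks up the required bit of the code word. -/
lemma flips_read_inl [NeZero p] (hp : p ≤ 2 ^ m) (sα : α → Fin w) (sβ : β → Fin w)
    (gα : α → Fin p → Fin 2)
    (gβ : β → Fin p → Fin 2) (u : α → Fin 2) (v : β → Fin 2) (y : Basis p w) (k : Fin w → Fin 2) :
    flips m (readWeight sα sβ) (readFun gα gβ)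
      (Finset.univ.map (Function.Embedding.inl : α ↪ SimWire α β w p))
      (simLabel u v (fun i => some (y i)) (fun _ _ => none) k) =
      simLabel (fun t => gα t (y (sα t))) 0 (fun _ => none) (fun _ _ => none) 0 := by
  have hnm : ∀ j : β ⊕ (Fin w × Fin p) ⊕ (Fin w × Fin p × Fin p) ⊕ Fin w,
      (.inr j : SimWire α β w p) ∉
        Finset.univ.map (Function.Embedding.inl : α ↪ SimWire α β w p) := by simp
  funext j
  rcases j with (t | j | j | j | j)
  · have hw : weight (readWeight sα sβ) (.inl t : SimWire α β w p)
        (simLabel u v (fun i => some (y i)) (fun _ _ => none) k) = y (sα t) := by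
      simp only [weight, readWeight, simLabel, Fintype.sum_sum_type, Sum.elim_inl, Sum.elim_inr,
        Pi.zero_apply, zero_mul, Finset.sum_const_zero, zero_add, add_zero]
      exact sum_mul_oneHot y _
    rw [flips, hw, Nat.mod_eq_of_lt ((y _).2.trans_le hp)]
    simp only [Finset.mem_map, Finset.mem_univ, true_and, readFun, Sum.elim_inl, Fin.ofNat_val_eq_self,
      decide_eq_true_eq, simLabel, Function.Embedding.inl_apply, Sum.inl.injEq, exists_eq]
    exact ite_eq_one_fin_two _
  · rw [flips, if_neg fun h => hnm _ h.1]; rfl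
  · rw [flips, if_neg fun h => hnm _ h.1]; simp [simLabel]
  · rw [flips, if_neg fun h => hnm _ h.1]; simp [simLabel]
  · rw [flips, if_neg fun h => hnm _ h.1]; rfl

/-- The wires of the encoded outputs. -/
def outEmb (α β : Type*) (w p : ℕ) : β ↪ SimWire α β w p :=
  Function.Embedding.inl.trans Function.Embedding.inr

lemma flips_read_inr [NeZero p] (hp : p ≤ 2 ^ m) (sα : α → Fin w) (sβ : β → Fin w)
    (gα : α → Fin p → Fin 2)
    (gβ : β → Fin p → Fin 2) (u : α → Fin 2) (v : β → Fin 2) (y : Basis p w) (k : Fin w → Fin 2) :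
    flips m (readWeight sα sβ) (readFun gα gβ) (Finset.univ.map (outEmb α β w p))
      (simLabel u v (fun i => some (y i)) (fun _ _ => none) k) =
      simLabel 0 (fun t => gβ t (y (sβ t))) (fun _ => none) (fun _ _ => none) 0 := by
  have hnm : ∀ j : SimWire α β w p, (∀ t, outEmb α β w p t ≠ j) →
      j ∉ Finset.univ.map (outEmb α β w p) := by
    intro j hj h
    obtain ⟨t, -, ht⟩ := Finset.mem_map.1 h
    exact hj t ht
  funext j
  rcases j with (j | t | j | j | j)
  · rw [flips, if_neg fun h => hnm _ (by intro t h; cases h) h.1]; rfl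
  · have hw : weight (readWeight sα sβ) (.inr (.inl t) : SimWire α β w p)
        (simLabel u v (fun i => some (y i)) (fun _ _ => none) k) = y (sβ t) := by
      simp only [weight, readWeight, simLabel, Fintype.sum_sum_type, Sum.elim_inl, Sum.elim_inr,
        Pi.zero_apply, zero_mul, Finset.sum_const_zero, zero_add, add_zero]
      exact sum_mul_oneHot y _
    have hmem : (.inr (.inl t) : SimWire α β w p) ∈ Finset.univ.map (outEmb α β w p) :=
      Finset.mem_map.2 ⟨t, Finset.mem_univ _, rfl⟩
    rw [flips, hw, Nat.mod_eq_of_lt ((y _).2.trans_le hp)]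
    simp only [hmem, true_and, readFun, Sum.elim_inl, Sum.elim_inr, Fin.ofNat_val_eq_self,
      decide_eq_true_eq, simLabel]
    exact ite_eq_one_fin_two _
  · rw [flips, if_neg fun h => hnm _ (by intro t h; cases h) h.1]; simp [simLabel]
  · rw [flips, if_neg fun h => hnm _ (by intro t h; cases h) h.1]; simp [simLabel]
  · rw [flips, if_neg fun h => hnm _ (by intro t h; cases h) h.1]; rfl

/-- The number with the given binary digits. -/
def codeNumber {k : ℕ} (b : Basis 2 k) : ℕ := ∑ l : Fin k, 2 ^ (l : ℕ) * (b l : ℕ)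

lemma codeNumber_eq {k : ℕ} (b : Basis 2 k) : codeNumber b = finFunctionFinEquiv b := by
  rw [finFunctionFinEquiv_apply, codeNumber]
  exact Finset.sum_congr rfl fun l _ => mul_comm _ _

lemma codeNumber_lt {k : ℕ} (b : Basis 2 k) : codeNumber b < 2 ^ k := by
  rw [codeNumber_eq]; exact Fin.is_lt _

lemma codeNumber_inj {k : ℕ} {b b' : Basis 2 k} : codeNumber b = codeNumber b' ↔ b = b' := by
  rw [codeNumber_eq, codeNumber_eq, ← Fin.ext_iff, EmbeddingLike.apply_eq_iff_eq]

lemma sum_mul_encodeBasis {a k : ℕ} (e : Fin p → Basis 2 k) (f : Fin a ↪ Fin w) (x : Basis p a)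
    (j : Fin a) :
    ∑ t : Fin (a * k), (if f (finProdFinEquiv.symm t).1 = f j then
      2 ^ ((finProdFinEquiv.symm t).2 : ℕ) else 0) * (encodeBasis e x t : ℕ) =
      codeNumber (e (x j)) := by
  rw [← Equiv.sum_comp finProdFinEquiv, Fintype.sum_prod_type, Fintype.sum_eq_single j]
  · simp [codeNumber, encodeBasis]
  · intro j' hj'
    simp [f.injective.eq_iff, hj']

end Codes

/-! ### Conversion of inputs and outputs. -/

section Interface

variable {w c p k a b : ℕ} {W C : ℕ} {G : GateSet}
  {ι : SimWire (Fin (a * k)) (Fin (b * k)) w p ↪ Fin W} {κ : SimReg c p ↪ Fin C} {m m₀ n : ℕ}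

lemma HasOracle.reach {S X Y R : Type*} [Fintype S] [DecidableEq S] [Fintype X] [DecidableEq X]
    [Fintype Y] [DecidableEq Y] [Fintype R] [DecidableEq R] {ι : X ↪ Fin W} {κ : R ↪ Fin C}
    (hO : HasOracle G ι κ m n)
    {wt : X → X → ℕ} {fn : X → ℕ → Bool} {Z : Finset X} (hZ : ∀ z, ∀ j ∈ Z, wt z j = 0)
    (g : S → R → Fin 2) {f f' : Y → X → Fin 2} (h : ∀ y, f y + flips m wt fn Z (f y) = f' y) :
    Reach G n (fun σ : GS S Y => ext ι κ (push g f σ)) (fun σ => ext ι κ (push g f' σ)) :=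
  (hO wt fn Z hZ).wireLabels g fun s y => by rw [relabel_mulVec_ket, h]

lemma decodeWeight_eq_zero {α β : Type*} [Fintype α] [DecidableEq α] [Fintype β] [DecidableEq β]
    (cα : Fin w → α → ℕ) (cβ : Fin w → β → ℕ) (z : SimWire α β w p) :
    ∀ j ∈ Finset.univ.map (dataEmb α β w p), decodeWeight cα cβ z j = 0 := by
  intro j hj
  obtain ⟨t, -, rfl⟩ := Finset.mem_map.1 hj
  rcases z with (z | z | z | z | z) <;> rfl

/-- The weights with which the code words on given wires are read. -/
def codeWeight {a : ℕ} (k : ℕ) (f : Fin a ↪ Fin w) (i : Fin w) (t : Fin (a * k)) : ℕ :=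
  if f (finProdFinEquiv.symm t).1 = i then 2 ^ ((finProdFinEquiv.symm t).2 : ℕ) else 0

lemma sum_codeWeight (e : Fin p → Basis 2 k) (f : Fin a ↪ Fin w) (x : Basis p a) (j : Fin a) :
    ∑ t, codeWeight k f (f j) t * (encodeBasis e x t : ℕ) = codeNumber (e (x j)) :=
  sum_mul_encodeBasis e f x j

open Classical in
/-- The decoding of the inputs. -/
noncomputable def inputDecoder [NeZero p] (e : Fin p → Basis 2 k) (inp : Fin a ↪ Fin w)
    (i : Fin w) (v : Fin p) (h : ℕ) : Bool :=
  -- Auxiliary qudits start in `|0⟩`, whose one-hot code is not the zero string; the decoder has to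
  -- create it.
  if i ∈ Set.range inp then decide (h = codeNumber (e v)) else decide (v = 0)

open Classical in
/-- The decoding of the outputs. -/
noncomputable def outputDecoder (e : Fin p → Basis 2 k) (out : Fin b ↪ Fin w)
    (i : Fin w) (v : Fin p) (h : ℕ) : Bool :=
  decide (i ∈ Set.range out ∧ h = codeNumber (e v))

/-- Encoded inputs, and no other data. -/
def inputLabel (b w : ℕ) (e : Fin p → Basis 2 k) (x : Basis p a) :
    SimWire (Fin (a * k)) (Fin (b * k)) w p → Fin 2 :=
  simLabel (encodeBasis e x) 0 (fun _ => none) (fun _ _ => none) 0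

open Classical in
/-- Encoded outputs, and the one-hot encoding of all other qudits. -/
noncomputable def outputLabel (a : ℕ) (e : Fin p → Basis 2 k) (out : Fin b ↪ Fin w)
    (y : Basis p w) : SimWire (Fin (a * k)) (Fin (b * k)) w p → Fin 2 :=
  simLabel 0 (encodeBasis e (y ∘ out))
    (fun i => if i ∈ Set.range out then none else some (y i)) (fun _ _ => none) 0

/-- The code words are decoded into one-hot blocks and then erased by recomputing them from these
blocks. Decoding needs `e` injective; erasing keeps the conversion coherent. -/
lemma reach_input [NeZero p] (hO : HasOracle G ι κ m n) (hk : k ≤ m) (hp : p ≤ 2 ^ m)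
    {q : ℕ} (hq : q ∈ G.classicalMod)
    {e : Fin p → Basis 2 k} (he : Function.Injective e) (inp : Fin a ↪ Fin w)
    (out : Fin b ↪ Fin w) :
    Reach G (2 * n + 1)
      (fun σ : GS Unit (Basis p a) => ext ι κ (push (fun _ => 0) (inputLabel b w e) σ))
      (fun σ => ext ι κ (push (fun _ => encReg 0) (fun x => encWire _ _ (pad inp x)) σ)) := by
  let mid : Basis p a → SimWire (Fin (a * k)) (Fin (b * k)) w p → Fin 2 := fun x =>
    simLabel (encodeBasis e x) 0 (fun i => some (pad inp x i)) (fun _ _ => none) 0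
  have h₁ := Reach.regLabels (G := G) (ι := ι) (κ := κ) (S := Unit) hq
    -- The constant one-hot code of `0` is written to every simulated register.
    (u := Sum.elim (fun t => .bounded (.inl t) (.inl t) fun _ _ => if t.2 = 0 then 1 else 0)
      fun _ => .keep) (g := fun _ => 0) (g' := fun _ => encReg 0) (inputLabel b w e) (by
      rintro - (⟨r, v⟩ | t)
      · simp [RegGate.eval, encReg, oneHot, eq_comm]
      · rfl)
  have h₂ := hO.reach (S := Unit) (Y := Basis p a)
    (decodeWeight_eq_zero (codeWeight k inp) 0) (fun _ => encReg 0)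
    (f := inputLabel b w e) (f' := mid) (fn := decodeFun (inputDecoder e inp)) (by
      intro x
      rw [inputLabel, flips_decode (d' := fun i => some (pad inp x i))]
      · funext j
        rcases j with (j | j | j | j | j) <;> simp [mid, simLabel]
      · intro i v
        simp only [Pi.zero_apply, zero_mul, Finset.sum_const_zero, add_zero, inputDecoder,
          Option.some.injEq]
        by_cases hi : i ∈ Set.range inp
        · obtain ⟨j, rfl⟩ := hi
          rw [if_pos ⟨j, rfl⟩, sum_codeWeight, pad_apply inp.injective,
            Nat.mod_eq_of_lt ((codeNumber_lt _).trans_le (Nat.pow_le_pow_right (by norm_num) hk)),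
            decide_eq_true_eq, codeNumber_inj, he.eq_iff]
        · rw [if_neg hi, pad_apply_of_notMem x fun j hj => hi ⟨j, hj⟩, decide_eq_true_eq, eq_comm])
  have h₃ := hO.reach (S := Unit) (Y := Basis p a) (f := mid)
    (f' := fun x => encWire _ _ (pad inp x))
    (wt := readWeight (fun t => inp (finProdFinEquiv.symm t).1)
      fun t => out (finProdFinEquiv.symm t).1)
    (fn := readFun (fun t v => e v (finProdFinEquiv.symm t).2)
      fun t v => e v (finProdFinEquiv.symm t).2)
    (Z := Finset.univ.map Function.Embedding.inl) (by
      intro z j hj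
      obtain ⟨t, -, rfl⟩ := Finset.mem_map.1 hj
      rcases z with (z | z | z | z | z) <;> rfl) (fun _ => encReg 0) (by
      intro x
      simp only [mid]
      rw [flips_read_inl hp]
      funext j
      rcases j with (j | j | j | j | j)
      · simp only [Pi.add_apply, simLabel, encWire, Sum.elim_inl, pad_apply inp.injective,
          encodeBasis, Pi.zero_apply]
        generalize e _ _ = x
        revert x; decide
      all_goals simp [simLabel, encWire])
  exact ((h₁.trans h₂).trans h₃).mono (by omega)

/-- Code words are written first, then the one-hot blocks of the output qudits are erased from them.
A leftover block would be traced out as a copy of an output and would destroy its coherence. -/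
lemma reach_output [NeZero p] (hO : HasOracle G ι κ m n) (hk : k ≤ m) (hp : p ≤ 2 ^ m)
    {e : Fin p → Basis 2 k} (he : Function.Injective e) (inp : Fin a ↪ Fin w)
    (out : Fin b ↪ Fin w) :
    Reach G (2 * n)
      (fun σ : HybridState p w c => ext ι κ (push encReg (encWire _ _) σ))
      (fun σ => ext ι κ (push encReg (outputLabel a e out) σ)) := by
  let mid : Basis p w → SimWire (Fin (a * k)) (Fin (b * k)) w p → Fin 2 := fun y =>
    simLabel 0 (encodeBasis e (y ∘ out)) (fun i => some (y i)) (fun _ _ => none) 0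
  have h₂ := hO.reach (S := Basis p c) (Y := Basis p w)
    (decodeWeight_eq_zero 0 (codeWeight k out)) encReg
    (f := mid) (f' := outputLabel a e out) (fn := decodeFun (outputDecoder e out)) (by
      classical
      intro y
      simp only [mid]
      rw [flips_decode (d' := fun i => if i ∈ Set.range out then some (y i) else none)]
      · funext j
        rcases j with (j | j | ⟨i, v⟩ | j | j)
        · simp [outputLabel, simLabel]
        · simp [outputLabel, simLabel]
        · simp only [outputLabel, simLabel, Pi.add_apply, Sum.elim_inr, Sum.elim_inl]
          by_cases hi : i ∈ Set.range out
          · rw [if_pos hi, if_pos hi, oneHot_add_self, oneHot_none]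
          · rw [if_neg hi, if_neg hi, oneHot_none]; exact add_zero _
        · simp [outputLabel, simLabel]
        · simp [outputLabel, simLabel]
      · intro i v
        simp only [Pi.zero_apply, zero_mul, Finset.sum_const_zero, zero_add, outputDecoder,
          decide_eq_true_eq]
        by_cases hi : i ∈ Set.range out
        · obtain ⟨j, rfl⟩ := hi
          rw [if_pos ⟨j, rfl⟩, sum_codeWeight,
            Nat.mod_eq_of_lt ((codeNumber_lt _).trans_le (Nat.pow_le_pow_right (by norm_num) hk)),
            codeNumber_inj, he.eq_iff]
          simp
        · simp [hi])
  have h₃ := hO.reach (S := Basis p c) (Y := Basis p w) (f := encWire _ _) (f' := mid)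
    (wt := readWeight (fun t => inp (finProdFinEquiv.symm t).1)
      fun t => out (finProdFinEquiv.symm t).1)
    (fn := readFun (fun t v => e v (finProdFinEquiv.symm t).2)
      fun t v => e v (finProdFinEquiv.symm t).2)
    (Z := Finset.univ.map (outEmb _ _ w p)) (by
      intro z j hj
      obtain ⟨t, -, rfl⟩ := Finset.mem_map.1 hj
      rcases z with (z | z | z | z | z) <;> rfl) encReg (by
      intro y
      simp only [mid, encWire]
      rw [flips_read_inr hp]
      funext j
      rcases j with (j | j | j | j | j) <;> simp [simLabel, encodeBasis])
  exact (h₃.trans h₂).mono (by omega)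

end Interface

/-! ### From joint states to channels. -/

section Channel

lemma relabel_conj_apply {X X' : Type*} [Fintype X] [DecidableEq X] [Fintype X'] [DecidableEq X']
    (f : X → X') (ρ : Matrix X X ℂ) (x' y' : X') :
    (relabel f * ρ * (relabel f)ᴴ) x' y' =
      ∑ x, ∑ y, if f x = x' ∧ f y = y' then ρ x y else 0 := by
  simp only [Matrix.mul_apply, relabel, Matrix.of_apply, Matrix.conjTranspose_apply,
    Finset.sum_mul]
  rw [Finset.sum_comm]
  refine Finset.sum_congr rfl fun x _ => Finset.sum_congr rfl fun y _ => ?_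
  by_cases h1 : f x = x' <;> by_cases h2 : f y = y' <;> simp [h1, h2]

lemma encode_eq {p k m : ℕ} (e : Fin p → Basis 2 k) (ρ : Op p m) :
    encode e ρ = relabel (encodeBasis (m := m) e) * ρ * (relabel (encodeBasis (m := m) e))ᴴ := by
  ext X Y
  rw [relabel_conj_apply]
  rfl

lemma Circuit.init_eq {d a b : ℕ} [NeZero d] (C : Circuit d a b) (ρ : Op d a) :
    C.init ρ = push (fun _ : Unit => 0) (pad C.inp) (fun _ => ρ) := by
  classical
  funext s
  ext x y
  have hpad : ∀ (u : Basis d a) (x : Basis d C.width), pad C.inp u = x ↔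
      (∀ i, i ∉ Set.range C.inp → x i = 0) ∧ u = x ∘ C.inp := by
    intro u x
    constructor
    · rintro rfl
      refine ⟨fun i hi => pad_apply_of_notMem u fun j hj => hi ⟨j, hj⟩, funext fun j => ?_⟩
      rw [Function.comp_apply, pad_apply C.inp.injective]
    · rintro ⟨h, rfl⟩
      exact (pad_ext C.inp.injective (fun i => rfl) fun j hj => h j fun ⟨i, hi⟩ => hj i hi).symm
  rw [push_apply]
  simp only [Finset.univ_unique, Finset.sum_singleton, Circuit.init, Matrix.of_apply]
  by_cases hs : s = 0
  · subst hs
    rw [if_pos rfl, relabel_conj_apply]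
    simp only [hpad]
    by_cases h : ∀ i, i ∉ Set.range C.inp → x i = 0 ∧ y i = 0
    · rw [if_pos ⟨trivial, h⟩, Finset.sum_eq_single (x ∘ C.inp), Finset.sum_eq_single (y ∘ C.inp),
        if_pos ⟨⟨fun i hi => (h i hi).1, rfl⟩, ⟨fun i hi => (h i hi).2, rfl⟩⟩]
      · intro v _ hv; rw [if_neg fun h => hv h.2.2]
      · simp
      · intro u _ hu
        exact Finset.sum_eq_zero fun v _ => if_neg fun h => hu h.1.2
      · simp
    · rw [if_neg fun h' => h h'.2]
      symm
      refine Finset.sum_eq_zero fun u _ => Finset.sum_eq_zero fun v _ => if_neg fun h' => h ?_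
      exact fun i hi => ⟨h'.1.1 i hi, h'.2.1 i hi⟩
  · rw [if_neg fun h => hs h.1, if_neg (Ne.symm hs)]; rfl

open Classical in
/-- The reduced state of the output qudits as a linear function. -/
noncomputable def Circuit.finalLinear {d a b : ℕ} (C : Circuit d a b) :
    GS (Basis d C.regs) (Basis d C.width) →ₗ[ℂ] Op d b where
  toFun := C.final
  map_add' σ τ := by
    ext u v
    simp only [Circuit.final, Matrix.of_apply, Matrix.add_apply, ← Finset.sum_add_distrib]
    refine Finset.sum_congr rfl fun s _ => Finset.sum_congr rfl fun x _ =>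
      Finset.sum_congr rfl fun y _ => ?_
    split_ifs <;> simp
  map_smul' r σ := by
    ext u v
    simp only [Circuit.final, Matrix.of_apply, Matrix.smul_apply, RingHom.id_apply,
      Finset.smul_sum]
    refine Finset.sum_congr rfl fun s _ => Finset.sum_congr rfl fun x _ =>
      Finset.sum_congr rfl fun y _ => ?_
    split_ifs <;> simp

open Classical in
lemma Circuit.final_bas {d a b : ℕ} (C : Circuit d a b) (s : Basis d C.regs)
    (x y : Basis d C.width) : C.finalLinear (bas s x y) =
      if ∀ i, i ∉ Set.range C.out → x i = y i then
        Matrix.single (x ∘ C.out) (y ∘ C.out) 1 else 0 := by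
  ext u v
  change (∑ s', ∑ x', ∑ y', if x' ∘ C.out = u ∧ y' ∘ C.out = v ∧
    ∀ i, i ∉ Set.range C.out → x' i = y' i then bas s x y s' x' y' else 0) = _
  rw [Finset.sum_eq_single s, Finset.sum_eq_single x, Finset.sum_eq_single y]
  · have hb : bas s x y s x y = 1 := by simp [bas]
    rw [hb]
    by_cases h : ∀ i, i ∉ Set.range C.out → x i = y i
    · rw [if_pos h, Matrix.single_apply]
      by_cases h12 : x ∘ C.out = u ∧ y ∘ C.out = v
      · rw [if_pos h12, if_pos ⟨h12.1, h12.2, h⟩]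
      · rw [if_neg h12, if_neg fun h' => h12 ⟨h'.1, h'.2.1⟩]
    · rw [if_neg h, if_neg fun h' => h h'.2.2]; rfl
  · intro y' _ hy; simp [bas, Matrix.single_apply, Ne.symm hy]
  · simp
  · intro x' _ hx; simp [bas, Matrix.single_apply, Ne.symm hx]
  · simp
  · intro s' _ hs; simp [bas, hs]
  · simp

variable {p k a b W R : ℕ} {G : GateSet} {m m₀ n : ℕ}

/-- The traced-out wires must distinguish exactly what the traced-out qudits of `C` distinguish:
one-hot blocks of these qudits do so, and everything else that is traced out is constant. Registers
carry no coherences, so their contents are simply summed over. -/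
lemma final_outputLabel (C : Circuit p a b) (e : Fin p → Basis 2 k)
    (ι : SimWire (Fin (a * k)) (Fin (b * k)) C.width p ↪ Fin W) (κ : SimReg C.regs p ↪ Fin R)
    (Ls : List (Layer 2 W R)) (σ : HybridState p C.width C.regs) :
    (⟨W, R, Function.Embedding.inl.trans ι, (outEmb _ _ _ _).trans ι, Ls⟩ :
      Circuit 2 (a * k) (b * k)).final (ext ι κ (push encReg (outputLabel a e C.out) σ)) =
      encode e (C.final σ) := by
  classical
  set D : Circuit 2 (a * k) (b * k) :=
    ⟨W, R, Function.Embedding.inl.trans ι, (outEmb _ _ _ _).trans ι, Ls⟩ with hD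
  let conj : Op p b →ₗ[ℂ] Op 2 (b * k) :=
    { toFun := fun ρ => encode e ρ
      map_add' := fun ρ τ => by simp only [encode_eq, Matrix.mul_add, Matrix.add_mul]
      map_smul' := fun r ρ => by
        simp only [encode_eq, Matrix.mul_smul, Matrix.smul_mul, RingHom.id_apply] }
  refine LinearMap.congr_fun (f := D.finalLinear ∘ₗ ext ι κ ∘ₗ push encReg (outputLabel a e C.out))
    (g := conj ∘ₗ C.finalLinear) ?_ σ
  refine GS.linearMap_ext fun s x y => ?_
  have hout : ∀ x : Basis p C.width, pad ι (outputLabel a e C.out x) ∘ D.out =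
      encodeBasis e (x ∘ C.out) := by
    intro x
    funext t
    exact pad_apply ι.injective _ _
  have hiff : (∀ i, i ∉ Set.range D.out →
      pad ι (outputLabel a e C.out x) i = pad ι (outputLabel a e C.out y) i) ↔
      ∀ i, i ∉ Set.range C.out → x i = y i := by
    constructor
    · intro h i hi
      have := h (ι (.inr (.inr (.inl (i, y i))))) (by
        rintro ⟨t, ht⟩
        cases ι.injective ht)
      rw [pad_apply ι.injective, pad_apply ι.injective] at this
      simp only [outputLabel, simLabel, Sum.elim_inr, Sum.elim_inl, if_neg hi, oneHot,
        if_true, Option.some.injEq] at this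
      by_contra hne
      rw [if_neg hne] at this
      exact absurd this (by decide)
    · intro h i hi
      by_cases hr : ∃ j, ι j = i
      · obtain ⟨j, rfl⟩ := hr
        rw [pad_apply ι.injective, pad_apply ι.injective]
        rcases j with (j | j | ⟨j, v⟩ | j | j)
        · rfl
        · exact absurd ⟨j, rfl⟩ hi
        · simp only [outputLabel, simLabel, Sum.elim_inr, Sum.elim_inl]
          by_cases hj : j ∈ Set.range C.out
          · rw [if_pos hj, if_pos hj]
          · rw [if_neg hj, if_neg hj, h j hj]
        · rfl
        · rfl
      · push Not at hr
        rw [pad_apply_of_notMem _ hr, pad_apply_of_notMem _ hr]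
  rw [LinearMap.comp_apply, LinearMap.comp_apply, LinearMap.comp_apply, push_bas, ext, push_bas,
    Circuit.final_bas, Circuit.final_bas, hout, hout]
  by_cases h : ∀ i, i ∉ Set.range C.out → x i = y i
  · rw [if_pos (hiff.2 h), if_pos h]
    exact ((encode_eq e _).trans (relabel_single _ _ _)).symm
  · rw [if_neg (mt hiff.1 h), if_neg h, map_zero]

/-- The depth of the simulation of a circuit. -/
def simDepth (p D n : ℕ) : ℕ := 4 * n + 1 + D * layerDepth p n

lemma init_encode (C : Circuit p a b) (e : Fin p → Basis 2 k)
    (ι : SimWire (Fin (a * k)) (Fin (b * k)) C.width p ↪ Fin W) (κ : SimReg C.regs p ↪ Fin R)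
    (Ls : List (Layer 2 W R)) (ρ : Op p a) :
    (⟨W, R, Function.Embedding.inl.trans ι, (outEmb _ _ _ _).trans ι, Ls⟩ :
      Circuit 2 (a * k) (b * k)).init (encode e ρ) =
      ext ι κ (push (fun _ : Unit => 0) (inputLabel b C.width e) fun _ => ρ) := by
  have h1 : (fun _ : Unit => encode e ρ) = push (id : Unit → Unit) (encodeBasis e) fun _ => ρ := by
    funext u
    rw [push_apply, encode_eq]
    simp
  rw [Circuit.init_eq, h1, push_push, ext, push_push]
  have h2 : (pad κ ∘ fun _ : Unit => (0 : SimReg C.regs p → Fin 2)) = fun _ => 0 := by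
    funext u
    exact (pad_ext κ.injective (fun _ => rfl) fun _ _ => rfl).symm
  have h3 : pad ι ∘ inputLabel b C.width e = pad (Function.Embedding.inl.trans ι) ∘
      encodeBasis (m := a) e := by
    funext x
    symm
    apply pad_ext ι.injective
    · rintro (j | j | j | j | j)
      · exact pad_apply (Function.Embedding.inl.trans ι).injective _ _
      all_goals
        refine pad_apply_of_notMem _ fun t ht => ?_
        cases ι.injective ht
    · intro j hj
      exact pad_apply_of_notMem _ fun t => hj _
  rw [h2, h3]
  rfl

theorem exists_layers [NeZero p] [Nontrivial (Fin p)] {q : ℕ} (hq : q ∈ G.classicalMod)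
    (hq2 : 2 ≤ q) (C : Circuit p a b) (hC : ∀ L ∈ C.layers, L.Allowed ⟨True, True, ∅⟩)
    {e : Fin p → Basis 2 k} (he : Function.Injective e)
    (ι : SimWire (Fin (a * k)) (Fin (b * k)) C.width p ↪ Fin W) (κ : SimReg C.regs p ↪ Fin R)
    (hO : HasOracle G ι κ m n) (hm : m = m₀ + 2) (hw : C.width * p < 2 ^ m₀) (hk : k ≤ m)
    (hp : p ≤ 2 ^ m) :
    ∃ Ls : List (Layer 2 W R), (∀ L ∈ Ls, L.Allowed G) ∧ Ls.length ≤ simDepth p C.depth n ∧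
      ∀ ρ, (⟨W, R, Function.Embedding.inl.trans ι, (outEmb _ _ _ _).trans ι, Ls⟩ :
        Circuit 2 (a * k) (b * k)).channel (encode e ρ) = encode e (C.channel ρ) := by
  have h₁ := reach_input hO hk hp hq he C.inp C.out
  have h₂ := reach_layers (α := Fin (a * k)) (β := Fin (b * k)) hO hm hw hq hq2 C.layers hC
  have h₃ := reach_output hO hk hp he C.inp C.out
  have h₁' := h₁.comp fun ρ : Op p a => fun _ => ρ
  have h₂' := h₂.comp fun ρ : Op p a => C.init ρ
  have h₃' := h₃.comp fun ρ : Op p a => C.layers.foldl (fun σ L => L.apply σ) (C.init ρ)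
  have hmid : ∀ ρ : Op p a, ext ι κ (push encReg (encWire _ _) (C.init ρ)) =
      ext ι κ (push (fun _ => encReg 0) (fun x => encWire _ _ (pad C.inp x)) fun _ : Unit => ρ) := by
    intro ρ
    rw [Circuit.init_eq]
    exact congrArg _ (push_push _ _ _ _ _)
  simp only [hmid] at h₂'
  obtain ⟨Ls, hL, hlen, hLs⟩ := (h₁'.trans h₂').trans h₃'
  refine ⟨Ls, hL, hlen.trans ?_, fun ρ => ?_⟩
  · unfold simDepth Circuit.depth; omega
  · rw [Circuit.channel, init_encode C e ι κ Ls ρ]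
    exact (congrArg _ (hLs ρ)).trans (final_outputLabel C e ι κ Ls _)

end Channel

/-! ### Size bounds. -/

section Size

variable {d w c : ℕ} [NeZero d]

/-- Gates with disjoint supports have different targets. So a layer is no larger than the number of
wires and registers, and for bounded depth only these have to be counted. -/
lemma Layer.size_le (L : Layer d w c) : L.size ≤ w + c := by
  cases L with
  | quantum gs hgs =>
    have h : (gs.map fun g => g.2.target).Nodup := by
      rw [List.Nodup, List.pairwise_map]
      refine hgs.imp fun {g h} hd he => ?_
      exact Finset.disjoint_left.1 hd g.2.target_mem_support (he ▸ h.2.target_mem_support)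
    have := h.length_le_card
    simp only [List.length_map, Fintype.card_fin] at this
    exact this.trans (Nat.le_add_right _ _)
  | measure m =>
    refine (Finset.sum_le_card_nsmul _ _ 1 fun r _ => ?_).trans (by simp)
    split_ifs <;> simp
  | classical u =>
    refine (Finset.sum_le_card_nsmul _ _ 1 fun r _ => ?_).trans (by simp)
    cases u r <;> simp [CGate.cost]

lemma Circuit.size_le {a b K : ℕ} (C : Circuit d a b) (hK : C.depth ≤ K) :
    C.size ≤ (K + 1) * (C.width + C.regs) := by
  have h := List.sum_le_card_nsmul (C.layers.map Layer.size) (C.width + C.regs) (by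
    intro s hs
    obtain ⟨L, -, rfl⟩ := List.mem_map.1 hs
    exact L.size_le)
  rw [List.length_map, smul_eq_mul] at h
  have h2 := Nat.mul_le_mul_right (C.width + C.regs) hK
  unfold Circuit.depth at h2
  unfold Circuit.size
  linarith

/-- A bound on the number of wires that the oracle of a simulation acts on. -/
def oracleBound {A : Type*} [CommSemiring A] (p k : A) (K : A) (S : A) : A :=
  S * (2 * k + p + p * p + 1) * (1 + 2 * (8 * (S * p + K + p)) ^ 2)

/-- A bound on the size of a simulation. -/
def sizeBound {A : Type*} [CommSemiring A] (p q k K n : A) (S : A) : A :=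
  (n + 1) * (oracleBound p k K S + 2 * q * oracleBound p k K S ^ 2 +
    (S * (p + p * p) + (4 * q * q + q + q * q) * oracleBound p k K S ^ 2 +
      q * oracleBound p k K S))

lemma eval_sizeBound (p q k K n : ℕ) (P : Polynomial ℕ) (x : ℕ) :
    (sizeBound (p : Polynomial ℕ) q k K n P).eval x = sizeBound p q k K n (P.eval x) := by
  simp [sizeBound, oracleBound]

end Size

/-! ### The parameters of the simulation. -/

section Simulation

variable {p q k a b : ℕ}

lemma card_oracleWire_le {X : Type*} [Fintype X] {m M S r : ℕ} (hX : Fintype.card X ≤ S * r)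
    (hM : 2 ^ m ≤ M) :
    Fintype.card (OracleWire X m) ≤ S * r * (1 + 2 * M ^ 2) := by
  have hm : m ≤ M := (Nat.lt_two_pow_self (n := m)).le.trans hM
  simp only [Fintype.card_sum, Fintype.card_prod, Fintype.card_fun, Fintype.card_fin]
  have h1 : 2 ^ m * m ≤ M ^ 2 := by rw [sq]; exact Nat.mul_le_mul hM hm
  have h2 : 2 ^ m * 2 ^ m ≤ M ^ 2 := by rw [sq]; exact Nat.mul_le_mul hM hM
  calc Fintype.card X + (Fintype.card X * (2 ^ m * m) + Fintype.card X * (2 ^ m * 2 ^ m))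
      = Fintype.card X * (1 + (2 ^ m * m + 2 ^ m * 2 ^ m)) := by ring
    _ ≤ S * r * (1 + 2 * M ^ 2) := Nat.mul_le_mul hX (by omega)

/-- With `m` logarithmic in the source size, the wires for all guesses and all parities are
polynomially many; the chains square this number. The depth bound contains `D`, `p` and `q`, but not
`S`. -/
theorem exists_simulation [Fact p.Prime] [Fact q.Prime] {e : Fin p → Basis 2 k}
    (he : Function.Injective e) (C : Circuit p a b)
    (hC : ∀ L ∈ C.layers, L.Allowed ⟨True, True, ∅⟩) {D S : ℕ} (hD : C.depth ≤ D)
    (hS : C.size ≤ S) :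
    ∃ C' : Circuit 2 (a * k) (b * k), (∀ L ∈ C'.layers, L.Allowed ⟨False, False, {q}⟩) ∧
      C'.depth ≤ simDepth p D (oracleDepth q) ∧
      C'.size ≤ sizeBound p q k (2 ^ k) (simDepth p D (oracleDepth q)) S ∧
      ∀ ρ, C'.channel (encode e ρ) = encode e (C.channel ρ) := by
  have hp2 : 2 ≤ p := (Fact.out : p.Prime).two_le
  have hq2 : 2 ≤ q := (Fact.out : q.Prime).two_le
  have : Nontrivial (Fin p) := Fin.nontrivial_iff_two_le.2 hp2
  have hw : C.width ≤ S := by unfold Circuit.size at hS; omega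
  have hc : C.regs ≤ S := by unfold Circuit.size at hS; omega
  have ha : a ≤ S := by simpa using (Fintype.card_le_of_embedding C.inp).trans (by simpa using hw)
  have hb : b ≤ S := by simpa using (Fintype.card_le_of_embedding C.out).trans (by simpa using hw)
  -- The summands make `2 ^ m₀` exceed the weighted sums of controls, the code words and the values
  -- of a qudit; still `2 ^ (m₀ + 2) ≤ 8 * x` is linear in `S`.
  set x := S * p + 2 ^ k + p
  set m₀ := Nat.log 2 x + 1 with hm₀
  have hpx : p ≤ x := Nat.le_add_left _ _
  have hkx : 2 ^ k ≤ x := (Nat.le_add_left _ _).trans (Nat.le_add_right _ _)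
  have hSx : S * p ≤ x := (Nat.le_add_right _ _).trans (Nat.le_add_right _ _)
  have hx0 : x ≠ 0 := by clear_value x; omega
  have hlt : x < 2 ^ m₀ := Nat.lt_pow_succ_log_self (by norm_num) x
  have hle : 2 ^ (m₀ + 2) ≤ 8 * x := by
    have := Nat.pow_log_le_self 2 hx0
    calc 2 ^ (m₀ + 2) = 8 * 2 ^ Nat.log 2 x := by rw [hm₀]; ring
      _ ≤ 8 * x := Nat.mul_le_mul_left _ this
  have hm2 : 2 ^ m₀ ≤ 2 ^ (m₀ + 2) := Nat.pow_le_pow_right (by norm_num) (by omega)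
  have hwp : C.width * p < 2 ^ m₀ :=
    (Nat.mul_le_mul_right p hw).trans_lt (hSx.trans_lt hlt)
  have hk : k ≤ m₀ + 2 := by
    have : 2 ^ k < 2 ^ (m₀ + 2) := (hkx.trans_lt hlt).trans_le hm2
    exact ((Nat.pow_lt_pow_iff_right (by norm_num)).1 this).le
  have hp : p ≤ 2 ^ (m₀ + 2) := (hpx.trans hlt.le).trans hm2
  let X := SimWire (Fin (a * k)) (Fin (b * k)) C.width p
  let O := OracleWire X (m₀ + 2)
  let Wt := ChainWire q O (Fintype.card O)
  let Rt := SimReg C.regs p ⊕ AuxReg q O (Fintype.card O)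
  let ι : Wt ↪ Fin (Fintype.card Wt) := (Fintype.equivFin Wt).toEmbedding
  let κ : Rt ↪ Fin (Fintype.card Rt) := (Fintype.equivFin Rt).toEmbedding
  have hO : HasOracle ⟨False, False, {q}⟩
      (Function.Embedding.inl.trans (Function.Embedding.inl.trans ι))
      (Function.Embedding.inl.trans κ) (m₀ + 2) (oracleDepth q) := fun wt g Z hZ =>
    impl_oracle (Set.mem_singleton q) (Fintype.equivFin O) ι κ wt g Z hZ
  obtain ⟨Ls, hL, hlen, hch⟩ := exists_layers (Set.mem_singleton q) hq2 C hC he _ _ hO rfl hwp hk hp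
  have hdepth : Ls.length ≤ simDepth p D (oracleDepth q) :=
    hlen.trans (Nat.add_le_add_left (Nat.mul_le_mul_right _ hD) _)
  refine ⟨⟨_, _, _, _, Ls⟩, hL, hdepth, (Circuit.size_le _ hdepth).trans ?_, hch⟩
  refine Nat.mul_le_mul_left _ ?_
  have hXc : Fintype.card X ≤ S * (2 * k + p + p * p + 1) := by
    simp only [X, Fintype.card_sum, Fintype.card_prod, Fintype.card_fin]
    have h1 := Nat.mul_le_mul_right k ha
    have h2 := Nat.mul_le_mul_right k hb
    have h3 := Nat.mul_le_mul_right p hw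
    have h4 := Nat.mul_le_mul_right (p * p) hw
    linarith
  have hOc : Fintype.card O ≤ oracleBound p k (2 ^ k) S := card_oracleWire_le hXc hle
  refine Nat.add_le_add ?_ ?_
  · have h1 : Fintype.card Wt = Fintype.card O + 2 * q * Fintype.card O ^ 2 := by
      simp only [Wt, Fintype.card_sum, Fintype.card_prod, Fintype.card_fin, Fintype.card_bool,
        ZMod.card]
      ring
    refine h1.trans_le ?_
    gcongr
  · have h1 : Fintype.card Rt = C.regs * (p + p * p) +
        (4 * q * q + q + q * q) * Fintype.card O ^ 2 + q * Fintype.card O := by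
      simp only [Rt, Fintype.card_sum, Fintype.card_prod, Fintype.card_fin, Fintype.card_bool,
        ZMod.card]
      ring
    refine h1.trans_le ?_
    gcongr

end Simulation

end QuditCircuit

theorem theorem3p10 (p q : ℕ) [Fact p.Prime] [Fact q.Prime]
    (k : ℕ) (e : Fin p → QuditCircuit.Basis 2 k) (he : Function.Injective e)
    (a b : ℕ → ℕ)
    (Φ : (n : ℕ) → QuditCircuit.Op p (a n) → QuditCircuit.Op p (b n))
    (hΦ : Φ ∈ QuditCircuit.iQTC0 p a b) :
    ∃ Ψ ∈ QuditCircuit.iQNC0c 2 q (fun n => a n * k) (fun n => b n * k),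
      ∀ (n : ℕ) (ρ : QuditCircuit.Op p (a n)),
        Ψ n (QuditCircuit.encode e ρ) = QuditCircuit.encode e (Φ n ρ) := by
  obtain ⟨C, D, P, hC⟩ := hΦ
  choose C' hA hd hs hch using fun n => QuditCircuit.exists_simulation (q := q) he (C n) (hC n).1
    (hC n).2.1 (hC n).2.2.1
  refine ⟨fun n => (C' n).channel, ⟨C', _, _, fun n => ⟨hA n, hd n, (hs n).trans_eq
    (QuditCircuit.eval_sizeBound p q k (2 ^ k) _ P n).symm, rfl⟩⟩, fun n ρ => ?_⟩
  exact (hch n ρ).trans (by rw [(hC n).2.2.2])
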